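/- Let $3\le p\le q$ be integers and let $T_{p,q}$ be the torus link (a knot when $\gcd(p,q)=1$) given by its standard diagram $D_{p,q}$, the closure of the $p$-strand positive braid $(\sigma_1\sigma_2\cdots\sigma_{p-1})^q$. Let $\mathcal H^{i,j}(T_{p,q})$ denote its integral Khovanov homology group in homological degree $i$ and quantum degree $j$. It is computed from $D_{p,q}$ as the homology of the Khovanov cube complex, built from the free graded group $V=\mathbb Z 1\oplus\mathbb Z X$ with $\deg 1=1$, $\deg X=-1$, with multiplication and comultiplication $$m(1\otimes 1)=1,\quad m(1\otimes X)=m(X\otimes 1)=X,\quad m(X\otimes X)=0,$$ $$\Delta(1)=1\otimes X+X\otimes 1,\quad \Delta(X)=X\otimes X,$$ and shifted by $[-n_-]\{n_+-2n_-\}$, where $n_\pm$ are the numbers of positive and negative crossings of the diagram. Then $$\operatorname{rank}\,\mathcal H^{4,\,(p-1)(q-1)+5}(T_{p,q})>0 .$$ -/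

import Mathlib

/-- A crossing of an oriented link diagram whose edges are labelled by `E`. The four edges at the
crossing are listed counterclockwise, starting from the incoming end of the lower strand: the lower
strand runs from `a` to `c`, and the upper strand joins `b` and `d`. The crossing is positive iff
the upper strand runs from `d` to `b`, and negative iff it runs from `b` to `d`. -/
structure Crossing (E : Type) where
  a : E
  b : E
  c : E
  d : E
  positive : Bool

/-- The pairs of edges that are connected in the `0`-resolution (`false`) and in the `1`-resolution
(`true`) of a crossing. The `0`-resolution of a positive crossing and the `1`-resolution of a
negative crossing are the ones compatible with the orientation. -/
def Crossing.Connects {E : Type} (X : Crossing E) : Bool → E → E → Prop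
  | false, x, y => (x = X.a ∧ y = X.b) ∨ (x = X.c ∧ y = X.d)
  | true, x, y => (x = X.a ∧ y = X.d) ∨ (x = X.b ∧ y = X.c)

/-- Combinatorial code of an oriented link diagram (a planar diagram code): finitely many edges and
an ordered list of crossings. An edge of the diagram may be subdivided into several labelled pieces;
`join x y` says that the pieces `x` and `y` meet at a subdivision point. -/
structure LinkDiagram where
  Edge : Type
  [finite_edge : Finite Edge]
  n : ℕ
  crossing : Fin n → Crossing Edge
  join : Edge → Edge → Prop

attribute [instance] LinkDiagram.finite_edge

/-- The two basis elements `1` and `X` of the graded module `V`. -/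
inductive Label where
  | one
  | X
  deriving DecidableEq

instance : Fintype Label := ⟨{Label.one, Label.X}, fun u => by cases u <;> simp⟩

namespace Label

/-- `deg 1 = 1` and `deg X = -1`. -/
def deg : Label → ℤ
  | one => 1
  | X => -1

/-- `mulCoeff u v w` is the coefficient of `w` in `m (u ⊗ v)`. -/
def mulCoeff : Label → Label → Label → ℤ
  | one, one, one => 1
  | one, X, X => 1
  | X, one, X => 1
  | _, _, _ => 0

/-- `comulCoeff u v w` is the coefficient of `v ⊗ w` in `Δ u`. -/
def comulCoeff : Label → Label → Label → ℤ
  | one, one, X => 1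
  | one, X, one => 1
  | X, X, X => 1
  | _, _, _ => 0

end Label

namespace LinkDiagram

/-- The circles of the total resolution of `D` given by `ε`. -/
def Circle (D : LinkDiagram) (ε : Fin D.n → Bool) : Type :=
  Quot fun x y : D.Edge => D.join x y ∨ ∃ k, (D.crossing k).Connects (ε k) x y

instance (D : LinkDiagram) (ε : Fin D.n → Bool) : Finite (D.Circle ε) :=
  inferInstanceAs (Finite (Quot _))

noncomputable instance (D : LinkDiagram) (ε : Fin D.n → Bool) : Fintype (D.Circle ε) :=
  Fintype.ofFinite _

/-- The standard basis elements of `⨁_ε V_ε`, where `V_ε` is the tensor product of copies of `V`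
over the circles of the resolution `ε`: a resolution with a label `1` or `X` on each circle. -/
structure State (D : LinkDiagram) where
  res : Fin D.n → Bool
  label : D.Circle res → Label

instance (D : LinkDiagram) : Finite D.State :=
  Finite.of_injective
    (fun s : D.State => (⟨s.res, s.label⟩ : Σ ε : Fin D.n → Bool, D.Circle ε → Label)) (by
      rintro ⟨r, l⟩ ⟨r', l'⟩ h
      cases h
      rfl)

namespace State

variable {D : LinkDiagram}

/-- The circle of the underlying resolution that contains the edge `x`. -/
def circle (s : D.State) (x : D.Edge) : D.Circle s.res := Quot.mk _ x

/-- The label of the circle that contains the edge `x`. -/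
def labelAt (s : D.State) (x : D.Edge) : Label := s.label (s.circle x)

/-- The number `|ε|` of crossings resolved into their `1`-resolution. -/
def height (s : D.State) : ℕ := (Finset.univ.filter fun k => s.res k = true).card

/-- The degree in `V_ε{|ε|}`. -/
noncomputable def qdeg (s : D.State) : ℤ := ∑ z, (s.label z).deg + s.height

end State

open Classical in
/-- The coefficient of `t` in the image of `s` under the per-edge map that changes the crossing `k`
from its `0`- to its `1`-resolution (for `t.res = Function.update s.res k true`): the labels of
the circles not touching the crossing stay unchanged; if one circle splits into two, `Δ` is applied;
if two circles merge, `m` is applied. (For codes of planar diagrams one of these two cases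
occurs; otherwise a circle may become one circle, and the coefficient is then set to `0`.) -/
noncomputable def edgeCoeff (D : LinkDiagram) (k : Fin D.n) (s t : D.State) : ℤ :=
  if ∀ x, s.circle x ≠ s.circle (D.crossing k).a → s.circle x ≠ s.circle (D.crossing k).c →
      t.labelAt x = s.labelAt x then
    if s.circle (D.crossing k).a = s.circle (D.crossing k).c then
      if t.circle (D.crossing k).a = t.circle (D.crossing k).c then 0
      else Label.comulCoeff (s.labelAt (D.crossing k).a)
        (t.labelAt (D.crossing k).a) (t.labelAt (D.crossing k).c)
    else Label.mulCoeff (s.labelAt (D.crossing k).a) (s.labelAt (D.crossing k).c)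
      (t.labelAt (D.crossing k).a)
  else 0

open Classical in
/-- The coefficient of `t` in the differential of `s`: the sum over the edges of the cube from the
resolution of `s` to that of `t`, with sign `(-1)^f`, where `f` is the number of `1`-resolved
crossings before the one that changes. -/
noncomputable def diffCoeff (D : LinkDiagram) (s t : D.State) : ℤ :=
  ∑ k : Fin D.n, if s.res k = false ∧ t.res = Function.update s.res k true then
    (-1) ^ (Finset.univ.filter fun l => l < k ∧ s.res l = true).card * D.edgeCoeff k s t
  else 0

/-- The standard basis of the degree `j` part of the `i`-th chain group. -/
def Gen (D : LinkDiagram) (i j : ℤ) : Type := {s : D.State // (s.height : ℤ) = i ∧ s.qdeg = j}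

instance (D : LinkDiagram) (i j : ℤ) : Finite (D.Gen i j) :=
  inferInstanceAs (Finite {s : D.State // (s.height : ℤ) = i ∧ s.qdeg = j})

noncomputable instance (D : LinkDiagram) (i j : ℤ) : Fintype (D.Gen i j) := Fintype.ofFinite _

/-- `C^{i,j}(D)`, the degree `j` part of the `i`-th chain group. -/
abbrev Chain (D : LinkDiagram) (i j : ℤ) : Type := D.Gen i j → ℤ

/-- The component `C^{i,j}(D) → C^{i',j}(D)` of the differential (zero unless `i' = i + 1`). -/
noncomputable def diff (D : LinkDiagram) (i i' j : ℤ) : D.Chain i j →ₗ[ℤ] D.Chain i' j :=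
  (Matrix.of fun (t : D.Gen i' j) (s : D.Gen i j) => D.diffCoeff s.1 t.1).mulVecLin

/-- The unnormalized homology group `H^{i,j}(D)`: the kernel of `C^{i,j} → C^{i+1,j}` modulo the
image of `C^{i-1,j} → C^{i,j}`. -/
abbrev UnnormalizedHomology (D : LinkDiagram) (i j : ℤ) : Type :=
  LinearMap.ker (D.diff i (i + 1) j) ⧸
    (LinearMap.range (D.diff (i - 1) i j)).submoduleOf (LinearMap.ker (D.diff i (i + 1) j))

/-- The number of positive crossings. -/
def nPos (D : LinkDiagram) : ℕ := (Finset.univ.filter fun k => (D.crossing k).positive = true).card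

/-- The number of negative crossings. -/
def nNeg (D : LinkDiagram) : ℕ := (Finset.univ.filter fun k => (D.crossing k).positive = false).card

/-- The Khovanov homology group in homological degree `i` and quantum degree `j`, that is, the
homology of `C(D)[-n₋]{n₊ - 2 n₋}`. -/
abbrev KhovanovHomology (D : LinkDiagram) (i j : ℤ) : Type :=
  D.UnnormalizedHomology (i + D.nNeg) (j - D.nPos + 2 * D.nNeg)

end LinkDiagram

/-- A braid word on `p` strands; `(i, true)` and `(i, false)` stand for the generator exchanging the
strands at the positions `i` and `i + 1` (counted from `0`) and for its inverse. -/
abbrev BraidWord (p : ℕ) : Type := List (Fin (p - 1) × Bool)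

namespace BraidWord

variable {p : ℕ}

/-- The left one of the two positions that a generator acts on. -/
def left (i : Fin (p - 1)) : Fin p := ⟨i.1, by omega⟩

/-- The right one of the two positions that a generator acts on. -/
def right (i : Fin (p - 1)) : Fin p := ⟨i.1 + 1, by omega⟩

/-- The closure of a braid word, drawn from top to bottom, with all strands oriented upwards.
The piece `(t, x)` is the strand at position `x` on the horizontal level just above the `t`-th letter
(below all letters for `t = w.length`); the `t`-th letter lies between the levels `t` and
`t + 1`, and the closing strands join the lowest level to the level `0`. -/
def closure (w : BraidWord p) : LinkDiagram where
  Edge := Fin (w.length + 1) × Fin p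
  n := w.length
  crossing t :=
    if (w.get t).2 then
      { a := (t.succ, right (w.get t).1)
        b := (t.castSucc, right (w.get t).1)
        c := (t.castSucc, left (w.get t).1)
        d := (t.succ, left (w.get t).1)
        positive := true }
    else
      { a := (t.succ, left (w.get t).1)
        b := (t.succ, right (w.get t).1)
        c := (t.castSucc, right (w.get t).1)
        d := (t.castSucc, left (w.get t).1)
        positive := false }
  join x y :=
    (x.1 = Fin.last w.length ∧ y.1 = 0 ∧ x.2 = y.2) ∨
      ∃ t : Fin w.length, x.1 = t.castSucc ∧ y.1 = t.succ ∧ x.2 = y.2 ∧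
        x.2 ≠ left (w.get t).1 ∧ x.2 ≠ right (w.get t).1

/-- The braid word `(σ₁ σ₂ ⋯ σ_{p-1})^q`, with positive generators. -/
def torus (p q : ℕ) : BraidWord p :=
  (List.replicate q ((List.finRange (p - 1)).map fun i => (i, true))).flatten

end BraidWord

/-- The standard diagram `D_{p,q}` of the torus link `T_{p,q}`. -/
def torusLink (p q : ℕ) : LinkDiagram := (BraidWord.torus p q).closure

/-!
The diagram of the torus link has `(p - 1) q` crossings, all of them positive, so that the claim
concerns the homology of the unnormalized cube complex in height `4` and quantum degree `6 - p`. A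
class of infinite order is detected by a cycle `z` and an integral functional `φ` on chains with
`φ ∘ d = 0` and `φ z ≠ 0` (`LinkDiagram.finrank_unnormalizedHomology_pos`). Chains are handled as
functions on the set of all states, on which the whole complex has one `differential`.

*The cycle.* Number the letters of the braid word in the first two columns (the letters `σ₁`, `σ₂`)
by `0, 1, 2, …`, and `0`-resolve everything but the letters `0, …, 5`. On the resolutions that use
the letters `0, 1, 3, 4` and `0, 2, 3, 4`, label the circles through the closing strands at the
positions `0` and `2` by `X` and everything else by `1`. The sum of these two states is a cycle
(`initialCycle`): the two boundary terms at `0, 1, 2, 3, 4` cancel, and the letter `5` connects the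
two circles labelled `X`, where `X² = 0`. It is extended over the remaining crossings, one at a time
and column by column.

* If the states that use the new crossing form an acyclic quotient complex, there is no obstruction
  (`IsPartialCycle.exists_insert`). The acyclicity holds in the one relevant quantum degree. It
  follows by moving the new crossing through the braid closure with chain level forms of the first
  two Reidemeister moves (`IsAcyclic.of_curl`, `IsAcyclic.of_slide`): these use up more and more
  columns, or split off circles with the label `1`, until the lower bound `le_qdeg_add` for the
  quantum degree shows that no state is left (`isAcyclic_two_columns`, `isAcyclic_next_column`).
* The first crossing in a column `c ≥ 2` joins an untouched strand. There multiplication by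
  `X ⊗ 1 - 1 ⊗ X` makes the cycle extend by zero (`IsPartialCycle.insert_mulX_sub`). This lowers the
  degree by `2` and turns the label of the new strand into `X`. After the columns `2, …, p - 2` the
  quantum degree is `p - 2 (p - 3) = 6 - p`.

On states that use the first six letters only, the values of the resulting cycle are those of
`initialCycle` (`exists_columns`).

*The cocycle.* The functional `cocycle` is supported on twelve states that use four of the first six
letters. That it vanishes on boundaries is a finite computation once the circles of these
resolutions are known. They are found by walking along the `18` strands between the letters (`next`,
`reaches`). The cycle vanishes on all of the twelve states but one, where it has the value `1`.

The argument uses of planarity only that the number of circles changes along each edge of the cube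
(`LinkDiagram.IsPlanar`); this makes `d² = 0` and the quantum degree invariant. For braid closures
it holds because all resolutions are compatible with the orientation that alternates between
adjacent strands, so that the circles are the cycles of a permutation of the edges, and changing a
resolution multiplies this permutation by a transposition (`BraidWord.isPlanar_closure`).
-/


namespace LinkDiagram

variable {D : LinkDiagram}

/-! ### The circles of a resolution -/

/-- The circle of the resolution `ε` that contains the edge `x`. -/
def circ (D : LinkDiagram) (ε : Fin D.n → Bool) (x : D.Edge) : D.Circle ε := Quot.mk _ x

theorem exists_circ (ε : Fin D.n → Bool) (z : D.Circle ε) : ∃ x, D.circ ε x = z :=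
  Quot.exists_rep z

/-- Two edges lie on the same circle of the resolution `ε`. -/
def Conn (D : LinkDiagram) (ε : Fin D.n → Bool) (x y : D.Edge) : Prop :=
  D.circ ε x = D.circ ε y

section Conn

variable {ε ε' : Fin D.n → Bool} {k : Fin D.n} {x y z : D.Edge}

@[refl] theorem Conn.refl (ε : Fin D.n → Bool) (x : D.Edge) : D.Conn ε x x := rfl

theorem Conn.symm (h : D.Conn ε x y) : D.Conn ε y x := Eq.symm h

theorem Conn.trans (h : D.Conn ε x y) (h' : D.Conn ε y z) : D.Conn ε x z := Eq.trans h h'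

theorem conn_comm : D.Conn ε x y ↔ D.Conn ε y x := ⟨Conn.symm, Conn.symm⟩

theorem conn_of_join (h : D.join x y) : D.Conn ε x y := Quot.sound (Or.inl h)

theorem conn_of_connects (h : (D.crossing k).Connects (ε k) x y) : D.Conn ε x y :=
  Quot.sound (Or.inr ⟨k, h⟩)

/-- To bound `Conn` from above it suffices to find an equivalence relation that contains the
generating pairs. -/
theorem Conn.rec_equivalence {r : D.Edge → D.Edge → Prop} (hr : Equivalence r)
    (hj : ∀ x y, D.join x y → r x y)
    (hc : ∀ k x y, (D.crossing k).Connects (ε k) x y → r x y) (h : D.Conn ε x y) : r x y := by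
  have := Quot.eqvGen_exact h
  induction this with
  | rel a b hab =>
    rcases hab with hab | ⟨k, hab⟩
    · exact hj _ _ hab
    · exact hc _ _ _ hab
  | refl a => exact hr.refl a
  | symm a b _ ih => exact hr.symm (ih (Quot.eqvGen_sound ‹_›))
  | trans a b c _ _ ih1 ih2 =>
    exact hr.trans (ih1 (Quot.eqvGen_sound ‹_›)) (ih2 (Quot.eqvGen_sound ‹_›))

theorem conn_ab (h : ε k = false) : D.Conn ε (D.crossing k).a (D.crossing k).b :=
  conn_of_connects (k := k) (by rw [h]; exact Or.inl ⟨rfl, rfl⟩)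

theorem conn_cd (h : ε k = false) : D.Conn ε (D.crossing k).c (D.crossing k).d :=
  conn_of_connects (k := k) (by rw [h]; exact Or.inr ⟨rfl, rfl⟩)

theorem conn_ad (h : ε k = true) : D.Conn ε (D.crossing k).a (D.crossing k).d :=
  conn_of_connects (k := k) (by rw [h]; exact Or.inl ⟨rfl, rfl⟩)

theorem conn_bc (h : ε k = true) : D.Conn ε (D.crossing k).b (D.crossing k).c :=
  conn_of_connects (k := k) (by rw [h]; exact Or.inr ⟨rfl, rfl⟩)

/-- The circle of `x` touches the crossing `k`. -/
def Touch (D : LinkDiagram) (ε : Fin D.n → Bool) (k : Fin D.n) (x : D.Edge) : Prop :=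
  D.Conn ε x (D.crossing k).a ∨ D.Conn ε x (D.crossing k).c

theorem touch_a (ε : Fin D.n → Bool) (k : Fin D.n) : D.Touch ε k (D.crossing k).a :=
  Or.inl (Conn.refl _ _)

theorem touch_c (ε : Fin D.n → Bool) (k : Fin D.n) : D.Touch ε k (D.crossing k).c :=
  Or.inr (Conn.refl _ _)

theorem Touch.of_conn (h : D.Touch ε k y) (h' : D.Conn ε x y) : D.Touch ε k x :=
  h.imp h'.trans h'.trans

/-- Changing the resolution of one crossing, in such a way that afterwards only one circle touches
it, glues together the circles that touched it before. -/
theorem conn_iff_of_conn (h : ∀ l, l ≠ k → ε' l = ε l)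
    (hac : D.Conn ε' (D.crossing k).a (D.crossing k).c) :
    D.Conn ε' x y ↔ D.Conn ε x y ∨ (D.Touch ε k x ∧ D.Touch ε k y) := by
  have hb : D.Touch ε k (D.crossing k).b := by
    cases hk : ε k
    · exact Or.inl (conn_ab hk).symm
    · exact Or.inr (conn_bc hk)
  have hd : D.Touch ε k (D.crossing k).d := by
    cases hk : ε k
    · exact Or.inr (conn_cd hk).symm
    · exact Or.inl (conn_ad hk).symm
  have hb' : D.Conn ε' (D.crossing k).b (D.crossing k).a := by
    cases hk : ε' k
    · exact (conn_ab hk).symm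
    · exact (conn_bc hk).trans hac.symm
  have hd' : D.Conn ε' (D.crossing k).d (D.crossing k).a := by
    cases hk : ε' k
    · exact (conn_cd hk).symm.trans hac.symm
    · exact (conn_ad hk).symm
  have key : ∀ {x y}, D.Conn ε x y → D.Conn ε' x y := fun {x y} hxy => by
    refine Conn.rec_equivalence ⟨Conn.refl _, Conn.symm, Conn.trans⟩
      (fun _ _ => conn_of_join) (fun l x y hl => ?_) hxy
    by_cases hlk : l = k
    · subst hlk
      cases hε : ε l <;> rw [hε] at hl <;> rcases hl with ⟨rfl, rfl⟩ | ⟨rfl, rfl⟩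
      · exact hb'.symm
      · exact hac.symm.trans hd'.symm
      · exact hd'.symm
      · exact hb'.trans hac
    · exact conn_of_connects (k := l) (by rwa [h l hlk])
  have key' : ∀ {x}, D.Touch ε k x → D.Conn ε' x (D.crossing k).a := fun {x} hx =>
    hx.elim key fun hx => (key hx).trans hac.symm
  constructor
  · refine Conn.rec_equivalence
      (r := fun x y => D.Conn ε x y ∨ (D.Touch ε k x ∧ D.Touch ε k y))
      ⟨fun _ => Or.inl (Conn.refl _ _), ?_, ?_⟩
      (fun _ _ hj => Or.inl (conn_of_join hj)) (fun l x y hl => ?_)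
    · rintro x y (hxy | hxy)
      exacts [Or.inl hxy.symm, Or.inr hxy.symm]
    · rintro x y z (hxy | ⟨hx, hy⟩) (hyz | ⟨hy', hz⟩)
      · exact Or.inl (hxy.trans hyz)
      · exact Or.inr ⟨hy'.of_conn hxy, hz⟩
      · exact Or.inr ⟨hx, hy.of_conn hyz.symm⟩
      · exact Or.inr ⟨hx, hz⟩
    · by_cases hlk : l = k
      · subst hlk
        refine Or.inr ?_
        have ha := touch_a (D := D) ε l
        have hc := touch_c (D := D) ε l
        cases hε : ε' l <;> rw [hε] at hl <;> rcases hl with ⟨rfl, rfl⟩ | ⟨rfl, rfl⟩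
        exacts [⟨ha, hb⟩, ⟨hc, hd⟩, ⟨ha, hd⟩, ⟨hb, hc⟩]
      · exact Or.inl (conn_of_connects (k := l) (by rwa [← h l hlk]))
  · rintro (hxy | ⟨hx, hy⟩)
    · exact key hxy
    · exact (key' hx).trans (key' hy).symm

theorem touch_iff_of_conn (h : ∀ l, l ≠ k → ε' l = ε l)
    (hac : D.Conn ε' (D.crossing k).a (D.crossing k).c) :
    D.Touch ε' k x ↔ D.Touch ε k x := by
  have h1 := conn_iff_of_conn (x := x) (y := (D.crossing k).a) h hac
  have h2 := conn_iff_of_conn (x := x) (y := (D.crossing k).c) h hac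
  have ha := touch_a (D := D) ε k
  have hc := touch_c (D := D) ε k
  unfold Touch at *
  tauto

/-- Comparison of two sums over circles along an edge of the cube: only the circles at the crossing
contribute to the difference. -/
theorem sum_circle_of_conn (h : ∀ l, l ≠ k → ε' l = ε l)
    (hac : D.Conn ε' (D.crossing k).a (D.crossing k).c)
    (hnac : ¬ D.Conn ε (D.crossing k).a (D.crossing k).c)
    (g : D.Circle ε → ℤ) (g' : D.Circle ε' → ℤ)
    (hg : ∀ x, ¬ D.Touch ε k x → g (D.circ ε x) = g' (D.circ ε' x)) :
    ∑ z, g z + g' (D.circ ε' (D.crossing k).a) =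
      ∑ z, g' z + g (D.circ ε (D.crossing k).a) + g (D.circ ε (D.crossing k).c) := by
  classical
  set A := D.circ ε (D.crossing k).a with hA
  set C := D.circ ε (D.crossing k).c with hC
  set A' := D.circ ε' (D.crossing k).a with hA'
  have hAC : A ≠ C := hnac
  have hmap : ∀ x y, D.Conn ε x y → D.Conn ε' x y := fun x y hxy =>
    (conn_iff_of_conn h hac).2 (Or.inl hxy)
  let π : D.Circle ε → D.Circle ε' :=
    Quot.lift (D.circ ε') fun x y hxy => hmap x y (Quot.sound hxy)
  have hπ : ∀ x, π (D.circ ε x) = D.circ ε' x := fun _ => rfl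
  have hne : ∀ x, ¬ D.Touch ε k x ↔ (D.circ ε x ≠ A ∧
      D.circ ε x ≠ C) := fun x => by
    unfold Touch Conn; tauto
  have hne' : ∀ x, ¬ D.Touch ε k x ↔ D.circ ε' x ≠ A' := fun x => by
    rw [not_iff_not]
    have := conn_iff_of_conn (x := x) (y := (D.crossing k).a) h hac
    have h0 : D.Conn ε' x (D.crossing k).a ↔ D.circ ε' x = A' := Iff.rfl
    rw [← h0, this]
    have ha := touch_a (D := D) ε k
    unfold Touch at *
    tauto
  have key : ∑ z ∈ (Finset.univ.erase A).erase C, g z = ∑ z ∈ Finset.univ.erase A', g' z := by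
    refine Finset.sum_bij (fun z _ => π z) ?_ ?_ ?_ ?_
    · intro z hx
      obtain ⟨x, rfl⟩ := exists_circ _ z
      simp only [Finset.mem_erase, Finset.mem_univ, and_true] at hx ⊢
      exact (hne' x).1 ((hne x).2 ⟨hx.2, hx.1⟩)
    · intro z hx z' hy hxy
      obtain ⟨x, rfl⟩ := exists_circ _ z
      obtain ⟨y, rfl⟩ := exists_circ _ z'
      simp only [Finset.mem_erase, Finset.mem_univ, and_true] at hx
      have hxy' : D.Conn ε' x y := hxy
      rw [conn_iff_of_conn h hac] at hxy'
      rcases hxy' with h1 | h1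
      · exact h1
      · exact absurd h1.1 ((hne x).2 ⟨hx.2, hx.1⟩)
    · intro z hx
      obtain ⟨x, rfl⟩ := exists_circ _ z
      simp only [Finset.mem_erase, Finset.mem_univ, and_true] at hx
      have := (hne x).1 ((hne' x).2 hx)
      exact ⟨D.circ ε x, by simpa using ⟨this.2, this.1⟩, rfl⟩
    · intro z hx
      obtain ⟨x, rfl⟩ := exists_circ _ z
      simp only [Finset.mem_erase, Finset.mem_univ, and_true] at hx
      exact hg x ((hne x).2 ⟨hx.2, hx.1⟩)
  rw [← Finset.add_sum_erase Finset.univ g (Finset.mem_univ A),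
    ← Finset.add_sum_erase (Finset.univ.erase A) g (a := C) (by simp [hAC.symm]), key,
    ← Finset.add_sum_erase Finset.univ g' (Finset.mem_univ A')]
  ring

end Conn

/-! ### Planarity and states -/

/-- Along every edge of the cube of resolutions the number of circles changes. For planar diagrams
this holds because the circles can be oriented coherently. -/
def IsPlanar (D : LinkDiagram) : Prop :=
  ∀ (ε : Fin D.n → Bool) (k : Fin D.n), ε k = false →
    (D.Conn (Function.update ε k true) (D.crossing k).a (D.crossing k).c ↔
      ¬ D.Conn ε (D.crossing k).a (D.crossing k).c)

namespace State

variable {s t : D.State} {x y : D.Edge}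

theorem labelAt_congr (h : D.Conn s.res x y) : s.labelAt x = s.labelAt y :=
  congrArg s.label h

theorem ext_labelAt (h : s.res = t.res) (h' : ∀ x, s.labelAt x = t.labelAt x) : s = t := by
  obtain ⟨r, l⟩ := s
  obtain ⟨r', l'⟩ := t
  obtain rfl : r = r' := h
  congr 1
  funext z
  induction z using Quot.ind with
  | mk x => exact h' x

/-- The state with resolution `ε` in which the edge `x` has the label `f x`. -/
def ofLabel (ε : Fin D.n → Bool) (f : D.Edge → Label)
    (hf : ∀ x y, D.Conn ε x y → f x = f y) : D.State where
  res := ε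
  label := Quot.lift f fun x y h => hf x y (Quot.sound h)

open Classical in
/-- The state obtained by changing the label of the circle of `e` to `v`. -/
noncomputable def set (s : D.State) (e : D.Edge) (v : Label) : D.State :=
  ofLabel s.res (fun x => if D.Conn s.res x e then v else s.labelAt x) fun x y h => by
    have : D.Conn s.res x e ↔ D.Conn s.res y e := ⟨h.symm.trans, h.trans⟩
    simp only [this, labelAt_congr h]

@[simp] theorem set_res (s : D.State) (e : D.Edge) (v : Label) : (s.set e v).res = s.res := rfl

open Classical in
theorem set_labelAt (s : D.State) (e : D.Edge) (v : Label) (x : D.Edge) :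
    (s.set e v).labelAt x = if D.Conn s.res x e then v else s.labelAt x := rfl

@[simp] theorem set_labelAt_self (s : D.State) (e : D.Edge) (v : Label) :
    (s.set e v).labelAt e = v := by
  rw [set_labelAt, if_pos (Conn.refl _ _)]

theorem set_labelAt_of_conn (v : Label) (h : D.Conn s.res x y) : (s.set y v).labelAt x = v := by
  rw [set_labelAt, if_pos h]

theorem set_labelAt_of_not_conn (v : Label) (h : ¬ D.Conn s.res x y) :
    (s.set y v).labelAt x = s.labelAt x := by
  rw [set_labelAt, if_neg h]

theorem set_set (s : D.State) (e : D.Edge) (v w : Label) : (s.set e v).set e w = s.set e w :=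
  ext_labelAt rfl fun x => by
    by_cases h : D.Conn s.res x e
    · rw [set_labelAt_of_conn w (s := s.set e v) h, set_labelAt_of_conn w h]
    · rw [set_labelAt_of_not_conn w (s := s.set e v) h, set_labelAt_of_not_conn w h,
        set_labelAt_of_not_conn v h]

theorem set_self {v : Label} (h : s.labelAt x = v) : s.set x v = s :=
  ext_labelAt rfl fun y => by
    rw [set_labelAt]; split_ifs with hy
    · rw [labelAt_congr hy, h]
    · rfl

theorem set_comm (h : ¬ D.Conn s.res x y) (v w : Label) :
    (s.set x v).set y w = (s.set y w).set x v :=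
  ext_labelAt rfl fun z => by
    by_cases h1 : D.Conn s.res z x
    · have h2 : ¬ D.Conn s.res z y := fun h2 => h (h1.symm.trans h2)
      rw [set_labelAt_of_not_conn w (s := s.set x v) h2, set_labelAt_of_conn v h1,
        set_labelAt_of_conn v (s := s.set y w) h1]
    · rw [set_labelAt_of_not_conn v (s := s.set y w) h1]
      by_cases h2 : D.Conn s.res z y
      · rw [set_labelAt_of_conn w (s := s.set x v) h2, set_labelAt_of_conn w h2]
      · rw [set_labelAt_of_not_conn w (s := s.set x v) h2, set_labelAt_of_not_conn v h1,
          set_labelAt_of_not_conn w h2]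

theorem set_congr (h : D.Conn s.res x y) (v : Label) : s.set x v = s.set y v :=
  ext_labelAt rfl fun z => by
    by_cases h1 : D.Conn s.res z x
    · rw [set_labelAt_of_conn v h1, set_labelAt_of_conn v (h1.trans h)]
    · rw [set_labelAt_of_not_conn v h1,
        set_labelAt_of_not_conn v fun h2 => h1 (h2.trans h.symm)]

end State

open Classical in
theorem edgeCoeff_merge {k : Fin D.n} {s t : D.State}
    (h : ¬ D.Conn s.res (D.crossing k).a (D.crossing k).c) :
    D.edgeCoeff k s t = if ∀ x, ¬ D.Touch s.res k x → t.labelAt x = s.labelAt x then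
      Label.mulCoeff (s.labelAt (D.crossing k).a) (s.labelAt (D.crossing k).c)
        (t.labelAt (D.crossing k).a) else 0 := by
  unfold edgeCoeff
  have h1 : ¬ (s.circle (D.crossing k).a = s.circle (D.crossing k).c) := h
  simp only [if_neg h1, Touch, not_or, and_imp]
  rfl

open Classical in
theorem edgeCoeff_split {k : Fin D.n} {s t : D.State}
    (h : D.Conn s.res (D.crossing k).a (D.crossing k).c)
    (h' : ¬ D.Conn t.res (D.crossing k).a (D.crossing k).c) :
    D.edgeCoeff k s t = if ∀ x, ¬ D.Touch s.res k x → t.labelAt x = s.labelAt x then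
      Label.comulCoeff (s.labelAt (D.crossing k).a) (t.labelAt (D.crossing k).a)
        (t.labelAt (D.crossing k).c) else 0 := by
  unfold edgeCoeff
  have h1 : (s.circle (D.crossing k).a = s.circle (D.crossing k).c) := h
  have h2 : ¬ (t.circle (D.crossing k).a = t.circle (D.crossing k).c) := h'
  simp only [if_pos h1, if_neg h2, Touch, not_or, and_imp]
  rfl

theorem height_update {s t : D.State} {k : Fin D.n} (hk : s.res k = false)
    (ht : t.res = Function.update s.res k true) : t.height = s.height + 1 := by
  classical
  unfold State.height
  rw [ht]
  have : (Finset.univ.filter fun l => Function.update s.res k true l = true) =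
      insert k (Finset.univ.filter fun l => s.res l = true) := by
    ext l
    by_cases hl : l = k <;> simp [Function.update, hl]
  rw [this, Finset.card_insert_of_notMem (by simp [hk])]

/-- The per-edge maps have degree `0`. -/
theorem qdeg_eq_of_edgeCoeff_ne_zero (hD : D.IsPlanar) {s t : D.State} {k : Fin D.n}
    (hk : s.res k = false) (ht : t.res = Function.update s.res k true)
    (h : D.edgeCoeff k s t ≠ 0) : t.qdeg = s.qdeg := by
  classical
  unfold State.qdeg
  rw [height_update hk ht]
  have hoff : ∀ l, l ≠ k → t.res l = s.res l := fun l hl => by rw [ht, Function.update_of_ne hl]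
  by_cases hac : D.Conn s.res (D.crossing k).a (D.crossing k).c
  · have hac' : ¬ D.Conn t.res (D.crossing k).a (D.crossing k).c := by
      rw [ht, hD _ _ hk]; exact not_not.2 hac
    rw [edgeCoeff_split hac hac'] at h
    have hlab := by_contra fun hc => h (if_neg hc)
    rw [if_pos hlab] at h
    have := sum_circle_of_conn (fun l hl => (hoff l hl).symm) hac hac'
      (fun z => (t.label z).deg) (fun z => (s.label z).deg) (fun x hx => by
        rw [← touch_iff_of_conn (fun l hl => (hoff l hl).symm) hac] at hx
        exact congrArg Label.deg (hlab x hx))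
    change _ + (s.labelAt _).deg = _ + (t.labelAt _).deg + (t.labelAt _).deg at this
    generalize s.labelAt (D.crossing k).a = u at *
    generalize t.labelAt (D.crossing k).a = v at *
    generalize t.labelAt (D.crossing k).c = w at *
    push_cast
    cases u <;> cases v <;> cases w <;> simp [Label.comulCoeff, Label.deg] at h this ⊢ <;> linarith
  · have hac' : D.Conn t.res (D.crossing k).a (D.crossing k).c := by
      rw [ht, hD _ _ hk]; exact hac
    rw [edgeCoeff_merge hac] at h
    have hlab := by_contra fun hc => h (if_neg hc)
    rw [if_pos hlab] at h
    have := sum_circle_of_conn hoff hac' hac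
      (fun z => (s.label z).deg) (fun z => (t.label z).deg)
      (fun x hx => (congrArg Label.deg (hlab x hx)).symm)
    change _ + (t.labelAt _).deg = _ + (s.labelAt _).deg + (s.labelAt _).deg at this
    generalize s.labelAt (D.crossing k).a = u at *
    generalize s.labelAt (D.crossing k).c = v at *
    generalize t.labelAt (D.crossing k).a = w at *
    push_cast
    cases u <;> cases v <;> cases w <;> simp [Label.mulCoeff, Label.deg] at h this ⊢ <;> linarith

theorem exists_of_diffCoeff_ne_zero {s t : D.State} (h : D.diffCoeff s t ≠ 0) :
    ∃ k, s.res k = false ∧ t.res = Function.update s.res k true ∧ D.edgeCoeff k s t ≠ 0 := by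
  classical
  obtain ⟨k, -, hk⟩ := Finset.exists_ne_zero_of_sum_ne_zero h
  have h1 := by_contra fun hc => hk (if_neg hc)
  rw [if_pos h1] at hk
  exact ⟨k, h1.1, h1.2, right_ne_zero_of_mul hk⟩

open Classical in
theorem diffCoeff_eq {s t : D.State} {k : Fin D.n} (hk : s.res k = false)
    (ht : t.res = Function.update s.res k true) :
    D.diffCoeff s t =
      (-1) ^ (Finset.univ.filter fun l => l < k ∧ s.res l = true).card * D.edgeCoeff k s t := by
  unfold diffCoeff
  rw [Finset.sum_eq_single k, if_pos ⟨hk, ht⟩]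
  · intro l _ hl
    rw [if_neg]
    rintro ⟨h1, h2⟩
    have := congrFun (ht.symm.trans h2) l
    rw [Function.update_of_ne hl, Function.update_self, h1] at this
    cases this
  · simp

theorem qdeg_eq_of_diffCoeff_ne_zero (hD : D.IsPlanar) {s t : D.State}
    (h : D.diffCoeff s t ≠ 0) : t.qdeg = s.qdeg := by
  obtain ⟨k, h1, h2, h3⟩ := exists_of_diffCoeff_ne_zero h
  exact qdeg_eq_of_edgeCoeff_ne_zero hD h1 h2 h3

theorem height_eq_of_diffCoeff_ne_zero {s t : D.State}
    (h : D.diffCoeff s t ≠ 0) : t.height = s.height + 1 := by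
  obtain ⟨k, h1, h2, h3⟩ := exists_of_diffCoeff_ne_zero h
  exact height_update h1 h2

/-! ### The edge maps of the cube and multiplication by `X` -/

noncomputable instance (D : LinkDiagram) : Fintype D.State := Fintype.ofFinite _

theorem label_eq_one_or (u : Label) : u = .one ∨ u = .X := by cases u <;> simp

open Classical in
/-- Multiplication by `X` on the tensor factor of the circle that contains the edge `e`. -/
noncomputable def mulX (D : LinkDiagram) (e : D.Edge) : (D.State → ℤ) →ₗ[ℤ] (D.State → ℤ) where
  toFun z t := if t.labelAt e = .X then z (t.set e .one) else 0
  map_add' z w := by ext t; simp only [Pi.add_apply]; split_ifs <;> simp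
  map_smul' c z := by ext t; simp only [Pi.smul_apply, RingHom.id_apply]; split_ifs <;> simp

theorem mulX_apply_X {e : D.Edge} {t : D.State} (h : t.labelAt e = .X) (z : D.State → ℤ) :
    D.mulX e z t = z (t.set e .one) := if_pos h

theorem mulX_apply_one {e : D.Edge} {t : D.State} (h : t.labelAt e = .one) (z : D.State → ℤ) :
    D.mulX e z t = 0 := if_neg (by simp [h])

open Classical in
/-- The coefficient of `t` in the image of `s` under the map attached to the edges of the cube in
the direction `k`. -/
noncomputable def cubeCoeff (D : LinkDiagram) (k : Fin D.n) (s t : D.State) : ℤ :=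
  if s.res k = false ∧ t.res = Function.update s.res k true then D.edgeCoeff k s t else 0

/-- The sum of the maps attached to the edges of the cube in the direction `k`, without signs. -/
noncomputable def edgeMap (D : LinkDiagram) (k : Fin D.n) :
    (D.State → ℤ) →ₗ[ℤ] (D.State → ℤ) where
  toFun z t := ∑ s, D.cubeCoeff k s t * z s
  map_add' z w := by ext t; simp [mul_add, Finset.sum_add_distrib]
  map_smul' c z := by
    ext t
    simp only [Pi.smul_apply, smul_eq_mul, RingHom.id_apply, Finset.mul_sum]
    exact Finset.sum_congr rfl fun s _ => by ring

theorem edgeMap_apply (k : Fin D.n) (z : D.State → ℤ) (t : D.State) :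
    D.edgeMap k z t = ∑ s, D.cubeCoeff k s t * z s := rfl

theorem mulX_mulX_of_conn_apply {e f : D.Edge} {t : D.State} (h : D.Conn t.res e f)
    (z : D.State → ℤ) : D.mulX e (D.mulX f z) t = 0 := by
  rcases label_eq_one_or (t.labelAt e) with h1 | h1
  · rw [mulX_apply_one h1]
  · rw [mulX_apply_X h1, mulX_apply_one]
    exact State.set_labelAt_of_conn _ h.symm

theorem mulX_comm (e f : D.Edge) (z : D.State → ℤ) :
    D.mulX e (D.mulX f z) = D.mulX f (D.mulX e z) := by
  ext t
  by_cases h : D.Conn t.res e f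
  · rw [mulX_mulX_of_conn_apply h, mulX_mulX_of_conn_apply h.symm]
  · have he : (t.set f .one).labelAt e = t.labelAt e := State.set_labelAt_of_not_conn _ h
    have hf : (t.set e .one).labelAt f = t.labelAt f :=
      State.set_labelAt_of_not_conn _ fun h' => h h'.symm
    rcases label_eq_one_or (t.labelAt e) with h1 | h1 <;>
      rcases label_eq_one_or (t.labelAt f) with h2 | h2
    · rw [mulX_apply_one h1, mulX_apply_one h2]
    · rw [mulX_apply_one h1, mulX_apply_X h2, mulX_apply_one (he.trans h1)]
    · rw [mulX_apply_X h1, mulX_apply_one h2, mulX_apply_one (hf.trans h2)]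
    · rw [mulX_apply_X h1, mulX_apply_X h2, mulX_apply_X (he.trans h1),
        mulX_apply_X (hf.trans h2), State.set_comm h]

open Classical in
/-- If `s` has the label `1` and `t` the label `X` at `e`, then moving the factor `X` from one side
to the other does not change the coefficient: the edge maps are linear over multiplication by
`X`. -/
theorem edgeCoeff_set (hD : D.IsPlanar) {k : Fin D.n} {s t : D.State} (hk : s.res k = false)
    (ht : t.res = Function.update s.res k true) (e : D.Edge) :
    (if s.labelAt e = .one then D.edgeCoeff k (s.set e .X) t else 0) =
      if t.labelAt e = .X then D.edgeCoeff k s (t.set e .one) else 0 := by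
  have hoff : ∀ l, l ≠ k → t.res l = s.res l := fun l hl => by rw [ht, Function.update_of_ne hl]
  have hoff' : ∀ l, l ≠ k → s.res l = t.res l := fun l hl => (hoff l hl).symm
  by_cases he : D.Touch s.res k e
  · -- the conditions on the untouched circles agree
    have huntouched : (∀ x, ¬ D.Touch s.res k x → t.labelAt x = (s.set e .X).labelAt x) ↔
        (∀ x, ¬ D.Touch s.res k x → (t.set e .one).labelAt x = s.labelAt x) := by
      refine forall_congr' fun x => imp_congr_right fun hx => ?_
      have h1 : ¬ D.Conn s.res x e := fun h => hx (he.of_conn h)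
      have h2 : ¬ D.Conn t.res x e := fun h => by
        by_cases hac : D.Conn s.res (D.crossing k).a (D.crossing k).c
        · exact h1 ((conn_iff_of_conn hoff' hac).2 (Or.inl h))
        · have hac' : D.Conn t.res (D.crossing k).a (D.crossing k).c := by
            rw [ht, hD _ _ hk]; exact hac
          rcases (conn_iff_of_conn hoff hac').1 h with h | h
          · exact h1 h
          · exact hx h.1
      rw [State.set_labelAt_of_not_conn _ h1, State.set_labelAt_of_not_conn _ h2]
    by_cases hac : D.Conn s.res (D.crossing k).a (D.crossing k).c
    · have hac' : ¬ D.Conn t.res (D.crossing k).a (D.crossing k).c := by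
        rw [ht, hD _ _ hk]; exact not_not.2 hac
      rw [edgeCoeff_split (s := s.set e .X) hac hac', edgeCoeff_split (t := t.set e .one) hac hac']
      simp only [State.set_res, huntouched]
      by_cases hU : ∀ x, ¬ D.Touch s.res k x → (t.set e .one).labelAt x = s.labelAt x
      · simp only [if_pos hU]
        have hea : D.Conn s.res e (D.crossing k).a := he.elim id fun h => h.trans hac.symm
        rw [State.set_labelAt_of_conn _ hea.symm, State.labelAt_congr hea]
        rcases (touch_iff_of_conn hoff' hac).1 he with h | h
        · have hc : ¬ D.Conn t.res (D.crossing k).c e := fun h' => hac' (h'.trans h).symm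
          rw [State.set_labelAt_of_conn _ h.symm, State.set_labelAt_of_not_conn _ hc,
            State.labelAt_congr h]
          generalize s.labelAt (D.crossing k).a = u
          generalize t.labelAt (D.crossing k).a = v
          generalize t.labelAt (D.crossing k).c = w
          cases u <;> cases v <;> cases w <;> simp [Label.comulCoeff]
        · have hc : ¬ D.Conn t.res (D.crossing k).a e := fun h' => hac' (h'.trans h)
          rw [State.set_labelAt_of_conn _ h.symm, State.set_labelAt_of_not_conn _ hc,
            State.labelAt_congr h]
          generalize s.labelAt (D.crossing k).a = u
          generalize t.labelAt (D.crossing k).a = v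
          generalize t.labelAt (D.crossing k).c = w
          cases u <;> cases v <;> cases w <;> simp [Label.comulCoeff]
      · simp only [if_neg hU, ite_self]
    · have hac' : D.Conn t.res (D.crossing k).a (D.crossing k).c := by
        rw [ht, hD _ _ hk]; exact hac
      rw [edgeCoeff_merge (s := s.set e .X) hac, edgeCoeff_merge (t := t.set e .one) hac]
      simp only [State.set_res, huntouched]
      by_cases hU : ∀ x, ¬ D.Touch s.res k x → (t.set e .one).labelAt x = s.labelAt x
      · simp only [if_pos hU]
        have hea : D.Conn t.res e (D.crossing k).a :=
          ((touch_iff_of_conn hoff hac').2 he).elim id fun h => h.trans hac'.symm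
        rw [State.set_labelAt_of_conn _ hea.symm, State.labelAt_congr hea]
        rcases he with h | h
        · have hc : ¬ D.Conn s.res (D.crossing k).c e := fun h' => hac (h'.trans h).symm
          rw [State.set_labelAt_of_conn _ h.symm, State.set_labelAt_of_not_conn _ hc,
            State.labelAt_congr h]
          generalize s.labelAt (D.crossing k).a = u
          generalize s.labelAt (D.crossing k).c = v
          generalize t.labelAt (D.crossing k).a = w
          cases u <;> cases v <;> cases w <;> simp [Label.mulCoeff]
        · have hc : ¬ D.Conn s.res (D.crossing k).a e := fun h' => hac (h'.trans h)
          rw [State.set_labelAt_of_conn _ h.symm, State.set_labelAt_of_not_conn _ hc,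
            State.labelAt_congr h]
          generalize s.labelAt (D.crossing k).a = u
          generalize s.labelAt (D.crossing k).c = v
          generalize t.labelAt (D.crossing k).a = w
          cases u <;> cases v <;> cases w <;> simp [Label.mulCoeff]
      · simp only [if_neg hU, ite_self]
  · have hconn : ∀ x, D.Conn t.res x e ↔ D.Conn s.res x e := fun x => by
      by_cases hac : D.Conn s.res (D.crossing k).a (D.crossing k).c
      · have h1 := conn_iff_of_conn (x := x) (y := e) hoff' hac
        have h2 := touch_iff_of_conn (x := e) hoff' hac
        tauto
      · have hac' : D.Conn t.res (D.crossing k).a (D.crossing k).c := by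
          rw [ht, hD _ _ hk]; exact hac
        have h1 := conn_iff_of_conn (x := x) (y := e) hoff hac'
        tauto
    have hsa : ¬ D.Conn s.res (D.crossing k).a e := fun h => he (Or.inl h.symm)
    have hsc : ¬ D.Conn s.res (D.crossing k).c e := fun h => he (Or.inr h.symm)
    have hta : ¬ D.Conn t.res (D.crossing k).a e := by rwa [hconn]
    have htc : ¬ D.Conn t.res (D.crossing k).c e := by rwa [hconn]
    have huntouched : (s.labelAt e = .one ∧
          ∀ x, ¬ D.Touch s.res k x → t.labelAt x = (s.set e .X).labelAt x) ↔
        (t.labelAt e = .X ∧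
          ∀ x, ¬ D.Touch s.res k x → (t.set e .one).labelAt x = s.labelAt x) := by
      constructor
      · rintro ⟨h1, h2⟩
        refine ⟨(h2 e he).trans (State.set_labelAt_self _ _ _), fun x hx => ?_⟩
        by_cases hxe : D.Conn s.res x e
        · rw [State.set_labelAt_of_conn _ ((hconn x).2 hxe), State.labelAt_congr hxe, h1]
        · rw [State.set_labelAt_of_not_conn _ (mt (hconn x).1 hxe), h2 x hx,
            State.set_labelAt_of_not_conn _ hxe]
      · rintro ⟨h1, h2⟩
        refine ⟨(h2 e he).symm.trans (State.set_labelAt_self _ _ _), fun x hx => ?_⟩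
        by_cases hxe : D.Conn s.res x e
        · rw [State.set_labelAt_of_conn _ hxe, State.labelAt_congr ((hconn x).2 hxe), h1]
        · rw [State.set_labelAt_of_not_conn _ hxe, ← h2 x hx,
            State.set_labelAt_of_not_conn _ (mt (hconn x).1 hxe)]
    by_cases hac : D.Conn s.res (D.crossing k).a (D.crossing k).c
    · have hac' : ¬ D.Conn t.res (D.crossing k).a (D.crossing k).c := by
        rw [ht, hD _ _ hk]; exact not_not.2 hac
      rw [edgeCoeff_split (s := s.set e .X) hac hac', edgeCoeff_split (t := t.set e .one) hac hac',
        ← ite_and, ← ite_and, State.set_labelAt_of_not_conn _ hsa,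
        State.set_labelAt_of_not_conn _ hta, State.set_labelAt_of_not_conn _ htc]
      simp only [State.set_res, huntouched]
    · rw [edgeCoeff_merge (s := s.set e .X) hac, edgeCoeff_merge (t := t.set e .one) hac,
        ← ite_and, ← ite_and, State.set_labelAt_of_not_conn _ hsa,
        State.set_labelAt_of_not_conn _ hsc, State.set_labelAt_of_not_conn _ hta]
      simp only [State.set_res, huntouched]

open Classical in
theorem cubeCoeff_set (hD : D.IsPlanar) (k : Fin D.n) (s t : D.State) (e : D.Edge) :
    (if s.labelAt e = .one then D.cubeCoeff k (s.set e .X) t else 0) =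
      if t.labelAt e = .X then D.cubeCoeff k s (t.set e .one) else 0 := by
  by_cases h : s.res k = false ∧ t.res = Function.update s.res k true
  · have h1 : D.cubeCoeff k (s.set e .X) t = D.edgeCoeff k (s.set e .X) t := if_pos h
    have h2 : D.cubeCoeff k s (t.set e .one) = D.edgeCoeff k s (t.set e .one) := if_pos h
    rw [h1, h2]
    exact edgeCoeff_set hD h.1 h.2 e
  · have h1 : D.cubeCoeff k (s.set e .X) t = 0 := if_neg h
    have h2 : D.cubeCoeff k s (t.set e .one) = 0 := if_neg h
    rw [h1, h2, ite_self, ite_self]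

/-- The edge maps are linear over multiplication by `X`, since `m` and `Δ` are bimodule maps. -/
theorem edgeMap_mulX (hD : D.IsPlanar) (k : Fin D.n) (e : D.Edge) (z : D.State → ℤ) :
    D.edgeMap k (D.mulX e z) = D.mulX e (D.edgeMap k z) := by
  classical
  ext t
  have h1 : D.edgeMap k (D.mulX e z) t =
      ∑ s, (if s.labelAt e = .one then D.cubeCoeff k (s.set e .X) t else 0) * z s := by
    simp only [edgeMap_apply, ite_mul, zero_mul, ← Finset.sum_filter]
    rw [← Finset.sum_filter_add_sum_filter_not Finset.univ (fun s : D.State => s.labelAt e = .X),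
      Finset.sum_eq_zero (s := Finset.univ.filter fun s : D.State => ¬ s.labelAt e = .X), add_zero]
    · refine Finset.sum_nbij' (fun s => s.set e .one) (fun s => s.set e .X) ?_ ?_ ?_ ?_ ?_
      · intro s _; simp
      · intro s _; simp
      · intro s hs; rw [State.set_set, State.set_self (by simpa using hs)]
      · intro s hs; rw [State.set_set, State.set_self (by simpa using hs)]
      · intro s hs
        have hs : s.labelAt e = .X := by simpa using hs
        rw [mulX_apply_X hs, State.set_set, State.set_self hs]
    · intro s hs
      rw [mulX_apply_one, mul_zero]
      exact (label_eq_one_or _).resolve_right (by simpa using hs)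
  rw [h1]
  simp only [cubeCoeff_set hD]
  rcases label_eq_one_or (t.labelAt e) with h | h
  · rw [mulX_apply_one h]; simp [h]
  · rw [mulX_apply_X h, edgeMap_apply]; simp [h]

/-! ### The elements `1 ⊗ ⋯ ⊗ 1` and the commuting faces of the cube -/

/-- The state with resolution `ε` and all labels `1`. -/
def vac (D : LinkDiagram) (ε : Fin D.n → Bool) : D.State :=
  State.ofLabel ε (fun _ => .one) fun _ _ _ => rfl

open Classical in
/-- The basis element `1 ⊗ ⋯ ⊗ 1` of the resolution `ε`. -/
noncomputable def vacuum (D : LinkDiagram) (ε : Fin D.n → Bool) : D.State → ℤ :=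
  Pi.single (D.vac ε) 1

theorem eq_vac_iff {ε : Fin D.n → Bool} {t : D.State} :
    t = D.vac ε ↔ t.res = ε ∧ ∀ x, t.labelAt x = .one := by
  constructor
  · rintro rfl; exact ⟨rfl, fun _ => rfl⟩
  · rintro ⟨h1, h2⟩; exact State.ext_labelAt h1 h2

open Classical in
theorem vacuum_apply (ε : Fin D.n → Bool) (t : D.State) :
    D.vacuum ε t = if t.res = ε ∧ ∀ x, t.labelAt x = .one then 1 else 0 := by
  rw [vacuum, Pi.single_apply]
  simp only [eq_vac_iff]

theorem mulX_vacuum_congr {ε : Fin D.n → Bool} {e f : D.Edge} (h : D.Conn ε e f) :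
    D.mulX e (D.vacuum ε) = D.mulX f (D.vacuum ε) := by
  ext t
  by_cases ht : t.res = ε
  · have h' : D.Conn t.res e f := by rwa [ht]
    have hl := State.labelAt_congr h'
    rcases label_eq_one_or (t.labelAt f) with h1 | h1
    · rw [mulX_apply_one h1, mulX_apply_one (hl.trans h1)]
    · rw [mulX_apply_X h1, mulX_apply_X (hl.trans h1), State.set_congr h']
  · have : ∀ e, D.mulX e (D.vacuum ε) t = 0 := fun e => by
      rcases label_eq_one_or (t.labelAt e) with h1 | h1
      · rw [mulX_apply_one h1]
      · rw [mulX_apply_X h1, vacuum_apply, if_neg fun h => ht h.1]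
    rw [this, this]

theorem edgeMap_vacuum_apply (k : Fin D.n) (ε : Fin D.n → Bool) (t : D.State) :
    D.edgeMap k (D.vacuum ε) t = D.cubeCoeff k (D.vac ε) t := by
  classical
  rw [edgeMap_apply, Finset.sum_eq_single (D.vac ε)]
  · simp [vacuum]
  · intro s _ hs; simp [vacuum, hs]
  · simp

theorem edgeMap_vacuum_of_true {k : Fin D.n} {ε : Fin D.n → Bool} (hk : ε k = true) :
    D.edgeMap k (D.vacuum ε) = 0 := by
  ext t
  rw [edgeMap_vacuum_apply, cubeCoeff, if_neg]
  · rfl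
  · rintro ⟨h, -⟩
    change ε k = false at h
    rw [hk] at h; cases h

theorem edgeMap_vacuum_merge {k : Fin D.n} {ε : Fin D.n → Bool}
    (hk : ε k = false) (h : ¬ D.Conn ε (D.crossing k).a (D.crossing k).c) (hD : D.IsPlanar) :
    D.edgeMap k (D.vacuum ε) = D.vacuum (Function.update ε k true) := by
  classical
  ext t
  rw [edgeMap_vacuum_apply, vacuum_apply]
  unfold cubeCoeff
  by_cases ht : t.res = Function.update ε k true
  swap
  · rw [if_neg fun h => ht h.2, if_neg fun h => ht h.1]
  rw [if_pos ⟨hk, ht⟩, edgeCoeff_merge (s := D.vac ε) h]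
  have hoff : ∀ l, l ≠ k → t.res l = ε l := fun l hl => by rw [ht, Function.update_of_ne hl]
  have hac' : D.Conn t.res (D.crossing k).a (D.crossing k).c := by
    rw [ht, hD _ _ hk]; exact h
  change (if ∀ x, ¬ D.Touch ε k x → t.labelAt x = .one then
    Label.mulCoeff .one .one (t.labelAt (D.crossing k).a) else 0) = _
  by_cases hall : ∀ x, t.labelAt x = .one
  · rw [if_pos fun x _ => hall x, if_pos ⟨ht, hall⟩, hall]; rfl
  · rw [if_neg (c := _ ∧ _) fun h => hall h.2]
    split_ifs with hU
    · rcases label_eq_one_or (t.labelAt (D.crossing k).a) with h1 | h1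
      · refine absurd (fun x => ?_) hall
        by_cases hx : D.Touch ε k x
        · rw [← h1]
          exact State.labelAt_congr (((touch_iff_of_conn hoff hac').2 hx).elim id
            fun h => h.trans hac'.symm)
        · exact hU x hx
      · rw [h1]; rfl
    · rfl

theorem edgeMap_vacuum_split {k : Fin D.n} {ε : Fin D.n → Bool}
    (hk : ε k = false) (h : D.Conn ε (D.crossing k).a (D.crossing k).c) (hD : D.IsPlanar) :
    D.edgeMap k (D.vacuum ε) = D.mulX (D.crossing k).a (D.vacuum (Function.update ε k true)) +
      D.mulX (D.crossing k).c (D.vacuum (Function.update ε k true)) := by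
  classical
  ext t
  rw [edgeMap_vacuum_apply, Pi.add_apply]
  unfold cubeCoeff
  by_cases ht : t.res = Function.update ε k true
  swap
  · have : ∀ e, D.mulX e (D.vacuum (Function.update ε k true)) t = 0 := fun e => by
      rcases label_eq_one_or (t.labelAt e) with h1 | h1
      · rw [mulX_apply_one h1]
      · rw [mulX_apply_X h1, vacuum_apply, if_neg fun h => ht h.1]
    rw [if_neg fun h => ht h.2, this, this, add_zero]
  have hac' : ¬ D.Conn t.res (D.crossing k).a (D.crossing k).c := by
    rw [ht, hD _ _ hk]; exact not_not.2 h
  have hoff : ∀ l, l ≠ k → ε l = t.res l := fun l hl => by rw [ht, Function.update_of_ne hl]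
  have hT : ∀ x, D.Touch ε k x ↔ D.Touch t.res k x := fun x => touch_iff_of_conn hoff h
  rw [if_pos ⟨hk, ht⟩, edgeCoeff_split (s := D.vac ε) h hac']
  change (if ∀ x, ¬ D.Touch ε k x → t.labelAt x = .one then
    Label.comulCoeff .one (t.labelAt (D.crossing k).a) (t.labelAt (D.crossing k).c) else 0) = _
  have key : ∀ e f, D.Touch t.res k e → D.Touch t.res k f → ¬ D.Conn t.res e f →
      t.labelAt e = .X → D.mulX e (D.vacuum (Function.update ε k true)) t =
      if (∀ x, ¬ D.Touch ε k x → t.labelAt x = .one) ∧ t.labelAt f = .one then 1 else 0 := by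
    intro e f he hf hef heX
    rw [mulX_apply_X heX, vacuum_apply]
    congr 1
    simp only [State.set_res, ht, true_and, eq_iff_iff]
    constructor
    · intro H
      have H' : ∀ x, ¬ D.Conn t.res x e → t.labelAt x = .one := fun x hx => by
        rw [← State.set_labelAt_of_not_conn (s := t) _ hx]; exact H x
      exact ⟨fun x hx => H' x fun h' => hx ((hT x).2 (he.of_conn h')),
        H' f fun h' => hef h'.symm⟩
    · rintro ⟨H1, H2⟩ x
      by_cases hx : D.Conn t.res x e
      · rw [State.set_labelAt_of_conn _ hx]
      · rw [State.set_labelAt_of_not_conn _ hx]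
        by_cases hx' : D.Touch t.res k x
        · rw [← H2]
          refine State.labelAt_congr ?_
          rcases hx' with hx' | hx' <;> rcases hf with hf | hf <;> rcases he with he | he
          · exact absurd (hx'.trans he.symm) hx
          · exact hx'.trans hf.symm
          · exact absurd (hx'.trans he.symm) hx
          · exact absurd (he.trans hf.symm) hef
          · exact absurd (he.trans hf.symm) hef
          · exact absurd (hx'.trans he.symm) hx
          · exact hx'.trans hf.symm
          · exact absurd (hx'.trans he.symm) hx
        · exact H1 x (mt (hT x).1 hx')
  rcases label_eq_one_or (t.labelAt (D.crossing k).a) with h1 | h1 <;>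
    rcases label_eq_one_or (t.labelAt (D.crossing k).c) with h2 | h2
  · rw [mulX_apply_one h1, mulX_apply_one h2, h1, h2]; simp [Label.comulCoeff]
  · rw [mulX_apply_one h1, key _ _ (touch_c _ _) (touch_a _ _) (fun h => hac' h.symm) h2]
    simp [h1, h2, Label.comulCoeff]
  · rw [mulX_apply_one h2, key _ _ (touch_a _ _) (touch_c _ _) hac' h1]
    simp [h1, h2, Label.comulCoeff]
  · rw [key _ _ (touch_c _ _) (touch_a _ _) (fun h => hac' h.symm) h2,
      key _ _ (touch_a _ _) (touch_c _ _) hac' h1]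
    simp [h1, h2, Label.comulCoeff]

theorem single_eq_mulX {s : D.State} {e : D.Edge} (h : s.labelAt e = .X) [DecidableEq D.State] :
    (Pi.single s 1 : D.State → ℤ) = D.mulX e (Pi.single (s.set e .one) 1) := by
  ext t
  rw [Pi.single_apply]
  rcases label_eq_one_or (t.labelAt e) with h1 | h1
  · rw [mulX_apply_one h1, if_neg]
    rintro rfl
    rw [h] at h1; cases h1
  · rw [mulX_apply_X h1, Pi.single_apply]
    congr 1
    rw [eq_iff_iff]
    constructor
    · rintro rfl; rfl
    · intro h'
      rw [← State.set_self h, ← State.set_self h1, ← State.set_set t e .one, h', State.set_set]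

/-- A linear map that commutes with all multiplications by `X` is determined by its values on the
elements `1 ⊗ ⋯ ⊗ 1`. -/
theorem linearMap_ext_vacuum {f g : (D.State → ℤ) →ₗ[ℤ] (D.State → ℤ)}
    (hf : ∀ e z, f (D.mulX e z) = D.mulX e (f z)) (hg : ∀ e z, g (D.mulX e z) = D.mulX e (g z))
    (h : ∀ ε, f (D.vacuum ε) = g (D.vacuum ε)) : f = g := by
  classical
  have key : ∀ (N : ℕ) (s : D.State), Set.ncard {x | s.labelAt x = .X} = N →
      f (Pi.single s 1) = g (Pi.single s 1) := by
    intro N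
    induction N using Nat.strong_induction_on with
    | _ N ih =>
      intro s hs
      by_cases hex : ∃ e, s.labelAt e = .X
      · obtain ⟨e, he⟩ := hex
        rw [single_eq_mulX he, hf, hg]
        congr 1
        refine ih _ ?_ (s.set e .one) rfl
        rw [← hs]
        refine Set.ncard_lt_ncard ⟨fun x hx => ?_, fun hsub => ?_⟩ (Set.toFinite _)
        · by_cases hxe : D.Conn s.res x e
          · simp [State.set_labelAt_of_conn _ hxe] at hx
          · simpa [State.set_labelAt_of_not_conn _ hxe] using hx
        · have := hsub he
          simp at this
      · have : s = D.vac s.res :=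
          eq_vac_iff.2 ⟨rfl, fun x => (label_eq_one_or _).resolve_right fun hx => hex ⟨x, hx⟩⟩
        rw [this]
        exact h s.res
  refine LinearMap.pi_ext' fun s => LinearMap.ext_ring ?_
  exact key _ s rfl

/-- Along an edge of the cube the number of circles changes by one. -/
theorem card_circle_update (hD : D.IsPlanar) {ε : Fin D.n → Bool} {k : Fin D.n}
    (hk : ε k = false) [Decidable (D.Conn ε (D.crossing k).a (D.crossing k).c)] :
    (Fintype.card (D.Circle (Function.update ε k true)) : ℤ) = Fintype.card (D.Circle ε) +
      if D.Conn ε (D.crossing k).a (D.crossing k).c then 1 else -1 := by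
  have hoff : ∀ l, l ≠ k → Function.update ε k true l = ε l := fun l hl =>
    Function.update_of_ne hl _ _
  split_ifs with h
  · have := sum_circle_of_conn (fun l hl => (hoff l hl).symm) h
      (by rw [hD _ _ hk]; exact not_not.2 h) (fun _ => 1) (fun _ => 1) fun _ _ => rfl
    simp at this
    linarith
  · have := sum_circle_of_conn hoff (by rw [hD _ _ hk]; exact h) h
      (fun _ => 1) (fun _ => 1) fun _ _ => rfl
    simp at this
    linarith

open Classical in
/-- The operator `F` with `edgeMap k (vacuum ε) = F (vacuum ε')`. -/
noncomputable def edgeFactor (D : LinkDiagram) (k : Fin D.n) (ε : Fin D.n → Bool) :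
    (D.State → ℤ) →ₗ[ℤ] (D.State → ℤ) :=
  if D.Conn ε (D.crossing k).a (D.crossing k).c then
    D.mulX (D.crossing k).a + D.mulX (D.crossing k).c
  else LinearMap.id

theorem edgeMap_vacuum (hD : D.IsPlanar) {k : Fin D.n} {ε : Fin D.n → Bool} (hk : ε k = false) :
    D.edgeMap k (D.vacuum ε) = D.edgeFactor k ε (D.vacuum (Function.update ε k true)) := by
  unfold edgeFactor
  split_ifs with h
  · exact edgeMap_vacuum_split hk h hD
  · exact edgeMap_vacuum_merge hk h hD

theorem edgeMap_edgeFactor (hD : D.IsPlanar) (k l : Fin D.n) (ε : Fin D.n → Bool)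
    (z : D.State → ℤ) : D.edgeMap l (D.edgeFactor k ε z) = D.edgeFactor k ε (D.edgeMap l z) := by
  unfold edgeFactor
  split_ifs
  · simp [edgeMap_mulX hD]
  · rfl

/-- The faces of the cube of resolutions commute. -/
theorem edgeMap_comm (hD : D.IsPlanar) (k l : Fin D.n) (z : D.State → ℤ) :
    D.edgeMap l (D.edgeMap k z) = D.edgeMap k (D.edgeMap l z) := by
  classical
  rcases eq_or_ne k l with rfl | hkl
  · rfl
  refine LinearMap.congr_fun (f := D.edgeMap l ∘ₗ D.edgeMap k) (g := D.edgeMap k ∘ₗ D.edgeMap l)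
    (linearMap_ext_vacuum (by simp [edgeMap_mulX hD]) (by simp [edgeMap_mulX hD]) fun ε => ?_) z
  simp only [LinearMap.comp_apply]
  cases hk : ε k
  swap
  · rw [edgeMap_vacuum_of_true hk, map_zero]
    cases hl : ε l
    · rw [edgeMap_vacuum hD hl, edgeMap_edgeFactor hD, edgeMap_vacuum_of_true, map_zero]
      rwa [Function.update_of_ne hkl]
    · rw [edgeMap_vacuum_of_true hl, map_zero]
  cases hl : ε l
  swap
  · rw [edgeMap_vacuum_of_true hl, map_zero, edgeMap_vacuum hD hk, edgeMap_edgeFactor hD,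
      edgeMap_vacuum_of_true, map_zero]
    rwa [Function.update_of_ne hkl.symm]
  have hkl' : Function.update ε l true k = false := by rwa [Function.update_of_ne hkl]
  have hlk' : Function.update ε k true l = false := by rwa [Function.update_of_ne hkl.symm]
  rw [edgeMap_vacuum hD hk, edgeMap_vacuum hD hl, edgeMap_edgeFactor hD, edgeMap_edgeFactor hD,
    edgeMap_vacuum hD hlk', edgeMap_vacuum hD hkl']
  have hcomm := Function.update_comm hkl true true ε
  have hoffk : ∀ j, j ≠ k → Function.update ε k true j = ε j :=
    fun j hj => Function.update_of_ne hj _ _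
  have hoffl : ∀ j, j ≠ l → Function.update ε l true j = ε j :=
    fun j hj => Function.update_of_ne hj _ _
  have hoffkl : ∀ j, j ≠ l →
      Function.update (Function.update ε k true) l true j = Function.update ε k true j :=
    fun j hj => Function.update_of_ne hj _ _
  have hofflk : ∀ j, j ≠ k →
      Function.update (Function.update ε k true) l true j = Function.update ε l true j :=
    fun j hj => by rw [hcomm]; exact Function.update_of_ne hj _ _
  have c1 := card_circle_update hD hk
  have c2 := card_circle_update hD hl
  have c3 := card_circle_update hD hlk'
  have c4 := card_circle_update hD hkl'
  have p1 := hD _ _ hk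
  have p2 := hD _ _ hl
  have p3 := hD _ _ hlk'
  have p4 := hD _ _ hkl'
  rw [← hcomm] at c4 p4 ⊢
  unfold edgeFactor
  by_cases h1 : D.Conn ε (D.crossing k).a (D.crossing k).c <;>
  by_cases h2 : D.Conn ε (D.crossing l).a (D.crossing l).c <;>
  by_cases h3 : D.Conn (Function.update ε k true) (D.crossing l).a (D.crossing l).c <;>
  by_cases h4 : D.Conn (Function.update ε l true) (D.crossing k).a (D.crossing k).c <;>
  simp only [h1, h2, h3, h4, if_true, if_false, not_true, not_false_iff, iff_true, iff_false]
    at c1 c2 c3 c4 p1 p2 p3 p4 ⊢ <;>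
  first | (exfalso; linarith) | rfl | skip
  · simp only [LinearMap.add_apply, map_add, mulX_comm (D.crossing k).a,
      mulX_comm (D.crossing k).c]
    abel
  · -- two splits that touch the same circle, each followed by a merge
    have ht : D.Touch (Function.update ε k true) k (D.crossing l).a :=
      (((conn_iff_of_conn (fun j hj => (hoffk j hj).symm) h1).1 h2).resolve_left h3).1
    have ht' : D.Conn (Function.update (Function.update ε k true) l true)
        (D.crossing l).a (D.crossing k).a := by
      rcases ht with ht | ht
      · exact (conn_iff_of_conn hoffkl p3).2 (Or.inl ht)
      · exact ((conn_iff_of_conn hoffkl p3).2 (Or.inl ht)).trans p4.symm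
    simp only [LinearMap.add_apply, LinearMap.id_apply]
    rw [← mulX_vacuum_congr p3, ← mulX_vacuum_congr p4, mulX_vacuum_congr ht']
  · -- two merges of the same two circles, each followed by a split
    have hmem : ∀ x, D.Touch ε k x →
        D.Touch (Function.update (Function.update ε k true) l true) k x := fun x hx => by
      have hx' : D.Conn (Function.update ε l true) x (D.crossing k).a := by
        rcases hx with hx | hx
        · exact (conn_iff_of_conn hoffl p2).2 (Or.inl hx)
        · exact ((conn_iff_of_conn hoffl p2).2 (Or.inl hx)).trans h4.symm
      rcases (conn_iff_of_conn (fun j hj => (hofflk j hj).symm) h4).1 hx' with h | h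
      · exact Or.inl h
      · exact h.1
    obtain ⟨ha, hc⟩ := ((conn_iff_of_conn hoffk p1).1 h3).resolve_left h2
    replace ha := hmem _ ha
    replace hc := hmem _ hc
    simp only [LinearMap.add_apply, LinearMap.id_apply]
    rcases ha with ha | ha <;> rcases hc with hc | hc
    · exact absurd (ha.trans hc.symm) p3
    · rw [mulX_vacuum_congr ha, mulX_vacuum_congr hc]
    · rw [mulX_vacuum_congr ha, mulX_vacuum_congr hc, add_comm]
    · exact absurd (ha.trans hc.symm) p3

/-! ### The differential -/

/-- The differential of the Khovanov complex in all degrees at once, as an operator on functions on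
the set of states. -/
noncomputable def differential (D : LinkDiagram) : (D.State → ℤ) →ₗ[ℤ] (D.State → ℤ) where
  toFun z t := ∑ s, D.diffCoeff s t * z s
  map_add' z w := by ext t; simp [mul_add, Finset.sum_add_distrib]
  map_smul' c z := by
    ext t
    simp only [Pi.smul_apply, smul_eq_mul, RingHom.id_apply, Finset.mul_sum]
    exact Finset.sum_congr rfl fun s _ => by ring

theorem differential_apply (z : D.State → ℤ) (t : D.State) :
    D.differential z t = ∑ s, D.diffCoeff s t * z s := rfl

/-- The sign of the edge in the direction `k` of the cube that ends (or begins) at `ε`. -/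
def cubeSign (ε : Fin D.n → Bool) (k : Fin D.n) : ℤ :=
  (-1) ^ (Finset.univ.filter fun l => l < k ∧ ε l = true).card

theorem cubeSign_mul_self (ε : Fin D.n → Bool) (k : Fin D.n) :
    cubeSign ε k * cubeSign ε k = 1 := by
  rw [cubeSign, ← pow_add, ← two_mul, pow_mul]; norm_num

theorem cubeSign_update_self (ε : Fin D.n → Bool) (k : Fin D.n) (b : Bool) :
    cubeSign (Function.update ε k b) k = cubeSign ε k := by
  unfold cubeSign
  congr 2
  refine Finset.filter_congr fun l _ => and_congr_right fun hl => ?_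
  rw [Function.update_of_ne hl.ne]

theorem cubeSign_update {ε : Fin D.n → Bool} {k l : Fin D.n} (hl : ε l = false) :
    cubeSign (Function.update ε l true) k = cubeSign ε k * if l < k then -1 else 1 := by
  unfold cubeSign
  split_ifs with h
  · have : (Finset.univ.filter fun m => m < k ∧ Function.update ε l true m = true) =
        insert l (Finset.univ.filter fun m => m < k ∧ ε m = true) := by
      ext m
      by_cases hm : m = l
      · subst hm; simp [h]
      · simp [hm]
    rw [this, Finset.card_insert_of_notMem (by simp [hl]), pow_succ]
  · rw [mul_one]
    congr 2
    refine Finset.filter_congr fun m _ => and_congr_right fun hm => ?_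
    rw [Function.update_of_ne]
    rintro rfl
    exact h hm

theorem differential_eq_sum_edgeMap (z : D.State → ℤ) (t : D.State) :
    D.differential z t = ∑ k, cubeSign t.res k * D.edgeMap k z t := by
  simp only [differential_apply, edgeMap_apply, Finset.mul_sum, diffCoeff, Finset.sum_mul]
  rw [Finset.sum_comm]
  refine Finset.sum_congr rfl fun k _ => Finset.sum_congr rfl fun s _ => ?_
  unfold cubeCoeff
  split_ifs with h
  · rw [h.2, cubeSign_update_self, mul_assoc]; rfl
  · simp

theorem differential_mulX (hD : D.IsPlanar) (e : D.Edge) (z : D.State → ℤ) :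
    D.differential (D.mulX e z) = D.mulX e (D.differential z) := by
  ext t
  simp only [differential_eq_sum_edgeMap, edgeMap_mulX hD]
  rcases label_eq_one_or (t.labelAt e) with h | h
  · simp [mulX_apply_one h]
  · simp only [mulX_apply_X h, differential_eq_sum_edgeMap, State.set_res]

theorem edgeMap_edgeMap_self (k : Fin D.n) (z : D.State → ℤ) :
    D.edgeMap k (D.edgeMap k z) = 0 := by
  ext t
  simp only [edgeMap_apply, Finset.mul_sum, Pi.zero_apply]
  refine Finset.sum_eq_zero fun u _ => Finset.sum_eq_zero fun s _ => ?_
  unfold cubeCoeff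
  split_ifs with h h'
  · have := h.1
    rw [h'.2, Function.update_self] at this
    cases this
  all_goals simp

/-- The faces of the cube commute, so with the signs they anticommute. -/
theorem differential_differential (hD : D.IsPlanar) (z : D.State → ℤ) :
    D.differential (D.differential z) = 0 := by
  classical
  ext t
  set f : Fin D.n → Fin D.n → ℤ := fun l k =>
    cubeSign t.res l * cubeSign t.res k * (if l < k then -1 else 1) *
      D.edgeMap l (D.edgeMap k z) t with hf
  have h1 : D.differential (D.differential z) t = ∑ l, ∑ k, f l k := by
    rw [differential_eq_sum_edgeMap]
    refine Finset.sum_congr rfl fun l _ => ?_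
    have : D.edgeMap l (D.differential z) t = ∑ k, cubeSign t.res k * (if l < k then -1 else 1) *
        D.edgeMap l (D.edgeMap k z) t := by
      simp only [edgeMap_apply l, Finset.mul_sum]
      rw [Finset.sum_comm]
      refine Finset.sum_congr rfl fun u _ => ?_
      rw [differential_eq_sum_edgeMap, Finset.mul_sum]
      refine Finset.sum_congr rfl fun k _ => ?_
      by_cases h : u.res l = false ∧ t.res = Function.update u.res l true
      · rw [h.2, cubeSign_update h.1]
        split_ifs <;> ring
      · rw [cubeCoeff, if_neg h]; simp
    rw [this, Finset.mul_sum]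
    exact Finset.sum_congr rfl fun k _ => by simp only [hf]; ring
  have h2 : ∀ l k, f l k = - f k l := fun l k => by
    rcases lt_trichotomy l k with h | rfl | h
    · simp only [hf, if_pos h, if_neg h.not_gt, edgeMap_comm hD k l]; ring
    · simp only [hf, edgeMap_edgeMap_self]; simp
    · simp only [hf, if_pos h, if_neg h.not_gt, edgeMap_comm hD k l]; ring
  have h3 : ∑ l, ∑ k, f l k = - ∑ l, ∑ k, f l k := by
    conv_rhs => rw [Finset.sum_comm]
    simp only [← Finset.sum_neg_distrib]
    exact Finset.sum_congr rfl fun l _ => Finset.sum_congr rfl fun k _ => h2 l k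
  -- over the integers, a sum that is its own negative vanishes
  rw [h1, Pi.zero_apply]
  linarith

/-! ### Acyclic subquotients -/

/-- A set of states that contains every state between two of its members, so that it spans a
subquotient of the complex. -/
def IsConvex (P : Set D.State) : Prop :=
  ∀ s ∈ P, ∀ t ∈ P, ∀ u, D.diffCoeff s u ≠ 0 → D.diffCoeff u t ≠ 0 → u ∈ P

/-- The subquotient complex spanned by `P` has no homology. -/
def IsAcyclic (P : Set D.State) : Prop :=
  ∀ z : D.State → ℤ, (∀ s, s ∉ P → z s = 0) → (∀ t ∈ P, D.differential z t = 0) →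
    ∃ y : D.State → ℤ, (∀ s, s ∉ P → y s = 0) ∧ ∀ t ∈ P, D.differential y t = z t

theorem isAcyclic_of_forall_notMem {P : Set D.State} (h : ∀ s, s ∉ P) : IsAcyclic P :=
  fun _ _ _ => ⟨0, fun _ _ => rfl, fun t ht => absurd ht (h t)⟩

/-- The differential of a subquotient squares to zero. -/
theorem IsConvex.differential_indicator (hD : D.IsPlanar) {P : Set D.State} (hP : IsConvex P)
    {y : D.State → ℤ} (hy : ∀ s, s ∉ P → y s = 0) {t : D.State} (ht : t ∈ P) :
    D.differential (P.indicator (D.differential y)) t = 0 := by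
  classical
  have h : D.differential (D.differential y) t = 0 := by rw [differential_differential hD]; rfl
  rw [← h]
  refine Finset.sum_congr rfl fun u _ => ?_
  by_cases hu : u ∈ P
  · rw [Set.indicator_of_mem hu]
  · rw [Set.indicator_of_notMem hu, mul_zero, eq_comm, differential_apply, Finset.mul_sum]
    refine Finset.sum_eq_zero fun s _ => ?_
    by_cases hs : s ∈ P
    · by_cases h1 : D.diffCoeff s u = 0
      · simp [h1]
      · have : D.diffCoeff u t = 0 := by_contra fun h2 => hu (hP s hs t ht u h1 h2)
        simp [this]
    · simp [hy s hs]

section Filtration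

variable {P A B : Set D.State}

theorem IsConvex.sub (hP : IsConvex P) (hu : A ∪ B = P)
    (hBA : ∀ s ∈ B, ∀ t ∈ A, D.diffCoeff s t = 0) : IsConvex B := by
  subst hu
  intro s hs t ht u h1 h2
  rcases hP s (Or.inr hs) t (Or.inr ht) u h1 h2 with h | h
  · exact absurd (hBA s hs u h) h1
  · exact h

theorem IsConvex.quotient (hP : IsConvex P) (hu : A ∪ B = P)
    (hBA : ∀ s ∈ B, ∀ t ∈ A, D.diffCoeff s t = 0) : IsConvex A := by
  subst hu
  intro s hs t ht u h1 h2
  rcases hP s (Or.inl hs) t (Or.inl ht) u h1 h2 with h | h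
  · exact h
  · exact absurd (hBA u h t ht) h2

theorem differential_apply_eq_zero {z : D.State → ℤ} (hz : ∀ s, s ∉ B → z s = 0) {t : D.State}
    (hBt : ∀ s ∈ B, D.diffCoeff s t = 0) : D.differential z t = 0 :=
  Finset.sum_eq_zero fun s _ => by
    by_cases hs : s ∈ B
    · rw [hBt s hs, zero_mul]
    · rw [hz s hs, mul_zero]

/-- The long exact sequence: if the subcomplex `B` and the quotient `A` are acyclic, so is `P`. -/
theorem IsAcyclic.of_filtration (hD : D.IsPlanar) (hP : IsConvex P) (hu : A ∪ B = P)
    (hBA : ∀ s ∈ B, ∀ t ∈ A, D.diffCoeff s t = 0)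
    (hA : IsAcyclic A) (hB : IsAcyclic B) : IsAcyclic P := by
  classical
  intro z hz hdz
  have hAP : A ⊆ P := hu ▸ Set.subset_union_left
  have hBP : B ⊆ P := hu ▸ Set.subset_union_right
  have hPB : ∀ s ∈ P, s ∉ A → s ∈ B := fun s hs hsA => by
    rw [← hu] at hs; exact hs.resolve_left hsA
  obtain ⟨y, hy, hdy⟩ := hA (A.indicator z) (fun s hs => Set.indicator_of_notMem hs _)
    fun t ht => by
      have h1 : D.differential (z - A.indicator z) t = 0 :=
        differential_apply_eq_zero (B := B) (fun s hs => by
          rw [Pi.sub_apply]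
          by_cases hsA : s ∈ A
          · rw [Set.indicator_of_mem hsA, sub_self]
          · rw [Set.indicator_of_notMem hsA, sub_zero]
            exact hz s fun hsP => hs (hPB s hsP hsA)) fun s hs => hBA s hs t ht
      rw [map_sub, Pi.sub_apply, hdz t (hAP ht), zero_sub, neg_eq_zero] at h1
      exact h1
  have hyP : ∀ s, s ∉ P → y s = 0 := fun s hs => hy s fun h => hs (hAP h)
  obtain ⟨y', hy', hdy'⟩ := hB (z - P.indicator (D.differential y)) (fun s hs => by
      rw [Pi.sub_apply]
      by_cases hsA : s ∈ A
      · rw [Set.indicator_of_mem (hAP hsA), hdy s hsA, Set.indicator_of_mem hsA, sub_self]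
      · have : s ∉ P := fun h => hs (hPB s h hsA)
        rw [Set.indicator_of_notMem this, hz s this, sub_zero])
    fun t ht => by
      rw [map_sub, Pi.sub_apply, hdz t (hBP ht), hP.differential_indicator hD hyP (hBP ht),
        sub_zero]
  refine ⟨y + y', fun s hs => by
    rw [Pi.add_apply, hyP s hs, hy' s fun h => hs (hBP h), add_zero], fun t ht => ?_⟩
  rw [map_add, Pi.add_apply]
  by_cases htA : t ∈ A
  · rw [hdy t htA, Set.indicator_of_mem htA,
      differential_apply_eq_zero hy' fun s hs => hBA s hs t htA, add_zero]
  · rw [hdy' t (hPB t ht htA), Pi.sub_apply, Set.indicator_of_mem ht]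
    ring

/-- Gaussian elimination: a set of states is acyclic if the differential matches one part `U` of it
bijectively with the rest `T`. -/
theorem IsAcyclic.of_matching (hD : D.IsPlanar) {U T : Set D.State} (hP : IsConvex P)
    (hu : U ∪ T = P)
    (h1 : ∀ s ∈ U, ∃ t ∈ T, D.diffCoeff s t * D.diffCoeff s t = 1)
    (h2 : ∀ t ∈ T, ∃ s ∈ U, D.diffCoeff s t ≠ 0)
    (h3 : ∀ s ∈ U, ∀ t ∈ T, ∀ t' ∈ T, D.diffCoeff s t ≠ 0 → D.diffCoeff s t' ≠ 0 → t = t')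
    (h4 : ∀ s ∈ U, ∀ s' ∈ U, ∀ t ∈ T, D.diffCoeff s t ≠ 0 → D.diffCoeff s' t ≠ 0 → s = s') :
    IsAcyclic P := by
  classical
  have hUP : U ⊆ P := hu ▸ Set.subset_union_left
  have hTP : T ⊆ P := hu ▸ Set.subset_union_right
  intro z hz hdz
  choose! μ hμT hμ using h1
  have hμ0 : ∀ s ∈ U, D.diffCoeff s (μ s) ≠ 0 := fun s hs h => by
    have := hμ s hs
    rw [h] at this
    simp at this
  have hsingle : ∀ (w : D.State → ℤ), (∀ s, s ∉ U → w s = 0) → ∀ s ∈ U,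
      D.differential w (μ s) = D.diffCoeff s (μ s) * w s := fun w hw s hs => by
    rw [differential_apply, Finset.sum_eq_single s]
    · intro s' _ hs'
      by_cases hU : s' ∈ U
      · by_contra hne
        exact hs' (h4 s' hU s hs _ (hμT s hs) (left_ne_zero_of_mul hne) (hμ0 s hs))
      · rw [hw s' hU, mul_zero]
    · simp
  -- matched coefficients are their own inverses, so `y` is the preimage prescribed on `T`
  set y : D.State → ℤ := fun s => if s ∈ U then D.diffCoeff s (μ s) * z (μ s) else 0 with hy
  have hyU : ∀ s, s ∉ U → y s = 0 := fun s hs => if_neg hs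
  have hyT : ∀ t ∈ T, D.differential y t = z t := fun t ht => by
    obtain ⟨s, hs, hst⟩ := h2 t ht
    obtain rfl : t = μ s := h3 s hs t ht _ (hμT s hs) hst (hμ0 s hs)
    rw [hsingle y hyU s hs, hy]
    simp only [if_pos hs]
    rw [← mul_assoc, hμ s hs, one_mul]
  refine ⟨y, fun s hs => hyU s fun h => hs (hUP h), fun t ht => ?_⟩
  by_cases htT : t ∈ T
  · exact hyT t htT
  · have htU : t ∈ U := by rw [← hu] at ht; exact ht.resolve_right htT
    -- `z - d y` vanishes on `T` and is a cycle; being supported on `U` it is zero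
    have hw := hsingle (z - P.indicator (D.differential y)) (fun s hs => by
      rw [Pi.sub_apply]
      by_cases hsP : s ∈ P
      · have hsT : s ∈ T := by rw [← hu] at hsP; exact hsP.resolve_left hs
        rw [Set.indicator_of_mem hsP, hyT s hsT, sub_self]
      · rw [Set.indicator_of_notMem hsP, hz s hsP, sub_zero]) t htU
    rw [map_sub, Pi.sub_apply, hdz _ (hTP (hμT t htU)),
      hP.differential_indicator hD (fun s hs => hyU s fun h => hs (hUP h)) (hTP (hμT t htU)),
      sub_zero, Pi.sub_apply, Set.indicator_of_mem ht, eq_comm, mul_eq_zero] at hw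
    have := hw.resolve_left (hμ0 t htU)
    linarith

end Filtration

/-! ### Matched pairs of states -/

section Pairs

variable {k : Fin D.n} {s s' t t' : D.State}

theorem diffCoeff_mul_self (hk : s.res k = false) (ht : t.res = Function.update s.res k true)
    (h : D.edgeCoeff k s t = 1) : D.diffCoeff s t * D.diffCoeff s t = 1 := by
  rw [diffCoeff_eq hk ht, h, mul_one]
  exact cubeSign_mul_self s.res k

theorem touch_update_iff (hD : D.IsPlanar) {ε : Fin D.n → Bool} (hk : ε k = false) {x : D.Edge} :
    D.Touch (Function.update ε k true) k x ↔ D.Touch ε k x := by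
  have hoff : ∀ l, l ≠ k → Function.update ε k true l = ε l := fun l hl =>
    Function.update_of_ne hl _ _
  by_cases hac : D.Conn ε (D.crossing k).a (D.crossing k).c
  · exact (touch_iff_of_conn (fun l hl => (hoff l hl).symm) hac).symm
  · exact touch_iff_of_conn hoff ((hD _ _ hk).2 hac)

theorem labelAt_eq_of_edgeCoeff_ne_zero (h : D.edgeCoeff k s t ≠ 0) {x : D.Edge}
    (hx : ¬ D.Touch s.res k x) : t.labelAt x = s.labelAt x := by
  unfold edgeCoeff at h
  have := by_contra fun hc => h (if_neg hc)
  unfold Touch at hx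
  exact this x (fun h => hx (Or.inl h)) fun h => hx (Or.inr h)

theorem labels_of_edgeCoeff_merge (hac : ¬ D.Conn s.res (D.crossing k).a (D.crossing k).c)
    (h : D.edgeCoeff k s t ≠ 0) : Label.mulCoeff (s.labelAt (D.crossing k).a)
      (s.labelAt (D.crossing k).c) (t.labelAt (D.crossing k).a) ≠ 0 := by
  rw [edgeCoeff_merge hac] at h
  rwa [if_pos (by_contra fun hc => h (if_neg hc))] at h

theorem labels_of_edgeCoeff_split (hac : D.Conn s.res (D.crossing k).a (D.crossing k).c)
    (hac' : ¬ D.Conn t.res (D.crossing k).a (D.crossing k).c)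
    (h : D.edgeCoeff k s t ≠ 0) : Label.comulCoeff (s.labelAt (D.crossing k).a)
      (t.labelAt (D.crossing k).a) (t.labelAt (D.crossing k).c) ≠ 0 := by
  rw [edgeCoeff_split hac hac'] at h
  rwa [if_pos (by_contra fun hc => h (if_neg hc))] at h

theorem update_update_false {ε : Fin D.n → Bool} (hk : ε k = true) :
    ε = Function.update (Function.update ε k false) k true := by
  rw [Function.update_idem, ← hk, Function.update_eq_self]

/-- The term of `Δ` with the label `X` on the circle of the edge `a`. -/
theorem exists_split (hD : D.IsPlanar) (hk : s.res k = false)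
    (hac : D.Conn s.res (D.crossing k).a (D.crossing k).c) :
    ∃ t : D.State, t.res = Function.update s.res k true ∧ t.labelAt (D.crossing k).a = .X ∧
      D.edgeCoeff k s t = 1 := by
  classical
  have hoff : ∀ l, l ≠ k → s.res l = Function.update s.res k true l := fun l hl =>
    (Function.update_of_ne hl _ _).symm
  have hac' : ¬ D.Conn (Function.update s.res k true) (D.crossing k).a (D.crossing k).c := by
    rw [hD _ _ hk]; exact not_not.2 hac
  set ε := Function.update s.res k true with hε
  let t := State.ofLabel ε
    (fun x => if D.Conn ε x (D.crossing k).a then .X else s.labelAt x) fun x y h => by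
      have h1 : D.Conn ε x (D.crossing k).a ↔ D.Conn ε y (D.crossing k).a :=
        ⟨h.symm.trans, h.trans⟩
      simp only [h1, State.labelAt_congr ((conn_iff_of_conn hoff hac).2 (Or.inl h))]
  have ht : ∀ x, t.labelAt x = if D.Conn ε x (D.crossing k).a then .X else s.labelAt x :=
    fun x => rfl
  refine ⟨t, rfl, by rw [ht, if_pos (Conn.refl _ _)], ?_⟩
  rw [edgeCoeff_split (t := t) hac hac', if_pos, ht, if_pos (Conn.refl _ _), ht,
    if_neg fun h => hac' h.symm, State.labelAt_congr hac]
  · cases s.labelAt (D.crossing k).c <;> rfl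
  · intro x hx
    rw [ht, if_neg]
    intro h
    rw [← touch_update_iff hD hk] at hx
    exact hx (Or.inl h)

theorem exists_of_split (hD : D.IsPlanar) (hk : t.res k = true)
    (hac : ¬ D.Conn t.res (D.crossing k).a (D.crossing k).c)
    (hX : t.labelAt (D.crossing k).a = .X) :
    ∃ s : D.State, s.res k = false ∧ t.res = Function.update s.res k true ∧
      D.edgeCoeff k s t = 1 := by
  classical
  set ε := Function.update t.res k false with hε
  have hεk : ε k = false := Function.update_self _ _ _
  have htε : t.res = Function.update ε k true := update_update_false hk
  have hoff : ∀ l, l ≠ k → ε l = t.res l := fun l hl => Function.update_of_ne hl _ _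
  have hac' : D.Conn ε (D.crossing k).a (D.crossing k).c := by
    rw [htε, hD _ _ hεk, not_not] at hac; exact hac
  let s := State.ofLabel ε
    (fun x => if D.Conn ε x (D.crossing k).a then t.labelAt (D.crossing k).c else t.labelAt x)
    fun x y h => by
      have h1 : D.Conn ε x (D.crossing k).a ↔ D.Conn ε y (D.crossing k).a :=
        ⟨h.symm.trans, h.trans⟩
      by_cases h2 : D.Conn ε y (D.crossing k).a
      · simp only [h1, h2, if_true]
      · simp only [h1, h2, if_false]
        refine State.labelAt_congr (((conn_iff_of_conn hoff hac').1 h).resolve_right ?_)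
        rintro ⟨-, h3⟩
        exact h2 (((touch_iff_of_conn hoff hac').2 h3).elim id fun h => h.trans hac'.symm)
  have hs : ∀ x, s.labelAt x =
    if D.Conn ε x (D.crossing k).a then t.labelAt (D.crossing k).c else t.labelAt x := fun x => rfl
  refine ⟨s, hεk, htε, ?_⟩
  rw [edgeCoeff_split (s := s) hac' hac, if_pos, hs, if_pos (Conn.refl _ _), hX]
  · cases t.labelAt (D.crossing k).c <;> rfl
  · intro x hx
    rw [hs, if_neg (c := D.Conn ε x _) fun h => hx (Or.inl h)]

theorem exists_merge (hD : D.IsPlanar) (hk : s.res k = false)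
    (hac : ¬ D.Conn s.res (D.crossing k).a (D.crossing k).c)
    (h1 : s.labelAt (D.crossing k).a = .one ∨ s.labelAt (D.crossing k).c = .one) :
    ∃ t : D.State, t.res = Function.update s.res k true ∧ D.edgeCoeff k s t = 1 := by
  classical
  have hoff : ∀ l, l ≠ k → Function.update s.res k true l = s.res l := fun l hl =>
    Function.update_of_ne hl _ _
  have hac' : D.Conn (Function.update s.res k true) (D.crossing k).a (D.crossing k).c := by
    rw [hD _ _ hk]; exact hac
  set ε := Function.update s.res k true with hε
  obtain ⟨v, hv⟩ : ∃ v, Label.mulCoeff (s.labelAt (D.crossing k).a)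
      (s.labelAt (D.crossing k).c) v = 1 := by
    generalize s.labelAt (D.crossing k).a = u at *
    generalize s.labelAt (D.crossing k).c = w at *
    rcases h1 with rfl | rfl
    · exact ⟨w, by cases w <;> rfl⟩
    · exact ⟨u, by cases u <;> rfl⟩
  let t := State.ofLabel ε
    (fun x => if D.Conn ε x (D.crossing k).a then v else s.labelAt x) fun x y h => by
      have h1 : D.Conn ε x (D.crossing k).a ↔ D.Conn ε y (D.crossing k).a :=
        ⟨h.symm.trans, h.trans⟩
      by_cases h2 : D.Conn ε y (D.crossing k).a
      · simp only [h1, h2, if_true]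
      · simp only [h1, h2, if_false]
        refine State.labelAt_congr (((conn_iff_of_conn hoff hac').1 h).resolve_right ?_)
        rintro ⟨-, h3⟩
        exact h2 (((touch_iff_of_conn hoff hac').2 h3).elim id fun h => h.trans hac'.symm)
  have ht : ∀ x, t.labelAt x = if D.Conn ε x (D.crossing k).a then v else s.labelAt x :=
    fun x => rfl
  refine ⟨t, rfl, ?_⟩
  rw [edgeCoeff_merge hac, if_pos, ht, if_pos (Conn.refl _ _), hv]
  intro x hx
  rw [ht, if_neg]
  intro h
  rw [← touch_update_iff hD hk] at hx
  exact hx (Or.inl h)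

/-- Undoing a merge: the circle of an edge `e` at the crossing gets the label `1`. -/
theorem exists_of_merge (hD : D.IsPlanar) (hk : t.res k = true) {e : D.Edge}
    (hac : ¬ D.Conn (Function.update t.res k false) (D.crossing k).a (D.crossing k).c)
    (he : D.Touch (Function.update t.res k false) k e) :
    ∃ s : D.State, s.res = Function.update t.res k false ∧ s.labelAt e = .one ∧
      D.edgeCoeff k s t = 1 := by
  classical
  set ε := Function.update t.res k false with hε
  have hεk : ε k = false := Function.update_self _ _ _
  have htε : t.res = Function.update ε k true := update_update_false hk
  have hoff : ∀ l, l ≠ k → t.res l = ε l := fun l hl => (Function.update_of_ne hl _ _).symm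
  have hac' : D.Conn t.res (D.crossing k).a (D.crossing k).c := by
    rw [htε, hD _ _ hεk]; exact hac
  let s := State.ofLabel ε (fun x => if D.Conn ε x e then .one else t.labelAt x) fun x y h => by
      have h1 : D.Conn ε x e ↔ D.Conn ε y e := ⟨h.symm.trans, h.trans⟩
      simp only [h1, State.labelAt_congr ((conn_iff_of_conn hoff hac').2 (Or.inl h))]
  have hs : ∀ x, s.labelAt x = if D.Conn ε x e then .one else t.labelAt x := fun x => rfl
  refine ⟨s, rfl, by rw [hs, if_pos (Conn.refl _ _)], ?_⟩
  rw [edgeCoeff_merge (s := s) hac, if_pos, hs, hs, State.labelAt_congr hac'.symm]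
  · rcases he with he | he
    · rw [if_pos he.symm, if_neg fun h => hac (h.trans he).symm]
      cases t.labelAt (D.crossing k).a <;> rfl
    · rw [if_pos he.symm, if_neg fun h => hac (h.trans he)]
      cases t.labelAt (D.crossing k).a <;> rfl
  · intro x hx
    rw [hs, if_neg fun h => hx (he.of_conn h)]

theorem eq_of_split_target (hac : D.Conn s.res (D.crossing k).a (D.crossing k).c)
    (hac' : ¬ D.Conn t.res (D.crossing k).a (D.crossing k).c)
    (ht : t.res = Function.update s.res k true) (ht' : t'.res = Function.update s.res k true)
    (h : D.edgeCoeff k s t ≠ 0) (h' : D.edgeCoeff k s t' ≠ 0)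
    (hX : t.labelAt (D.crossing k).a = .X) (hX' : t'.labelAt (D.crossing k).a = .X) : t = t' := by
  have hres : t.res = t'.res := ht.trans ht'.symm
  have hoff : ∀ l, l ≠ k → s.res l = t.res l := fun l hl => by rw [ht, Function.update_of_ne hl]
  have h1 := labels_of_edgeCoeff_split hac hac' h
  have h2 := labels_of_edgeCoeff_split hac (by rwa [← hres]) h'
  refine State.ext_labelAt hres fun x => ?_
  by_cases hx : D.Touch s.res k x
  · rcases (touch_iff_of_conn hoff hac).1 hx with hx | hx
    · rw [State.labelAt_congr hx, State.labelAt_congr (s := t') (hres ▸ hx), hX, hX']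
    · rw [State.labelAt_congr hx, State.labelAt_congr (s := t') (hres ▸ hx)]
      rw [hX] at h1; rw [hX'] at h2
      generalize s.labelAt (D.crossing k).a = u at *
      generalize t.labelAt (D.crossing k).c = v at *
      generalize t'.labelAt (D.crossing k).c = w at *
      cases u <;> cases v <;> cases w <;> simp [Label.comulCoeff] at h1 h2 ⊢
  · rw [labelAt_eq_of_edgeCoeff_ne_zero h hx, labelAt_eq_of_edgeCoeff_ne_zero h' hx]

theorem update_injective_of_false {ε ε' : Fin D.n → Bool} (hk : ε k = false) (hk' : ε' k = false)
    (h : Function.update ε k true = Function.update ε' k true) : ε = ε' := by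
  ext l
  by_cases hl : l = k
  · rw [hl, hk, hk']
  · have := congrFun h l
    rwa [Function.update_of_ne hl, Function.update_of_ne hl] at this

theorem eq_of_split_source (hac : D.Conn s.res (D.crossing k).a (D.crossing k).c)
    (hac' : ¬ D.Conn t.res (D.crossing k).a (D.crossing k).c) (hres : s.res = s'.res)
    (h : D.edgeCoeff k s t ≠ 0) (h' : D.edgeCoeff k s' t ≠ 0)
    (hX : t.labelAt (D.crossing k).a = .X) : s = s' := by
  have h1 := labels_of_edgeCoeff_split hac hac' h
  have h2 := labels_of_edgeCoeff_split (hres ▸ hac) hac' h'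
  refine State.ext_labelAt hres fun x => ?_
  by_cases hx : D.Touch s.res k x
  · have hx' : D.Conn s.res x (D.crossing k).a := hx.elim id fun hx => hx.trans hac.symm
    rw [State.labelAt_congr hx', State.labelAt_congr (s := s') (hres ▸ hx')]
    rw [hX] at h1 h2
    generalize s.labelAt (D.crossing k).a = u at *
    generalize s'.labelAt (D.crossing k).a = v at *
    generalize t.labelAt (D.crossing k).c = w at *
    cases u <;> cases v <;> cases w <;> simp [Label.comulCoeff] at h1 h2 ⊢
  · rw [← labelAt_eq_of_edgeCoeff_ne_zero h hx, labelAt_eq_of_edgeCoeff_ne_zero h' (hres ▸ hx)]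

theorem eq_of_merge_target (hac : ¬ D.Conn s.res (D.crossing k).a (D.crossing k).c)
    (hac' : D.Conn t.res (D.crossing k).a (D.crossing k).c)
    (ht : t.res = Function.update s.res k true) (ht' : t'.res = Function.update s.res k true)
    (h : D.edgeCoeff k s t ≠ 0) (h' : D.edgeCoeff k s t' ≠ 0) : t = t' := by
  have hres : t.res = t'.res := ht.trans ht'.symm
  have hoff : ∀ l, l ≠ k → t.res l = s.res l := fun l hl => by rw [ht, Function.update_of_ne hl]
  have h1 := labels_of_edgeCoeff_merge hac h
  have h2 := labels_of_edgeCoeff_merge hac h'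
  refine State.ext_labelAt hres fun x => ?_
  by_cases hx : D.Touch s.res k x
  · have hx' : D.Conn t.res x (D.crossing k).a :=
      ((touch_iff_of_conn hoff hac').2 hx).elim id fun hx => hx.trans hac'.symm
    rw [State.labelAt_congr hx', State.labelAt_congr (s := t') (hres ▸ hx')]
    generalize s.labelAt (D.crossing k).a = u at *
    generalize s.labelAt (D.crossing k).c = u' at *
    generalize t.labelAt (D.crossing k).a = v at *
    generalize t'.labelAt (D.crossing k).a = w at *
    cases u <;> cases u' <;> cases v <;> cases w <;> simp [Label.mulCoeff] at h1 h2 ⊢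
  · rw [labelAt_eq_of_edgeCoeff_ne_zero h hx, labelAt_eq_of_edgeCoeff_ne_zero h' hx]

theorem eq_of_merge_source (hac : ¬ D.Conn s.res (D.crossing k).a (D.crossing k).c)
    (hres : s.res = s'.res) {e : D.Edge} (he : D.Touch s.res k e)
    (h : D.edgeCoeff k s t ≠ 0) (h' : D.edgeCoeff k s' t ≠ 0)
    (h1 : s.labelAt e = .one) (h1' : s'.labelAt e = .one) : s = s' := by
  have h2 := labels_of_edgeCoeff_merge hac h
  have h3 := labels_of_edgeCoeff_merge (hres ▸ hac) h'
  refine State.ext_labelAt hres fun x => ?_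
  by_cases hx : D.Touch s.res k x
  · have key : s.labelAt (D.crossing k).a = s'.labelAt (D.crossing k).a ∧
        s.labelAt (D.crossing k).c = s'.labelAt (D.crossing k).c := by
      rcases he with he | he
      all_goals
        rw [State.labelAt_congr he] at h1
        rw [State.labelAt_congr (s := s') (hres ▸ he)] at h1'
        rw [h1] at h2 ⊢
        rw [h1'] at h3 ⊢
      · generalize s.labelAt (D.crossing k).c = u at *
        generalize s'.labelAt (D.crossing k).c = v at *
        generalize t.labelAt (D.crossing k).a = w at *
        cases u <;> cases v <;> cases w <;> simp [Label.mulCoeff] at h2 h3 ⊢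
      · generalize s.labelAt (D.crossing k).a = u at *
        generalize s'.labelAt (D.crossing k).a = v at *
        generalize t.labelAt (D.crossing k).a = w at *
        cases u <;> cases v <;> cases w <;> simp [Label.mulCoeff] at h2 h3 ⊢
    rcases hx with hx | hx
    · rw [State.labelAt_congr hx, State.labelAt_congr (s := s') (hres ▸ hx), key.1]
    · rw [State.labelAt_congr hx, State.labelAt_congr (s := s') (hres ▸ hx), key.2]
  · rw [← labelAt_eq_of_edgeCoeff_ne_zero h hx, labelAt_eq_of_edgeCoeff_ne_zero h' (hres ▸ hx)]

end Pairs

/-! ### Boxes of resolutions and two moves -/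

/-- The resolution `ε` uses all crossings of `lo`, and only crossings of `hi`. -/
def InBox (D : LinkDiagram) (lo hi : Set (Fin D.n)) (ε : Fin D.n → Bool) : Prop :=
  (∀ r ∈ lo, ε r = true) ∧ ∀ r, ε r = true → r ∈ hi

/-- The states of quantum degree `j` whose resolution lies between `lo` and `hi`, and which have the
label `1` on the circles of the edges in `F`. -/
def box (D : LinkDiagram) (lo hi : Set (Fin D.n)) (F : Set D.Edge) (j : ℤ) : Set D.State :=
  {s | D.InBox lo hi s.res ∧ (∀ x ∈ F, s.labelAt x = .one) ∧ s.qdeg = j}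

/-- Between `lo` and `hi`, the circle of `x` is not affected by a change of the resolution. -/
def Protected (D : LinkDiagram) (lo hi : Set (Fin D.n)) (x : D.Edge) : Prop :=
  ∀ ε, D.InBox lo hi ε → ∀ r ∈ hi, r ∉ lo → ¬ D.Touch ε r x

section Box

variable {lo hi lo' hi' : Set (Fin D.n)} {F : Set D.Edge} {j : ℤ} {k : Fin D.n}
  {ε : Fin D.n → Bool} {s t : D.State}

theorem InBox.mono (h : D.InBox lo' hi' ε) (hlo : lo ⊆ lo') (hhi : hi' ⊆ hi) : D.InBox lo hi ε :=
  ⟨fun r hr => h.1 r (hlo hr), fun r hr => hhi (h.2 r hr)⟩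

theorem Protected.mono {x : D.Edge} (h : D.Protected lo hi x) (hlo : lo ⊆ lo') (hhi : hi' ⊆ hi) :
    D.Protected lo' hi' x :=
  fun ε hε r hr hr' => h ε (hε.mono hlo hhi) r (hhi hr) fun h => hr' (hlo h)

theorem InBox.update_true (h : D.InBox lo hi ε) (hk : k ∈ hi) :
    D.InBox lo hi (Function.update ε k true) := by
  refine ⟨fun r hr => ?_, fun r hr => ?_⟩ <;> by_cases hrk : r = k
  · rw [hrk, Function.update_self]
  · rw [Function.update_of_ne hrk, h.1 r hr]
  · rwa [hrk]
  · rw [Function.update_of_ne hrk] at hr; exact h.2 r hr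

theorem InBox.update_false (h : D.InBox lo hi ε) (hk : k ∉ lo) :
    D.InBox lo hi (Function.update ε k false) := by
  refine ⟨fun r hr => ?_, fun r hr => ?_⟩ <;> by_cases hrk : r = k
  · exact absurd (hrk ▸ hr) hk
  · rw [Function.update_of_ne hrk, h.1 r hr]
  · rw [hrk, Function.update_self] at hr; cases hr
  · rw [Function.update_of_ne hrk] at hr; exact h.2 r hr

theorem mem_box_iff_of_edgeCoeff (hD : D.IsPlanar) (hF : ∀ x ∈ F, D.Protected lo hi x)
    (hk : s.res k = false) (ht : t.res = Function.update s.res k true)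
    (hs : D.InBox lo hi s.res) (ht' : D.InBox lo hi t.res) (h : D.edgeCoeff k s t ≠ 0) :
    s ∈ D.box lo hi F j ↔ t ∈ D.box lo hi F j := by
  have hkhi : k ∈ hi := ht'.2 k (by rw [ht, Function.update_self])
  have hklo : k ∉ lo := fun hk' => by have := hs.1 k hk'; rw [hk] at this; cases this
  have h1 : ∀ x ∈ F, t.labelAt x = s.labelAt x := fun x hx =>
    labelAt_eq_of_edgeCoeff_ne_zero h (hF x hx _ hs k hkhi hklo)
  have h2 := qdeg_eq_of_edgeCoeff_ne_zero hD hk ht h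
  constructor
  · rintro ⟨-, h3, h4⟩
    exact ⟨ht', fun x hx => (h1 x hx).trans (h3 x hx), h2.trans h4⟩
  · rintro ⟨-, h3, h4⟩
    exact ⟨hs, fun x hx => (h1 x hx).symm.trans (h3 x hx), h2.symm.trans h4⟩

theorem isConvex_box (hD : D.IsPlanar) (hF : ∀ x ∈ F, D.Protected lo hi x) :
    IsConvex (D.box lo hi F j) := by
  intro s hs t ht u h1 h2
  obtain ⟨k, hk, hu, hsu⟩ := exists_of_diffCoeff_ne_zero h1
  obtain ⟨l, hl, htu, -⟩ := exists_of_diffCoeff_ne_zero h2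
  refine (mem_box_iff_of_edgeCoeff hD hF hk hu hs.1 ⟨fun r hr => ?_, fun r hr => ?_⟩ hsu).1 hs
  · rw [hu]
    by_cases hrk : r = k
    · rw [hrk, Function.update_self]
    · rw [Function.update_of_ne hrk, hs.1.1 r hr]
  · refine ht.1.2 r ?_
    rw [htu]
    by_cases hrl : r = l
    · rw [hrl, Function.update_self]
    · rw [Function.update_of_ne hrl, hr]

/-- The states in which the small circle at a crossing `k` is absent or labelled `X` cancel. -/
theorem isAcyclic_split_part (hD : D.IsPlanar) (hF : ∀ x ∈ F, D.Protected lo hi x)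
    (hkhi : k ∈ hi) (hklo : k ∉ lo)
    (hsplit : ∀ ε, D.InBox lo hi ε → ε k = true → ¬ D.Conn ε (D.crossing k).a (D.crossing k).c)
    (hconv : IsConvex (D.box lo hi F j ∩
      {s | s.res k = false ∨ s.labelAt (D.crossing k).a = .X})) :
    IsAcyclic (D.box lo hi F j ∩ {s | s.res k = false ∨ s.labelAt (D.crossing k).a = .X}) := by
  have key : ∀ s t : D.State, D.InBox lo hi t.res → s.res k = false → t.res k = true →
      D.diffCoeff s t ≠ 0 → t.res = Function.update s.res k true ∧ D.edgeCoeff k s t ≠ 0 ∧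
        ¬ D.Conn t.res (D.crossing k).a (D.crossing k).c ∧
        D.Conn s.res (D.crossing k).a (D.crossing k).c := by
    intro s t ht hsk htk h
    obtain ⟨l, hl, htl, hst⟩ := exists_of_diffCoeff_ne_zero h
    obtain rfl : l = k := by
      by_contra hlk
      rw [htl, Function.update_of_ne (Ne.symm hlk), hsk] at htk
      cases htk
    have h1 := hsplit _ ht htk
    refine ⟨htl, hst, h1, ?_⟩
    rwa [htl, hD _ _ hsk, not_not] at h1
  refine IsAcyclic.of_matching hD (U := D.box lo hi F j ∩ {s | s.res k = false})
    (T := D.box lo hi F j ∩ {s | s.res k = true ∧ s.labelAt (D.crossing k).a = .X}) hconv ?_ ?_ ?_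
    ?_ ?_
  · ext s
    cases h : s.res k <;> simp [h]
  · rintro s ⟨hs, hsk⟩
    have h1 := hsplit _ (hs.1.update_true hkhi) (Function.update_self _ _ _)
    rw [hD _ _ hsk, not_not] at h1
    obtain ⟨t, ht, hX, hc⟩ := exists_split hD hsk h1
    refine ⟨t, ⟨(mem_box_iff_of_edgeCoeff hD hF hsk ht hs.1
      (by rw [ht]; exact hs.1.update_true hkhi) (by simp [hc])).1 hs, ?_, hX⟩,
      diffCoeff_mul_self hsk ht hc⟩
    rw [ht, Function.update_self]
  · rintro t ⟨ht, htk, hX⟩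
    obtain ⟨s, hsk, hts, hc⟩ := exists_of_split hD htk (hsplit _ ht.1 htk) hX
    have hsb : D.InBox lo hi s.res := by
      have : s.res = Function.update t.res k false := by
        rw [hts, Function.update_idem, ← hsk, Function.update_eq_self]
      rw [this]; exact ht.1.update_false hklo
    refine ⟨s, ⟨(mem_box_iff_of_edgeCoeff hD hF hsk hts hsb ht.1 (by simp [hc])).2 ht, hsk⟩, ?_⟩
    have := diffCoeff_mul_self hsk hts hc
    intro h; rw [h] at this; simp at this
  · rintro s ⟨hs, hsk⟩ t ⟨ht, htk, hX⟩ t' ⟨ht', htk', hX'⟩ h h'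
    obtain ⟨h1, h2, h3, h4⟩ := key s t ht.1 hsk htk h
    obtain ⟨h1', h2', -, -⟩ := key s t' ht'.1 hsk htk' h'
    exact eq_of_split_target h4 h3 h1 h1' h2 h2' hX hX'
  · rintro s ⟨hs, hsk⟩ s' ⟨hs', hsk'⟩ t ⟨ht, htk, hX⟩ h h'
    obtain ⟨h1, h2, h3, h4⟩ := key s t ht.1 hsk htk h
    obtain ⟨h1', h2', -, -⟩ := key s' t ht.1 hsk' htk h'
    exact eq_of_split_source h4 h3 (update_injective_of_false hsk hsk' (h1.symm.trans h1')) h2 h2'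
      hX

theorem labelAt_eq_of_not_touch {s t : D.State} {x : D.Edge} (hkt : t.res k = s.res k)
    (h : D.diffCoeff s t ≠ 0) (hs : D.InBox lo hi s.res) (ht : D.InBox lo hi t.res)
    (hx : ∀ r ∈ hi, r ∉ lo → r ≠ k → ¬ D.Touch s.res r x) : t.labelAt x = s.labelAt x := by
  obtain ⟨r, hr, htr, hst⟩ := exists_of_diffCoeff_ne_zero h
  refine labelAt_eq_of_edgeCoeff_ne_zero hst (hx r (ht.2 r ?_) (fun hr' => ?_) ?_)
  · rw [htr, Function.update_self]
  · have := hs.1 r hr'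
    rw [hr] at this; cases this
  · rintro rfl
    rw [htr, Function.update_self, hr] at hkt
    cases hkt

/-- The chain level form of the first Reidemeister move: if the `1`-resolution of `k` always
splits off a circle that meets no other active crossing, then up to acyclic pieces `k` is
`1`-resolved and this circle has the label `1`. -/
theorem IsAcyclic.of_curl (hD : D.IsPlanar) (hF : ∀ x ∈ F, D.Protected lo hi x)
    (hkhi : k ∈ hi) (hklo : k ∉ lo)
    (hsplit : ∀ ε, D.InBox lo hi ε → ε k = true → ¬ D.Conn ε (D.crossing k).a (D.crossing k).c ∧
      ∀ r ∈ hi, r ∉ lo → r ≠ k → ¬ D.Touch ε r (D.crossing k).a)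
    (h : IsAcyclic (D.box (insert k lo) hi (insert (D.crossing k).a F) j)) :
    IsAcyclic (D.box lo hi F j) := by
  set A := D.box lo hi F j ∩ {s | s.res k = false ∨ s.labelAt (D.crossing k).a = .X} with hA
  set B := D.box (insert k lo) hi (insert (D.crossing k).a F) j with hB
  have hmemB : ∀ s, s ∈ B ↔ s ∈ D.box lo hi F j ∧ s.res k = true ∧
      s.labelAt (D.crossing k).a = .one := fun s => by
    simp only [hB, box, InBox, Set.mem_ofPred_eq, Set.forall_mem_insert]
    tauto
  have hu : A ∪ B = D.box lo hi F j := by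
    ext s
    simp only [Set.mem_union, hmemB, hA, Set.mem_inter_iff, Set.mem_ofPred_eq]
    cases s.res k <;> rcases label_eq_one_or (s.labelAt (D.crossing k).a) with h | h <;> simp [h]
  have hBA : ∀ s ∈ B, ∀ t ∈ A, D.diffCoeff s t = 0 := by
    intro s hs t ht
    obtain ⟨hs, hsk, hs1⟩ := (hmemB s).1 hs
    by_contra hc
    have htk : t.res k = true := by
      obtain ⟨r, -, htr, -⟩ := exists_of_diffCoeff_ne_zero hc
      rw [htr, Function.update_apply]
      split_ifs
      exacts [rfl, hsk]
    have := labelAt_eq_of_not_touch (htk.trans hsk.symm) hc hs.1 ht.1.1 (hsplit _ hs.1 hsk).2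
    rw [hs1] at this
    rcases ht.2 with h | h
    · rw [htk] at h; cases h
    · rw [this] at h; cases h
  have hP := isConvex_box (j := j) hD hF
  exact IsAcyclic.of_filtration hD hP hu hBA (isAcyclic_split_part hD hF hkhi hklo
    (fun ε hε hk => (hsplit ε hε hk).1) (hP.quotient hu hBA)) h

/-- The chain level form of the second Reidemeister move: if the `1`-resolution of `k` splits off a
circle that meets exactly one other active crossing `l`, where it is merged into another circle,
then up to acyclic pieces `k` is `0`-resolved and `l` is `1`-resolved. -/
theorem IsAcyclic.of_slide (hD : D.IsPlanar) (hF : ∀ x ∈ F, D.Protected lo hi x) {l : Fin D.n}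
    (hkl : k ≠ l) (hkhi : k ∈ hi) (hklo : k ∉ lo) (hlhi : l ∈ hi) (hllo : l ∉ lo)
    (hsplit : ∀ ε, D.InBox lo hi ε → ε k = true → ε l = false →
      ¬ D.Conn ε (D.crossing k).a (D.crossing k).c ∧
      (∀ r ∈ hi, r ∉ lo → r ≠ k → r ≠ l → ¬ D.Touch ε r (D.crossing k).a) ∧
      D.Touch ε l (D.crossing k).a ∧ ¬ D.Conn ε (D.crossing l).a (D.crossing l).c)
    (h : IsAcyclic (D.box (insert l lo) (hi \ {k}) F j)) :
    IsAcyclic (D.box lo hi F j) := by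
  have hFl : ∀ x ∈ F, D.Protected lo (hi \ {l}) x := fun x hx =>
    (hF x hx).mono subset_rfl Set.sdiff_subset
  have hP := isConvex_box (j := j) hD hF
  set A := D.box lo (hi \ {l}) F j ∩ {s | s.res k = false ∨ s.labelAt (D.crossing k).a = .X}
    with hA
  set B₀ := D.box (insert l lo) (hi \ {k}) F j with hB₀
  set U := D.box lo hi F j ∩
    {s | s.res k = true ∧ s.res l = false ∧ s.labelAt (D.crossing k).a = .one} with hU
  set T := D.box lo hi F j ∩ {s | s.res k = true ∧ s.res l = true} with hT
  have hmemA : ∀ s, s ∈ A ↔ s ∈ D.box lo hi F j ∧ s.res l = false ∧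
      (s.res k = false ∨ s.labelAt (D.crossing k).a = .X) := fun s => by
    have : D.InBox lo (hi \ {l}) s.res ↔ D.InBox lo hi s.res ∧ s.res l = false := by
      constructor
      · intro hs
        refine ⟨hs.mono subset_rfl Set.sdiff_subset, Bool.eq_false_iff.2 fun hl => ?_⟩
        exact (hs.2 l hl).2 rfl
      · rintro ⟨hs, hl⟩
        refine ⟨hs.1, fun r hr => ⟨hs.2 r hr, ?_⟩⟩
        rintro rfl
        rw [hl] at hr; cases hr
    simp only [hA, box, Set.mem_inter_iff, Set.mem_ofPred_eq, this]
    tauto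
  have hmemB₀ : ∀ s, s ∈ B₀ ↔ s ∈ D.box lo hi F j ∧ s.res k = false ∧ s.res l = true := fun s => by
    have : D.InBox (insert l lo) (hi \ {k}) s.res ↔
        D.InBox lo hi s.res ∧ s.res k = false ∧ s.res l = true := by
      constructor
      · intro hs
        refine ⟨hs.mono (Set.subset_insert _ _) Set.sdiff_subset,
          Bool.eq_false_iff.2 fun hl => ?_, hs.1 l (Set.mem_insert _ _)⟩
        exact (hs.2 k hl).2 rfl
      · rintro ⟨hs, hk, hl⟩
        refine ⟨fun r hr => ?_, fun r hr => ⟨hs.2 r hr, ?_⟩⟩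
        · rcases hr with rfl | hr
          exacts [hl, hs.1 r hr]
        · rintro rfl
          rw [hk] at hr; cases hr
    simp only [hB₀, box, Set.mem_ofPred_eq, this]
    tauto
  have htrue : ∀ {s t : D.State} {r : Fin D.n}, D.diffCoeff s t ≠ 0 → s.res r = true →
      t.res r = true := by
    intro s t r hc hr
    obtain ⟨r', -, htr, -⟩ := exists_of_diffCoeff_ne_zero hc
    rw [htr, Function.update_apply]
    split_ifs
    exacts [rfl, hr]
  have hu : A ∪ (B₀ ∪ (U ∪ T)) = D.box lo hi F j := by
    ext s
    simp only [Set.mem_union, hmemA, hmemB₀, hU, hT, Set.mem_inter_iff, Set.mem_ofPred_eq]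
    cases s.res k <;> cases s.res l <;>
      rcases label_eq_one_or (s.labelAt (D.crossing k).a) with h | h <;> simp [h]
  have hBA : ∀ s ∈ B₀ ∪ (U ∪ T), ∀ t ∈ A, D.diffCoeff s t = 0 := by
    intro s hs t ht
    obtain ⟨ht, htl, ht1⟩ := (hmemA t).1 ht
    by_contra hc
    have hsl : s.res l = false := Bool.eq_false_iff.2 fun hsl => by
      rw [htrue hc hsl] at htl; cases htl
    have hsU : s ∈ U := by
      rcases hs with hs | hs | hs
      · rw [((hmemB₀ s).1 hs).2.2] at hsl; cases hsl
      · exact hs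
      · rw [hs.2.2] at hsl; cases hsl
    obtain ⟨hs, hsk, -, hs1⟩ := hsU
    have htk := htrue hc hsk
    have hsep := (hsplit _ hs.1 hsk hsl).2.1
    have : t.labelAt (D.crossing k).a = s.labelAt (D.crossing k).a := by
      obtain ⟨r, hr, htr, hst⟩ := exists_of_diffCoeff_ne_zero hc
      refine labelAt_eq_of_edgeCoeff_ne_zero hst (hsep r (ht.1.2 r ?_) (fun hr' => ?_) ?_ ?_)
      · rw [htr, Function.update_self]
      · have := hs.1.1 r hr'
        rw [hr] at this; cases this
      · rintro rfl
        rw [hr] at hsk; cases hsk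
      · rintro rfl
        rw [htr, Function.update_self] at htl; cases htl
    rw [hs1] at this
    rcases ht1 with h | h
    · rw [htk] at h; cases h
    · rw [this] at h; cases h
  have hCB : ∀ s ∈ U ∪ T, ∀ t ∈ B₀, D.diffCoeff s t = 0 := by
    intro s hs t ht
    have htk := ((hmemB₀ t).1 ht).2.1
    by_contra hc
    have hsk : s.res k = true := by rcases hs with hs | hs <;> exact hs.2.1
    rw [htrue hc hsk] at htk; cases htk
  have hB := hP.sub hu hBA
  have hA' : IsAcyclic A := isAcyclic_split_part hD hFl ⟨hkhi, hkl⟩ hklo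
    (fun ε hε hk => (hsplit ε (hε.mono subset_rfl Set.sdiff_subset) hk
      (Bool.eq_false_iff.2 fun hl => (hε.2 l hl).2 rfl)).1) (hP.quotient hu hBA)
  -- of the states outside `A`, those with `k` `0`-resolved form the remaining box, and the merging
  -- map of `l` matches the rest
  refine IsAcyclic.of_filtration hD hP hu hBA hA'
    (IsAcyclic.of_filtration hD hB rfl hCB h ?_)
  have key : ∀ s ∈ U, ∀ t ∈ T, D.diffCoeff s t ≠ 0 →
      t.res = Function.update s.res l true ∧ D.edgeCoeff l s t ≠ 0 := by
    rintro s ⟨hs, hsk, hsl, hs1⟩ t ⟨ht, htk, htl⟩ hc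
    obtain ⟨r, hr, htr, hst⟩ := exists_of_diffCoeff_ne_zero hc
    obtain rfl : r = l := by
      by_contra hrl
      rw [htr, Function.update_of_ne (Ne.symm hrl), hsl] at htl
      cases htl
    exact ⟨htr, hst⟩
  refine IsAcyclic.of_matching hD (hB.sub rfl hCB) rfl ?_ ?_ ?_ ?_
  · rintro s ⟨hs, hsk, hsl, hs1⟩
    obtain ⟨-, -, htouch, hac⟩ := hsplit _ hs.1 hsk hsl
    obtain ⟨t, ht, hc⟩ := exists_merge hD hsl hac (by
      rcases htouch with h | h
      · exact Or.inl ((State.labelAt_congr h).symm.trans hs1)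
      · exact Or.inr ((State.labelAt_congr h).symm.trans hs1))
    refine ⟨t, ⟨(mem_box_iff_of_edgeCoeff hD hF hsl ht hs.1
      (by rw [ht]; exact hs.1.update_true hlhi) (by simp [hc])).1 hs, ?_, ?_⟩,
      diffCoeff_mul_self hsl ht hc⟩
    · rw [ht, Function.update_of_ne hkl, hsk]
    · rw [ht, Function.update_self]
  · rintro t ⟨ht, htk, htl⟩
    have hbox := ht.1.update_false hllo
    obtain ⟨-, -, htouch, hac⟩ := hsplit _ hbox (by rw [Function.update_of_ne hkl, htk])
      (Function.update_self _ _ _)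
    obtain ⟨s, hs, hs1, hc⟩ := exists_of_merge hD htl hac htouch
    have hsl : s.res l = false := by rw [hs, Function.update_self]
    have hts : t.res = Function.update s.res l true := by rw [hs]; exact update_update_false htl
    refine ⟨s, ⟨(mem_box_iff_of_edgeCoeff hD hF hsl hts (by rwa [hs]) ht.1 (by simp [hc])).2 ht,
      ?_, hsl, hs1⟩, ?_⟩
    · rw [hs, Function.update_of_ne hkl, htk]
    · have := diffCoeff_mul_self hsl hts hc
      intro h; rw [h] at this; simp at this
  · rintro s hs t ht t' ht' hc hc'
    obtain ⟨h1, h2⟩ := key s hs t ht hc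
    obtain ⟨h1', h2'⟩ := key s hs t' ht' hc'
    obtain ⟨-, -, -, hac⟩ := hsplit _ hs.1.1 hs.2.1 hs.2.2.1
    exact eq_of_merge_target hac (by rw [h1, hD _ _ hs.2.2.1]; exact hac) h1 h1' h2 h2'
  · rintro s hs s' hs' t ht hc hc'
    obtain ⟨h1, h2⟩ := key s hs t ht hc
    obtain ⟨h1', h2'⟩ := key s' hs' t ht hc'
    obtain ⟨-, -, htouch, hac⟩ := hsplit _ hs.1.1 hs.2.1 hs.2.2.1
    exact eq_of_merge_source hac
      (update_injective_of_false hs.2.2.1 hs'.2.2.1 (h1.symm.trans h1')) htouch h2 h2'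
      hs.2.2.2 hs'.2.2.2

end Box

end LinkDiagram

/-! ### Multiplying a permutation by a transposition -/

namespace Equiv.Perm

variable {α : Type*} [DecidableEq α] (ρ : Perm α) {u v : α}

/-- Until the orbit of `u` meets `u` or `v` again, the orbit of `v` under `ρ * swap u v` runs along
it. -/
theorem mul_swap_pow_apply {m : ℕ} (h : ∀ j, 0 < j → j < m → (ρ ^ j) u ≠ u ∧ (ρ ^ j) u ≠ v)
    {j : ℕ} (hj : 0 < j) (hjm : j ≤ m) : ((ρ * swap u v) ^ j) v = (ρ ^ j) u := by
  induction j with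
  | zero => omega
  | succ j ih =>
    rcases Nat.eq_zero_or_pos j with rfl | hj0
    · simp
    · rw [pow_succ', mul_apply, ih hj0 (by omega), mul_apply,
        swap_apply_of_ne_of_ne (h j hj0 (by omega)).1 (h j hj0 (by omega)).2, pow_succ', mul_apply]

/-- Composing a permutation with the transposition of `u` and `v` splits the common cycle of `u` and
`v`, or merges their two cycles. -/
theorem sameCycle_mul_swap_iff [Finite α] (huv : u ≠ v) :
    (ρ * swap u v).SameCycle u v ↔ ¬ ρ.SameCycle u v := by
  classical
  constructor
  · intro h hρ
    have hex : ∃ m, 0 < m ∧ (ρ ^ m) u = v := by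
      obtain ⟨m, -, hm⟩ := hρ.exists_pow_eq'
      refine ⟨m, Nat.pos_of_ne_zero fun h0 => huv ?_, hm⟩
      rw [← hm, h0]; rfl
    have hm := Nat.find_spec hex
    set m := Nat.find hex with hmdef
    have hlt : ∀ j, 0 < j → j < m → (ρ ^ j) u ≠ u ∧ (ρ ^ j) u ≠ v := by
      intro j hj hjm
      refine ⟨fun hu => ?_, fun hv => Nat.find_min hex hjm ⟨hj, hv⟩⟩
      refine Nat.find_min hex (m := m - j) (by omega) ⟨by omega, ?_⟩
      have : (ρ ^ m) u = (ρ ^ (m - j)) ((ρ ^ j) u) := by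
        rw [← mul_apply, ← pow_add, Nat.sub_add_cancel hjm.le]
      rw [← hm.2, this, hu]
    have hper : ((ρ * swap u v) ^ m) v = v := by
      rw [mul_swap_pow_apply ρ hlt hm.1 le_rfl, hm.2]
    obtain ⟨i, -, hi⟩ := h.symm.exists_pow_eq'
    have hmod : ((ρ * swap u v) ^ (i % m)) v = u := by
      have h2 : (((ρ * swap u v) ^ m) ^ (i / m)) v = v := Function.IsFixedPt.perm_pow hper (i / m)
      rw [← Nat.mod_add_div i m, pow_add, mul_apply, pow_mul, h2] at hi
      exact hi
    rcases Nat.eq_zero_or_pos (i % m) with h0 | h0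
    · rw [h0] at hmod
      exact huv hmod.symm
    · rw [mul_swap_pow_apply ρ hlt h0 (Nat.mod_lt _ hm.1).le] at hmod
      exact (hlt _ h0 (Nat.mod_lt _ hm.1)).1 hmod
  · intro hρ
    have hex : ∃ m, 0 < m ∧ (ρ ^ m) u = u :=
      ⟨orderOf ρ, orderOf_pos ρ, by simp [pow_orderOf_eq_one]⟩
    have hm := Nat.find_spec hex
    have hlt : ∀ j, 0 < j → j < Nat.find hex → (ρ ^ j) u ≠ u ∧ (ρ ^ j) u ≠ v := fun j hj hjm =>
      ⟨fun hu => Nat.find_min hex hjm ⟨hj, hu⟩, fun hv => hρ ⟨j, by simpa using hv⟩⟩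
    have := mul_swap_pow_apply ρ hlt hm.1 le_rfl
    rw [hm.2] at this
    exact SameCycle.symm ⟨Nat.find hex, by simpa using this⟩

end Equiv.Perm

namespace BraidWord

open LinkDiagram

variable {p : ℕ} {w : BraidWord p}

/-! ### The edges of a braid closure -/

/-- The strand at the position `x` on the level `i` of the closure of `w`. -/
def edge (w : BraidWord p) (i : Fin (w.length + 1)) (x : Fin p) : w.closure.Edge := (i, x)

/-- The level of an edge of the closure. -/
def lev (e : w.closure.Edge) : ℕ := (show Fin (w.length + 1) × Fin p from e).1

/-- The position of an edge of the closure. -/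
def pos (e : w.closure.Edge) : ℕ := (show Fin (w.length + 1) × Fin p from e).2

/-- The number of the generator that stands at the letter `k`. -/
def col (w : BraidWord p) (k : Fin w.closure.n) : ℕ := (w.get k).1

@[simp] theorem lev_edge (i : Fin (w.length + 1)) (x : Fin p) : lev (edge w i x) = i := rfl

@[simp] theorem pos_edge (i : Fin (w.length + 1)) (x : Fin p) : pos (edge w i x) = x := rfl

theorem edge_ext {e f : w.closure.Edge} (h : lev e = lev f) (h' : pos e = pos f) : e = f :=
  Prod.ext (Fin.ext h) (Fin.ext h')

theorem lev_le (e : w.closure.Edge) : lev e ≤ w.length :=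
  Nat.lt_succ_iff.1 (show Fin (w.length + 1) × Fin p from e).1.2

theorem pos_lt (e : w.closure.Edge) : pos e < p := (show Fin (w.length + 1) × Fin p from e).2.2

theorem exists_edge {i x : ℕ} (hi : i ≤ w.length) (hx : x < p) :
    ∃ e : w.closure.Edge, lev e = i ∧ pos e = x :=
  ⟨edge w ⟨i, Nat.lt_succ_iff.2 hi⟩ ⟨x, hx⟩, rfl, rfl⟩

theorem col_lt (k : Fin w.closure.n) : col w k + 1 < p := by
  have := (w.get k).1.2
  unfold col
  omega

theorem lt_length (k : Fin w.closure.n) : (k : ℕ) < w.length := k.2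

/-- All letters of the braid word are generators, not inverses of generators. -/
def IsPositive (w : BraidWord p) : Prop := ∀ k, (w.get k).2 = true

section Positive

variable (hw : w.IsPositive) (k : Fin w.closure.n)

include hw

theorem crossing_eq : w.closure.crossing k =
    { a := edge w k.succ (right (w.get k).1)
      b := edge w k.castSucc (right (w.get k).1)
      c := edge w k.castSucc (left (w.get k).1)
      d := edge w k.succ (left (w.get k).1)
      positive := true } := if_pos (hw k)

theorem lev_a : lev (w.closure.crossing k).a = k + 1 := by rw [crossing_eq hw]; rfl
theorem lev_b : lev (w.closure.crossing k).b = k := by rw [crossing_eq hw]; rfl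
theorem lev_c : lev (w.closure.crossing k).c = k := by rw [crossing_eq hw]; rfl
theorem lev_d : lev (w.closure.crossing k).d = k + 1 := by rw [crossing_eq hw]; rfl
theorem pos_a : pos (w.closure.crossing k).a = col w k + 1 := by rw [crossing_eq hw]; rfl
theorem pos_b : pos (w.closure.crossing k).b = col w k + 1 := by rw [crossing_eq hw]; rfl
theorem pos_c : pos (w.closure.crossing k).c = col w k := by rw [crossing_eq hw]; rfl
theorem pos_d : pos (w.closure.crossing k).d = col w k := by rw [crossing_eq hw]; rfl

end Positive

theorem join_iff {e f : w.closure.Edge} : w.closure.join e f ↔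
    (lev e = w.length ∧ lev f = 0 ∧ pos e = pos f) ∨
      ∃ k : Fin w.closure.n, lev e = k ∧ lev f = k + 1 ∧ pos e = pos f ∧ pos e ≠ col w k ∧
        pos e ≠ col w k + 1 := by
  have h1 : ∀ e : w.closure.Edge, ∀ i, (show Fin (w.length + 1) × Fin p from e).1 = i ↔ lev e = i :=
    fun e i => Fin.ext_iff
  have h2 : ∀ e : w.closure.Edge, ∀ x, (show Fin (w.length + 1) × Fin p from e).2 = x ↔ pos e = x :=
    fun e i => Fin.ext_iff
  change (_ ∧ _ ∧ _) ∨ (∃ t : Fin w.length, _ ∧ _ ∧ _ ∧ _ ∧ _) ↔ _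
  refine or_congr (and_congr (h1 e _) (and_congr (h1 f _) (h2 e _))) (exists_congr fun k => ?_)
  exact and_congr (h1 e _) (and_congr (h1 f _) (and_congr (h2 e _)
    (and_congr (not_congr (h2 e _)) (not_congr (h2 e _)))))

section Conn

variable {ε : Fin w.closure.n → Bool}

theorem conn_close {e f : w.closure.Edge} (he : lev e = w.length) (hf : lev f = 0)
    (hp : pos e = pos f) : w.closure.Conn ε e f :=
  conn_of_join (join_iff.2 (Or.inl ⟨he, hf, hp⟩))

theorem conn_vertical (hw : w.IsPositive) {k : Fin w.closure.n} {e f : w.closure.Edge}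
    (he : lev e = k) (hf : lev f = k + 1) (hp : pos e = pos f)
    (h : ε k = true → pos e ≠ col w k ∧ pos e ≠ col w k + 1) : w.closure.Conn ε e f := by
  by_cases h1 : pos e = col w k
  · have hk : ε k = false := Bool.eq_false_iff.2 fun hk => (h hk).1 h1
    have := conn_cd (D := w.closure) hk
    rwa [edge_ext (e := (w.closure.crossing k).c) (f := e) (by rw [lev_c hw, he])
      (by rw [pos_c hw, h1]), edge_ext (e := (w.closure.crossing k).d) (f := f)
      (by rw [lev_d hw, hf]) (by rw [pos_d hw, ← hp, h1])] at this
  by_cases h2 : pos e = col w k + 1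
  · have hk : ε k = false := Bool.eq_false_iff.2 fun hk => (h hk).2 h2
    have := (conn_ab (D := w.closure) hk).symm
    rwa [edge_ext (e := (w.closure.crossing k).b) (f := e) (by rw [lev_b hw, he])
      (by rw [pos_b hw, h2]), edge_ext (e := (w.closure.crossing k).a) (f := f)
      (by rw [lev_a hw, hf]) (by rw [pos_a hw, ← hp, h2])] at this
  exact conn_of_join (join_iff.2 (Or.inr ⟨k, he, hf, hp, h1, h2⟩))

theorem conn_lower (hw : w.IsPositive) {k : Fin w.closure.n} {e f : w.closure.Edge}
    (hk : ε k = true) (he : lev e = k) (hf : lev f = k) (he' : pos e = col w k)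
    (hf' : pos f = col w k + 1) : w.closure.Conn ε e f := by
  have := (conn_bc (D := w.closure) hk).symm
  rwa [edge_ext (e := (w.closure.crossing k).b) (f := f) (by rw [lev_b hw, hf])
      (by rw [pos_b hw, hf']), edge_ext (e := (w.closure.crossing k).c) (f := e)
      (by rw [lev_c hw, he]) (by rw [pos_c hw, he'])] at this

theorem conn_upper (hw : w.IsPositive) {k : Fin w.closure.n} {e f : w.closure.Edge}
    (hk : ε k = true) (he : lev e = k + 1) (hf : lev f = k + 1) (he' : pos e = col w k)
    (hf' : pos f = col w k + 1) : w.closure.Conn ε e f := by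
  have := (conn_ad (D := w.closure) hk).symm
  rwa [edge_ext (e := (w.closure.crossing k).a) (f := f) (by rw [lev_a hw, hf])
      (by rw [pos_a hw, hf']), edge_ext (e := (w.closure.crossing k).d) (f := e)
      (by rw [lev_d hw, he]) (by rw [pos_d hw, he'])] at this

/-- An equivalence relation between edges that contains the closing strands, the vertical strands,
and the cups and caps, contains `Conn`. -/
theorem conn_induction (hw : w.IsPositive) {r : w.closure.Edge → w.closure.Edge → Prop}
    (hr : Equivalence r)
    (hclose : ∀ e f, lev e = w.length → lev f = 0 → pos e = pos f → r e f)
    (hvert : ∀ (k : Fin w.closure.n) (e f : w.closure.Edge), lev e = k → lev f = k + 1 →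
      pos e = pos f → (ε k = true → pos e ≠ col w k ∧ pos e ≠ col w k + 1) → r e f)
    (hlower : ∀ (k : Fin w.closure.n) (e f : w.closure.Edge), ε k = true → lev e = k → lev f = k →
      pos e = col w k → pos f = col w k + 1 → r e f)
    (hupper : ∀ (k : Fin w.closure.n) (e f : w.closure.Edge), ε k = true → lev e = k + 1 →
      lev f = k + 1 → pos e = col w k → pos f = col w k + 1 → r e f)
    {e f : w.closure.Edge} (h : w.closure.Conn ε e f) : r e f := by
  refine Conn.rec_equivalence hr (fun e f hj => ?_) (fun k e f hc => ?_) h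
  · rcases join_iff.1 hj with ⟨h1, h2, h3⟩ | ⟨k, h1, h2, h3, h4, h5⟩
    · exact hclose e f h1 h2 h3
    · exact hvert k e f h1 h2 h3 fun _ => ⟨h4, h5⟩
  · have ha := lev_a hw k
    have hb := lev_b hw k
    have hc' := lev_c hw k
    have hd := lev_d hw k
    have ha' := pos_a hw k
    have hb' := pos_b hw k
    have hc'' := pos_c hw k
    have hd' := pos_d hw k
    cases hk : ε k <;> rw [hk] at hc <;> rcases hc with ⟨rfl, rfl⟩ | ⟨rfl, rfl⟩
    · exact hr.symm (hvert k _ _ hb ha (hb'.trans ha'.symm) fun h => by rw [hk] at h; cases h)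
    · exact hvert k _ _ hc' hd (hc''.trans hd'.symm) fun h => by rw [hk] at h; cases h
    · exact hr.symm (hupper k _ _ hk hd ha hd' ha')
    · exact hr.symm (hlower k _ _ hk hc' hb hc'' hb')

end Conn

/-! ### Planarity -/

section Planar

/-- Strands at even positions are oriented upwards, strands at odd positions downwards. All
resolutions are compatible with this orientation. This is the translation along the strands. -/
def shift (w : BraidWord p) : Equiv.Perm w.closure.Edge where
  toFun e := if pos e % 2 = 0 then
      edge w ((show Fin (w.length + 1) × Fin p from e).1 + 1)
        (show Fin (w.length + 1) × Fin p from e).2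
    else edge w ((show Fin (w.length + 1) × Fin p from e).1 - 1)
      (show Fin (w.length + 1) × Fin p from e).2
  invFun e := if pos e % 2 = 0 then
      edge w ((show Fin (w.length + 1) × Fin p from e).1 - 1)
        (show Fin (w.length + 1) × Fin p from e).2
    else edge w ((show Fin (w.length + 1) × Fin p from e).1 + 1)
      (show Fin (w.length + 1) × Fin p from e).2
  left_inv := by
    rintro ⟨i, x⟩
    change Fin (w.length + 1) at i
    by_cases h : (x : ℕ) % 2 = 0 <;> simp [pos, edge, h] <;> rfl
  right_inv := by
    rintro ⟨i, x⟩
    change Fin (w.length + 1) at i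
    by_cases h : (x : ℕ) % 2 = 0 <;> simp [pos, edge, h] <;> rfl

theorem shift_of_even {e f : w.closure.Edge} (h : pos e % 2 = 0) (hp : pos e = pos f)
    (hl : lev f = lev e + 1 ∨ (lev e = w.length ∧ lev f = 0)) : shift w e = f := by
  have h1 : shift w e = edge w ((show Fin (w.length + 1) × Fin p from e).1 + 1)
    (show Fin (w.length + 1) × Fin p from e).2 := if_pos h
  rw [h1]
  refine edge_ext ?_ hp
  rw [lev_edge]
  rcases hl with hl | ⟨hl, hl'⟩
  · rw [hl, Fin.val_add_one_of_lt]
    · rfl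
    · rw [Fin.lt_def]
      have := lev_le f
      change lev e < w.length
      omega
  · have : (show Fin (w.length + 1) × Fin p from e).1 = Fin.last _ := Fin.ext hl
    rw [this, Fin.last_add_one, hl']; rfl

theorem shift_of_odd {e f : w.closure.Edge} (h : pos e % 2 = 1) (hp : pos e = pos f)
    (hl : lev f = lev e + 1 ∨ (lev e = w.length ∧ lev f = 0)) : shift w f = e := by
  rw [← Equiv.eq_symm_apply]
  have h1 : (shift w).symm e = edge w ((show Fin (w.length + 1) × Fin p from e).1 + 1)
    (show Fin (w.length + 1) × Fin p from e).2 := if_neg (by omega)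
  rw [h1]
  refine edge_ext ?_ hp.symm
  rw [lev_edge]
  rcases hl with hl | ⟨hl, hl'⟩
  · rw [hl, Fin.val_add_one_of_lt]
    · rfl
    · rw [Fin.lt_def]
      have := lev_le f
      change lev e < w.length
      omega
  · have : (show Fin (w.length + 1) × Fin p from e).1 = Fin.last _ := Fin.ext hl
    rw [this, Fin.last_add_one, hl']; rfl

/-- Following the orientation, the edge `e` runs into the crossing `k`. -/
def Enters (e : w.closure.Edge) (k : Fin w.closure.n) : Prop :=
  (pos e % 2 = 0 ∧ lev e = k) ∨ (pos e % 2 = 1 ∧ lev e = k + 1)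

theorem Enters.unique {e : w.closure.Edge} {k l : Fin w.closure.n} (h : Enters e k)
    (h' : Enters e l) : k = l := by
  refine Fin.ext ?_
  rcases h with h | h <;> rcases h' with h' | h' <;> omega

/-- The edge at an even position that runs into the crossing `k`. -/
def inEven (w : BraidWord p) (k : Fin w.closure.n) : w.closure.Edge :=
  edge w (Fin.castSucc (n := w.length) k)
    (if col w k % 2 = 0 then left (w.get k).1 else right (w.get k).1)

/-- The edge at an odd position that runs into the crossing `k`. -/
def inOdd (w : BraidWord p) (k : Fin w.closure.n) : w.closure.Edge :=
  edge w (Fin.succ (n := w.length) k)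
    (if col w k % 2 = 0 then right (w.get k).1 else left (w.get k).1)

theorem lev_inEven (k : Fin w.closure.n) : lev (inEven w k) = k := rfl

theorem lev_inOdd (k : Fin w.closure.n) : lev (inOdd w k) = k + 1 := rfl

theorem pos_in (k : Fin w.closure.n) :
    (col w k % 2 = 0 ∧ pos (inEven w k) = col w k ∧ pos (inOdd w k) = col w k + 1) ∨
    (col w k % 2 = 1 ∧ pos (inEven w k) = col w k + 1 ∧ pos (inOdd w k) = col w k) := by
  unfold inEven inOdd
  simp only [pos_edge]
  rcases Nat.mod_two_eq_zero_or_one (col w k) with h | h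
  · exact Or.inl ⟨h, by rw [if_pos h]; rfl, by rw [if_pos h]; rfl⟩
  · exact Or.inr ⟨h, by rw [if_neg (by omega)]; rfl, by rw [if_neg (by omega)]; rfl⟩

theorem enters_inEven (k : Fin w.closure.n) : Enters (inEven w k) k := by
  refine Or.inl ⟨?_, rfl⟩
  rcases pos_in k with h | h <;> omega

theorem enters_inOdd (k : Fin w.closure.n) : Enters (inOdd w k) k := by
  refine Or.inr ⟨?_, rfl⟩
  rcases pos_in k with h | h <;> omega

theorem inEven_ne_inOdd (k : Fin w.closure.n) : inEven w k ≠ inOdd w k := fun h => by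
  have := congrArg lev h
  rw [lev_inEven, lev_inOdd] at this
  omega

theorem Enters.eq_or_eq {e : w.closure.Edge} {k : Fin w.closure.n} (h : Enters e k)
    (hp : pos e = col w k ∨ pos e = col w k + 1) : e = inEven w k ∨ e = inOdd w k := by
  have h1 := lev_inEven k
  have h2 := lev_inOdd k
  rcases h with ⟨h3, h4⟩ | ⟨h3, h4⟩
  · exact Or.inl (edge_ext (by omega) (by rcases pos_in k with h | h <;> omega))
  · exact Or.inr (edge_ext (by omega) (by rcases pos_in k with h | h <;> omega))

open Classical in
/-- At every `1`-resolved crossing, exchange the two edges that run into it. -/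
noncomputable def smoothFun (ε : Fin w.closure.n → Bool) (e : w.closure.Edge) : w.closure.Edge :=
  if h : ∃ k, Enters e k ∧ ε k = true then Equiv.swap (inEven w h.choose) (inOdd w h.choose) e
  else e

section Smooth

variable {ε : Fin w.closure.n → Bool} {e f : w.closure.Edge} {k : Fin w.closure.n}

open Classical in
theorem smoothFun_of_true (h : Enters e k) (hk : ε k = true) :
    smoothFun ε e = Equiv.swap (inEven w k) (inOdd w k) e := by
  have hex : ∃ k, Enters e k ∧ ε k = true := ⟨k, h, hk⟩
  rw [smoothFun, dif_pos hex]
  rw [← h.unique hex.choose_spec.1]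

theorem smoothFun_of_forall (h : ∀ k, Enters e k → ε k = true → e ≠ inEven w k ∧ e ≠ inOdd w k) :
    smoothFun ε e = e := by
  classical
  by_cases hex : ∃ k, Enters e k ∧ ε k = true
  · obtain ⟨k, h1, h2⟩ := hex
    rw [smoothFun_of_true h1 h2]
    convert Equiv.swap_apply_of_ne_of_ne (h k h1 h2).1 (h k h1 h2).2
  · rw [smoothFun, dif_neg hex]

theorem smoothFun_inEven (hk : ε k = true) : smoothFun ε (inEven w k) = inOdd w k := by
  classical
  rw [smoothFun_of_true (enters_inEven k) hk]
  convert Equiv.swap_apply_left _ _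

theorem smoothFun_inOdd (hk : ε k = true) : smoothFun ε (inOdd w k) = inEven w k := by
  classical
  rw [smoothFun_of_true (enters_inOdd k) hk]
  convert Equiv.swap_apply_right _ _

theorem smoothFun_cases (ε : Fin w.closure.n → Bool) (e : w.closure.Edge) :
    (∃ k, ε k = true ∧ e = inEven w k) ∨ (∃ k, ε k = true ∧ e = inOdd w k) ∨
      (smoothFun ε e = e ∧ ∀ k, Enters e k → ε k = true →
        pos e ≠ col w k ∧ pos e ≠ col w k + 1) := by
  by_cases h : ∀ k, Enters e k → ε k = true → e ≠ inEven w k ∧ e ≠ inOdd w k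
  · refine Or.inr (Or.inr ⟨smoothFun_of_forall h, fun k hk hε => ?_⟩)
    have h1 := h k hk hε
    constructor <;> intro hp
    · rcases hk.eq_or_eq (Or.inl hp) with h2 | h2
      exacts [h1.1 h2, h1.2 h2]
    · rcases hk.eq_or_eq (Or.inr hp) with h2 | h2
      exacts [h1.1 h2, h1.2 h2]
  · push Not at h
    obtain ⟨k, -, hε, h2⟩ := h
    by_cases he : e = inEven w k
    · exact Or.inl ⟨k, hε, he⟩
    · exact Or.inr (Or.inl ⟨k, hε, h2 he⟩)

theorem smoothFun_involutive (ε : Fin w.closure.n → Bool) :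
    Function.Involutive (smoothFun ε) := by
  intro e
  rcases smoothFun_cases ε e with ⟨k, hk, rfl⟩ | ⟨k, hk, rfl⟩ | ⟨h, -⟩
  · rw [smoothFun_inEven hk, smoothFun_inOdd hk]
  · rw [smoothFun_inOdd hk, smoothFun_inEven hk]
  · rw [h, h]

/-- The permutation of the edges whose cycles are the circles of the resolution `ε`. -/
noncomputable def circlePerm (ε : Fin w.closure.n → Bool) : Equiv.Perm w.closure.Edge :=
  shift w * (smoothFun_involutive ε).toPerm

theorem circlePerm_apply : circlePerm ε e = shift w (smoothFun ε e) := rfl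

open Classical in
theorem circlePerm_update (hk : ε k = false) : circlePerm (Function.update ε k true) =
    circlePerm ε * Equiv.swap (inEven w k) (inOdd w k) := by
  ext e
  rw [Equiv.Perm.mul_apply, circlePerm_apply, circlePerm_apply]
  congr 1
  have hk' : Function.update ε k true k = true := Function.update_self _ _ _
  have hfix : ∀ e, Enters e k → smoothFun ε e = e := fun e he =>
    smoothFun_of_forall fun l hl hε => by
      rw [← he.unique hl, hk] at hε; cases hε
  by_cases h1 : e = inEven w k
  · rw [h1, smoothFun_inEven hk', Equiv.swap_apply_left, hfix _ (enters_inOdd k)]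
  by_cases h2 : e = inOdd w k
  · rw [h2, smoothFun_inOdd hk', Equiv.swap_apply_right, hfix _ (enters_inEven k)]
  rw [Equiv.swap_apply_of_ne_of_ne h1 h2]
  rcases smoothFun_cases ε e with ⟨l, hl, rfl⟩ | ⟨l, hl, rfl⟩ | ⟨h, h'⟩
  · have hlk : l ≠ k := by rintro rfl; exact h1 rfl
    rw [smoothFun_inEven hl, smoothFun_inEven (by rwa [Function.update_of_ne hlk])]
  · have hlk : l ≠ k := by rintro rfl; exact h2 rfl
    rw [smoothFun_inOdd hl, smoothFun_inOdd (by rwa [Function.update_of_ne hlk])]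
  · rw [h]
    refine smoothFun_of_forall fun l hl hε => ?_
    by_cases hlk : l = k
    · rw [hlk]; exact ⟨h1, h2⟩
    · rw [Function.update_of_ne hlk] at hε
      have h3 := h' l hl hε
      have h4 := pos_in l
      constructor <;> rintro rfl <;> omega

theorem circlePerm_inEven (hk : ε k = true) (hl : lev e = k)
    (hp : pos e = pos (inOdd w k)) : circlePerm ε (inEven w k) = e := by
  rw [circlePerm_apply, smoothFun_inEven hk]
  refine shift_of_odd ?_ hp (Or.inl (by rw [hl, lev_inOdd]))
  rcases pos_in k with h | h <;> omega

theorem circlePerm_inOdd (hk : ε k = true) (hl : lev e = k + 1)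
    (hp : pos e = pos (inEven w k)) : circlePerm ε (inOdd w k) = e := by
  rw [circlePerm_apply, smoothFun_inOdd hk]
  refine shift_of_even ?_ hp.symm (Or.inl (by rw [hl, lev_inEven]))
  rcases pos_in k with h | h <;> omega

theorem conn_circlePerm (hw : w.IsPositive) (ε : Fin w.closure.n → Bool) (e : w.closure.Edge) :
    w.closure.Conn ε e (circlePerm ε e) := by
  rcases smoothFun_cases ε e with ⟨k, hk, rfl⟩ | ⟨k, hk, rfl⟩ | ⟨h, h'⟩
  · obtain ⟨f, hf, hf'⟩ := exists_edge (w := w) (lt_length k).le (pos_lt (inOdd w k))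
    rw [circlePerm_inEven hk hf hf']
    rcases pos_in k with h | h
    · exact conn_lower hw hk (lev_inEven k) hf h.2.1 (by omega)
    · exact (conn_lower hw hk hf (lev_inEven k) (by omega) h.2.1).symm
  · obtain ⟨f, hf, hf'⟩ := exists_edge (w := w) (lt_length k) (pos_lt (inEven w k))
    rw [circlePerm_inOdd hk hf hf']
    rcases pos_in k with h | h
    · exact (conn_upper hw hk hf (lev_inOdd k) (by omega) h.2.2).symm
    · exact conn_upper hw hk (lev_inOdd k) hf h.2.2 (by omega)
  · rw [circlePerm_apply, h]
    rcases Nat.mod_two_eq_zero_or_one (pos e) with hp | hp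
    · rcases (lev_le e).lt_or_eq with hl | hl
      · obtain ⟨f, hf, hf'⟩ := exists_edge (w := w) (Nat.succ_le_of_lt hl) (pos_lt e)
        rw [shift_of_even hp hf'.symm (Or.inl hf)]
        exact conn_vertical hw (k := ⟨lev e, hl⟩) rfl hf hf'.symm fun hk =>
          h' _ (Or.inl ⟨hp, rfl⟩) hk
      · obtain ⟨f, hf, hf'⟩ := exists_edge (w := w) (Nat.zero_le _) (pos_lt e)
        rw [shift_of_even hp hf'.symm (Or.inr ⟨hl, hf⟩)]
        exact conn_close hl hf hf'.symm
    · rcases Nat.eq_zero_or_pos (lev e) with hl | hl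
      · obtain ⟨f, hf, hf'⟩ := exists_edge (w := w) le_rfl (pos_lt e)
        rw [shift_of_odd (by omega) hf' (Or.inr ⟨hf, hl⟩)]
        exact (conn_close hf hl hf').symm
      · have hl' := lev_le e
        obtain ⟨f, hf, hf'⟩ := exists_edge (w := w) (i := lev e - 1) (by omega) (pos_lt e)
        rw [shift_of_odd (by omega) hf' (Or.inl (by omega))]
        refine (conn_vertical hw (k := ⟨lev e - 1, by change _ < w.length; omega⟩) hf
          (by simp only; omega) hf' fun hk => ?_).symm
        rw [hf']
        exact h' _ (Or.inr ⟨hp, by simp only; omega⟩) hk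

/-- The circles of a resolution are the cycles of `circlePerm`. -/
theorem conn_iff_sameCycle (hw : w.IsPositive) :
    w.closure.Conn ε e f ↔ (circlePerm ε).SameCycle e f := by
  constructor
  · have hone : ∀ {e f}, circlePerm ε e = f → (circlePerm ε).SameCycle e f := fun h =>
      ⟨1, by simpa using h⟩
    refine conn_induction hw (Equiv.Perm.SameCycle.equivalence _) ?_ ?_ ?_ ?_
    · intro e f he hf hp
      rcases Nat.mod_two_eq_zero_or_one (pos e) with h | h
      · refine hone ?_
        rw [circlePerm_apply, smoothFun_of_forall, shift_of_even h hp (Or.inr ⟨he, hf⟩)]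
        intro k hk
        have := lt_length k
        rcases hk with hk | hk <;> omega
      · refine (hone ?_).symm
        rw [circlePerm_apply, smoothFun_of_forall, shift_of_odd h hp (Or.inr ⟨he, hf⟩)]
        intro k hk
        rcases hk with hk | hk <;> omega
    · intro k e f he hf hp hε
      have hin := pos_in k
      rcases Nat.mod_two_eq_zero_or_one (pos e) with h | h
      · refine hone ?_
        rw [circlePerm_apply, smoothFun_of_forall, shift_of_even h hp (Or.inl (by omega))]
        intro l hl hlε
        obtain rfl : l = k := hl.unique (Or.inl ⟨h, he⟩)
        have := hε hlε
        constructor <;> rintro rfl <;> omega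
      · refine (hone ?_).symm
        rw [circlePerm_apply, smoothFun_of_forall, shift_of_odd h hp (Or.inl (by omega))]
        intro l hl hlε
        obtain rfl : l = k := hl.unique (Or.inr ⟨hp ▸ h, hf⟩)
        have := hε hlε
        constructor <;> rintro rfl <;> omega
    · intro k e f hk he hf hpe hpf
      rcases pos_in k with ⟨-, h1, h2⟩ | ⟨-, h1, h2⟩
      · rw [← edge_ext (e := inEven w k) (f := e) (by rw [lev_inEven, he]) (by omega)]
        exact hone (circlePerm_inEven hk hf (by omega))
      · rw [← edge_ext (e := inEven w k) (f := f) (by rw [lev_inEven, hf]) (by omega)]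
        exact (hone (circlePerm_inEven hk he (by omega))).symm
    · intro k e f hk he hf hpe hpf
      rcases pos_in k with ⟨-, h1, h2⟩ | ⟨-, h1, h2⟩
      · rw [← edge_ext (e := inOdd w k) (f := f) (by rw [lev_inOdd, hf]) (by omega)]
        exact (hone (circlePerm_inOdd hk he (by omega))).symm
      · rw [← edge_ext (e := inOdd w k) (f := e) (by rw [lev_inOdd, he]) (by omega)]
        exact hone (circlePerm_inOdd hk hf (by omega))
  · intro h
    obtain ⟨i, -, rfl⟩ := h.exists_pow_eq'
    induction i with
    | zero => exact Conn.refl _ _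
    | succ i ih =>
      rw [pow_succ', Equiv.Perm.mul_apply]
      exact (ih ⟨i, by simp⟩).trans (conn_circlePerm hw ε _)

end Smooth

/-- Changing one resolution multiplies `circlePerm` by a transposition, which merges two cycles or
splits one. -/
theorem isPlanar_closure (hw : w.IsPositive) : w.closure.IsPlanar := by
  classical
  intro ε k hk
  have key : ∀ ε : Fin w.closure.n → Bool,
      w.closure.Conn ε (w.closure.crossing k).a (w.closure.crossing k).c ↔
        w.closure.Conn ε (inEven w k) (inOdd w k) := by
    intro ε
    rcases pos_in k with ⟨-, h1, h2⟩ | ⟨-, h1, h2⟩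
    · rw [edge_ext (e := inEven w k) (f := (w.closure.crossing k).c)
        (by rw [lev_inEven, lev_c hw]) (by rw [h1, pos_c hw]),
        edge_ext (e := inOdd w k) (f := (w.closure.crossing k).a)
        (by rw [lev_inOdd, lev_a hw]) (by rw [h2, pos_a hw]), conn_comm]
    · rw [edge_ext (e := inEven w k) (f := (w.closure.crossing k).b)
        (by rw [lev_inEven, lev_b hw]) (by rw [h1, pos_b hw]),
        edge_ext (e := inOdd w k) (f := (w.closure.crossing k).d)
        (by rw [lev_inOdd, lev_d hw]) (by rw [h2, pos_d hw])]
      cases h : ε k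
      · exact ⟨fun h' => (conn_ab h).symm.trans (h'.trans (conn_cd h)),
          fun h' => (conn_ab h).trans (h'.trans (conn_cd h).symm)⟩
      · exact ⟨fun h' => (conn_bc h).trans (h'.symm.trans (conn_ad h)),
          fun h' => (conn_ad h).trans (h'.symm.trans (conn_bc h))⟩
  rw [key, key, conn_iff_sameCycle hw, conn_iff_sameCycle hw, circlePerm_update hk]
  have : Finite w.closure.Edge := w.closure.finite_edge
  exact Equiv.Perm.sameCycle_mul_swap_iff _ (inEven_ne_inOdd k)

end Planar

/-! ### The number of circles and the quantum degree -/

/-- The columns of the braid in which the resolution `ε` has a `1`-resolved crossing. -/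
def cols (ε : Fin w.closure.n → Bool) : Finset ℕ :=
  (Finset.univ.filter fun k => ε k = true).image (col w)

theorem mem_cols {ε : Fin w.closure.n → Bool} {c : ℕ} :
    c ∈ cols ε ↔ ∃ k, ε k = true ∧ col w k = c := by
  simp [cols]

/-- Two edges on the same strand are connected if no `1`-resolved crossing between them meets the
strand. -/
theorem conn_of_pos_eq (hw : w.IsPositive) {ε : Fin w.closure.n → Bool} {e f : w.closure.Edge}
    (hp : pos e = pos f)
    (h : ∀ k : Fin w.closure.n, lev e ≤ (k : ℕ) → (k : ℕ) < lev f → ε k = true →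
      pos e ≠ col w k ∧ pos e ≠ col w k + 1)
    (hl : lev e ≤ lev f) : w.closure.Conn ε e f := by
  obtain ⟨d, hd⟩ := Nat.exists_eq_add_of_le hl
  induction d generalizing f with
  | zero => rw [edge_ext (e := e) (f := f) (by omega) hp]
  | succ d ih =>
    have hlf := lev_le f
    obtain ⟨g, hg, hg'⟩ := exists_edge (w := w) (i := lev e + d) (by omega) (pos_lt e)
    refine (ih (f := g) hg'.symm (fun k h1 h2 => h k h1 (by omega)) (by omega) hg).trans
      (conn_vertical hw (k := ⟨lev e + d, show _ < w.length by omega⟩) hg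
        (by show _ = lev e + d + 1; omega) (by omega) fun hk => ?_)
    rw [hg']
    exact h _ (Nat.le_add_right _ _) (show lev e + d < lev f by omega) hk

/-- No circle passes through an unused column. -/
theorem pos_le_iff_of_conn (hw : w.IsPositive) {ε : Fin w.closure.n → Bool} {i : ℕ}
    (hi : i ∉ cols ε) {e f : w.closure.Edge} (h : w.closure.Conn ε e f) :
    pos e ≤ i ↔ pos f ≤ i := by
  have hcol : ∀ k, ε k = true → col w k ≠ i := fun k hk h => hi (mem_cols.2 ⟨k, hk, h⟩)
  refine conn_induction hw (r := fun e f => pos e ≤ i ↔ pos f ≤ i)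
    ⟨fun _ => Iff.rfl, fun h => h.symm, fun h h' => h.trans h'⟩ ?_ ?_ ?_ ?_ h
  · intro e f _ _ hp; rw [hp]
  · intro k e f _ _ hp _; rw [hp]
  · intro k e f hk _ _ h1 h2
    have := hcol k hk
    omega
  · intro k e f hk _ _ h1 h2
    have := hcol k hk
    omega

theorem not_conn_of_notMem_cols (hw : w.IsPositive) {ε : Fin w.closure.n → Bool}
    {k : Fin w.closure.n} (hk : col w k ∉ cols ε) :
    ¬ w.closure.Conn ε (w.closure.crossing k).a (w.closure.crossing k).c := fun h => by
  have := pos_le_iff_of_conn hw hk h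
  rw [pos_a hw, pos_c hw] at this
  omega

theorem card_circle_zero (hw : w.IsPositive) :
    Fintype.card (w.closure.Circle fun _ => false) = p := by
  have hconn : ∀ x y : Fin p,
      w.closure.Conn (fun _ => false) (edge w 0 x) (edge w 0 y) → x = y := fun x y h => by
    have h1 := fun i => pos_le_iff_of_conn hw (i := i) (by simp [cols]) h
    have h2 := (h1 x).1 le_rfl
    have h3 := (h1 y).2 le_rfl
    exact Fin.ext (le_antisymm h3 h2)
  refine (Fintype.card_of_bijective (f := fun x : Fin p => w.closure.circ _ (edge w 0 x))
    ⟨fun x y h => hconn x y h, fun z => ?_⟩).symm.trans (Fintype.card_fin p)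
  obtain ⟨e, rfl⟩ := exists_circ _ z
  exact ⟨⟨pos e, pos_lt e⟩, conn_of_pos_eq hw rfl (fun _ _ _ h => by cases h) (Nat.zero_le _)⟩

/-- The first `1`-resolution in a column merges two circles, every further one adds at most one
circle. -/
theorem card_circle_add_le (hw : w.IsPositive) (ε : Fin w.closure.n → Bool) :
    Fintype.card (w.closure.Circle ε) + 2 * (cols ε).card ≤
      p + (Finset.univ.filter fun k => ε k = true).card := by
  classical
  obtain ⟨m, hm⟩ : ∃ m, (Finset.univ.filter fun k => ε k = true).card = m := ⟨_, rfl⟩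
  induction m generalizing ε with
  | zero =>
    have : ε = fun _ => false := by
      ext k
      rw [Finset.card_eq_zero, Finset.filter_eq_empty_iff] at hm
      exact Bool.eq_false_iff.2 (hm (Finset.mem_univ k))
    subst this
    rw [card_circle_zero hw]
    simp [cols]
  | succ m ih =>
    obtain ⟨k, hk⟩ : ∃ k, ε k = true := by
      by_contra h
      push Not at h
      rw [Finset.filter_false_of_mem (fun k _ => h k)] at hm
      simp at hm
    set ε₀ := Function.update ε k false with hε₀
    have hε₀k : ε₀ k = false := Function.update_self _ _ _
    have hε : ε = Function.update ε₀ k true := update_update_false hk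
    have hfil : (Finset.univ.filter fun l => ε l = true) =
        insert k (Finset.univ.filter fun l => ε₀ l = true) := by
      ext l
      by_cases hl : l = k
      · simp [hl, hk]
      · simp [hl, hε₀]
    have hcard := congrArg Finset.card hfil
    rw [Finset.card_insert_of_notMem (by simp [hε₀k]), hm] at hcard
    have ih' := ih ε₀ (by omega)
    have hN := card_circle_update (isPlanar_closure hw) hε₀k
    rw [← hε] at hN
    have hcols : cols ε = insert (col w k) (cols ε₀) := by
      unfold cols
      rw [hfil, Finset.image_insert]
    by_cases hc : col w k ∈ cols ε₀
    · rw [hcols, Finset.insert_eq_of_mem hc]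
      split_ifs at hN <;> omega
    · rw [hcols, Finset.card_insert_of_notMem hc]
      rw [if_neg (not_conn_of_notMem_cols hw hc)] at hN
      omega

/-- A lower bound for the quantum degree: every column that is used and every circle labelled `1`
contributes `2`. -/
theorem le_qdeg_add (hw : w.IsPositive) (s : w.closure.State) {C : Finset ℕ} (hC : C ⊆ cols s.res)
    {F : Finset w.closure.Edge} (hF : ∀ x ∈ F, s.labelAt x = .one)
    (hF' : ∀ x ∈ F, ∀ y ∈ F, x ≠ y → ¬ w.closure.Conn s.res x y) :
    (2 * C.card + 2 * F.card : ℤ) ≤ s.qdeg + p := by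
  classical
  have h1 : ∑ z, (s.label z).deg =
      2 * ((Finset.univ.filter fun z => s.label z = .one).card : ℤ) -
        Fintype.card (w.closure.Circle s.res) := by
    rw [Finset.card_filter]
    push_cast
    rw [Finset.mul_sum, ← Finset.card_univ, Finset.card_eq_sum_ones]
    push_cast
    rw [← Finset.sum_sub_distrib]
    refine Finset.sum_congr rfl fun z _ => ?_
    rcases label_eq_one_or (s.label z) with h | h <;> rw [h] <;> simp [Label.deg]
  have h2 : F.card ≤ (Finset.univ.filter fun z => s.label z = .one).card :=
    Finset.card_le_card_of_injOn (fun x => w.closure.circ s.res x)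
      (fun x hx => Finset.mem_coe.2 (Finset.mem_filter.2 ⟨Finset.mem_univ _, hF x hx⟩))
      fun x hx y hy hxy => by_contra fun hne => hF' x hx y hy hne hxy
  have h3 := card_circle_add_le hw s.res
  have h4 := Finset.card_le_card hC
  unfold State.qdeg State.height
  rw [h1]
  omega

/-! ### Small circles -/

/-- No crossing in the column `c` is adjacent to a crossing in the column `i`. -/
def Far (i c : ℕ) : Prop := c + 1 < i ∨ i + 1 < c

section Small

variable {ε : Fin w.closure.n → Bool} {k k' : Fin w.closure.n}

/-- Two consecutive `1`-resolved crossings in the same column bound a small circle. -/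
theorem conn_a_iff (hw : w.IsPositive) (hkk' : k < k') (hcol : col w k = col w k')
    (hk : ε k = true) (hk' : ε k' = true)
    (hbt : ∀ r, k < r → r < k' → ε r = true → Far (col w k) (col w r)) {e : w.closure.Edge} :
    w.closure.Conn ε (w.closure.crossing k).a e ↔
      (k : ℕ) < lev e ∧ lev e ≤ k' ∧ (pos e = col w k ∨ pos e = col w k + 1) := by
  have hbt' : ∀ r : Fin w.closure.n, (k : ℕ) < r → (r : ℕ) < k' → ε r = true →
      Far (col w k) (col w r) := hbt
  have hkk'' : (k : ℕ) < k' := hkk'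
  have hlt := lt_length k'
  constructor
  · intro h
    have key := conn_induction hw (r := fun e f =>
      ((k : ℕ) < lev e ∧ lev e ≤ k' ∧ (pos e = col w k ∨ pos e = col w k + 1)) ↔
      ((k : ℕ) < lev f ∧ lev f ≤ k' ∧ (pos f = col w k ∨ pos f = col w k + 1)))
      ⟨fun _ => Iff.rfl, fun h => h.symm, fun h h' => h.trans h'⟩ ?_ ?_ ?_ ?_ h
    · refine key.1 ?_
      rw [lev_a hw, pos_a hw]
      omega
    · intro e f he hf hp
      omega
    · intro r e f he hf hp hr
      rcases lt_trichotomy (r : ℕ) k with h1 | h1 | h1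
      · omega
      · have : r = k := Fin.ext h1
        subst this
        have := hr hk
        omega
      · rcases lt_trichotomy (r : ℕ) k' with h2 | h2 | h2
        · omega
        · have : r = k' := Fin.ext h2
          subst this
          have := hr hk'
          omega
        · omega
    · intro r e f hr he hf hp hp'
      by_cases h1 : (k : ℕ) < r ∧ (r : ℕ) < k'
      · have := hbt' r h1.1 h1.2 hr
        unfold Far at this
        omega
      · by_cases h2 : (r : ℕ) = k'
        · have : r = k' := Fin.ext h2
          subst this
          omega
        · omega
    · intro r e f hr he hf hp hp'
      by_cases h1 : (k : ℕ) < r ∧ (r : ℕ) < k'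
      · have := hbt' r h1.1 h1.2 hr
        unfold Far at this
        omega
      · by_cases h2 : (r : ℕ) = k
        · have : r = k := Fin.ext h2
          subst this
          omega
        · omega
  · rintro ⟨h1, h2, h3 | h3⟩
    · obtain ⟨f, hf, hf'⟩ := exists_edge (w := w) (i := k + 1) (by omega)
        (show col w k < p by have := col_lt k; omega)
      refine (conn_upper hw hk hf (lev_a hw k) hf' (pos_a hw k)).symm.trans
        (conn_of_pos_eq hw (by omega) (fun r hr hr' hε => ?_) (by omega))
      have := hbt' r (by omega) (by omega) hε
      unfold Far at this
      omega
    · have ha := lev_a hw k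
      have ha' := pos_a hw k
      refine conn_of_pos_eq hw (by omega) (fun r hr hr' hε => ?_) (by omega)
      have := hbt' r (by omega) (by omega) hε
      unfold Far at this
      omega

end Small

/-! ### The two moves for braid closures -/

/-- The edges of `F` lie on different circles, which are not affected by a change of the resolution
between `lo` and `hi`. -/
def Separated (lo hi : Set (Fin w.closure.n)) (F : Finset w.closure.Edge) : Prop :=
  (∀ x ∈ F, w.closure.Protected lo hi x) ∧
    ∀ ε, w.closure.InBox lo hi ε → ∀ x ∈ F, ∀ y ∈ F, x ≠ y → ¬ w.closure.Conn ε x y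

section Moves

variable {lo hi lo' hi' : Set (Fin w.closure.n)} {F : Finset w.closure.Edge} {j : ℤ}
  {k k' l : Fin w.closure.n}

theorem Separated.mono (h : Separated lo hi F) (hlo : lo ⊆ lo') (hhi : hi' ⊆ hi) :
    Separated lo' hi' F :=
  ⟨fun x hx => (h.1 x hx).mono hlo hhi, fun ε hε => h.2 ε (hε.mono hlo hhi)⟩

/-- In quantum degrees below the lower bound of `le_qdeg_add` there are no states. -/
theorem isAcyclic_box_of_lt (hw : w.IsPositive) (hF : Separated lo hi F) {C : Finset ℕ}
    (hC : ∀ c ∈ C, ∃ r ∈ lo, col w r = c) (hj : j + p < 2 * C.card + 2 * F.card) :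
    IsAcyclic (w.closure.box lo hi F j) :=
  isAcyclic_of_forall_notMem fun s hs => by
    have := le_qdeg_add hw s (C := C) (F := F) (fun c hc => by
      obtain ⟨r, hr, hrc⟩ := hC c hc
      exact mem_cols.2 ⟨r, hs.1.1 r hr, hrc⟩) hs.2.1 (hF.2 _ hs.1)
    rw [hs.2.2] at this
    omega

/-- Two crossings `k < k'` in the same column with nothing adjacent in between: the `1`-resolution
of both gives a small circle between them, which may be assumed to have the label `1`. -/
theorem isAcyclic_box_of_curl (hw : w.IsPositive) (hF : Separated lo hi F) (hkk' : k < k')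
    (hcol : col w k = col w k') (hk' : k' ∈ lo) (hkhi : k ∈ hi) (hklo : k ∉ lo)
    (hbt : ∀ r ∈ hi, k < r → r < k' → Far (col w k) (col w r))
    (h : ∀ F' : Finset w.closure.Edge, F'.card = F.card + 1 → Separated (insert k lo) hi F' →
      IsAcyclic (w.closure.box (insert k lo) hi F' j)) :
    IsAcyclic (w.closure.box lo hi F j) := by
  classical
  have hsplit : ∀ ε, w.closure.InBox lo hi ε → ε k = true →
      ¬ w.closure.Conn ε (w.closure.crossing k).a (w.closure.crossing k).c ∧
      ∀ r ∈ hi, r ∉ lo → r ≠ k → ¬ w.closure.Touch ε r (w.closure.crossing k).a := by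
    intro ε hε hk
    have hiff : ∀ e, _ ↔ _ := fun e => conn_a_iff hw hkk' hcol hk (hε.1 _ hk')
      (fun r h1 h2 hr => hbt r (hε.2 r hr) h1 h2) (e := e)
    refine ⟨?_, fun r hr hr' hrk => ?_⟩
    · rw [hiff, lev_c hw]; omega
    · have hrk' : r ≠ k' := fun h => hr' (h ▸ hk')
      have h1 : (r : ℕ) ≠ k := fun h => hrk (Fin.ext h)
      have h2 : (r : ℕ) ≠ k' := fun h => hrk' (Fin.ext h)
      have h3 := hbt r hr
      rw [Fin.lt_def, Fin.lt_def] at h3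
      unfold Far at h3
      rintro (h | h) <;> rw [hiff] at h
      · rw [lev_a hw, pos_a hw] at h
        have := h3 (by omega) (by omega)
        omega
      · rw [lev_c hw, pos_c hw] at h
        have := h3 (by omega) (by omega)
        omega
  by_cases hex : ∃ ε, w.closure.InBox lo hi ε
  swap
  · exact isAcyclic_of_forall_notMem fun s hs => hex ⟨_, hs.1⟩
  have hnotMem : (w.closure.crossing k).a ∉ F := fun hmem =>
    have ⟨ε, hε⟩ := hex
    hF.1 _ hmem ε hε k hkhi hklo (touch_a _ _)
  refine IsAcyclic.of_curl (isPlanar_closure hw) hF.1 hkhi hklo hsplit ?_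
  rw [← Finset.coe_insert]
  refine h _ (Finset.card_insert_of_notMem hnotMem) ?_
  have hmono := hF.mono (Set.subset_insert k lo) (subset_refl hi)
  have hnew : ∀ ε, w.closure.InBox (insert k lo) hi ε → ∀ x ∈ F,
      ¬ w.closure.Conn ε x (w.closure.crossing k).a := fun ε hε x hx hc =>
    hF.1 x hx ε (hε.mono (Set.subset_insert _ _) subset_rfl) k hkhi hklo (Or.inl hc)
  refine ⟨fun x hx => ?_, fun ε hε x hx y hy hxy => ?_⟩
  · rcases Finset.mem_insert.1 hx with rfl | hx
    · intro ε hε r hr hr'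
      rw [Set.mem_insert_iff, not_or] at hr'
      exact (hsplit ε (hε.mono (Set.subset_insert _ _) subset_rfl)
        (hε.1 k (Set.mem_insert _ _))).2 r hr hr'.2 hr'.1
    · exact hmono.1 x hx
  · rcases Finset.mem_insert.1 hx with rfl | hx <;> rcases Finset.mem_insert.1 hy with rfl | hy
    · exact absurd rfl hxy
    · exact fun hc => hnew ε hε y hy hc.symm
    · exact hnew ε hε x hx
    · exact hmono.2 ε hε x hx y hy hxy

/-- Two crossings `k < k'` in the same column with one crossing `l` in an adjacent column between
them: the small circle between `k` and `k'` meets `l` only, and `k` may be replaced by `l`. -/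
theorem isAcyclic_box_of_slide (hw : w.IsPositive) (hF : Separated lo hi F) (hkl : k < l)
    (hlk' : l < k') (hcol : col w k = col w k')
    (hcoll : col w l = col w k + 1 ∨ col w l + 1 = col w k) (hk' : k' ∈ lo)
    (hkhi : k ∈ hi) (hklo : k ∉ lo) (hlhi : l ∈ hi) (hllo : l ∉ lo)
    (hbt : ∀ r ∈ hi, k < r → r < k' → r ≠ l → Far (col w k) (col w r))
    (h : Separated (insert l lo) (hi \ {k}) F →
      IsAcyclic (w.closure.box (insert l lo) (hi \ {k}) F j)) :
    IsAcyclic (w.closure.box lo hi F j) := by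
  refine IsAcyclic.of_slide (isPlanar_closure hw) hF.1 hkl.ne hkhi hklo hlhi hllo
    (fun ε hε hk hl => ?_) (h (hF.mono (Set.subset_insert _ _) Set.sdiff_subset))
  have hiff : ∀ e, _ ↔ _ := fun e => conn_a_iff hw (hkl.trans hlk') hcol hk (hε.1 _ hk')
    (fun r h1 h2 hr => hbt r (hε.2 r hr) h1 h2 (by rintro rfl; rw [hl] at hr; cases hr)) (e := e)
  rw [Fin.lt_def] at hkl hlk'
  refine ⟨?_, fun r hr hr' hrk hrl => ?_, ?_, fun hc => ?_⟩
  · rw [hiff, lev_c hw]; omega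
  · have hrk' : r ≠ k' := fun h => hr' (h ▸ hk')
    have h1 : (r : ℕ) ≠ k := fun h => hrk (Fin.ext h)
    have h2 : (r : ℕ) ≠ k' := fun h => hrk' (Fin.ext h)
    have h3 := hbt r hr
    rw [Fin.lt_def, Fin.lt_def] at h3
    unfold Far at h3
    rintro (h | h) <;> rw [hiff] at h
    · rw [lev_a hw, pos_a hw] at h
      have := h3 (by omega) (by omega) hrl
      omega
    · rw [lev_c hw, pos_c hw] at h
      have := h3 (by omega) (by omega) hrl
      omega
  · unfold Touch
    rw [hiff, hiff, lev_a hw, lev_c hw, pos_a hw, pos_c hw]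
    omega
  · have h1 : w.closure.Conn ε (w.closure.crossing k).a (w.closure.crossing l).a ↔
        w.closure.Conn ε (w.closure.crossing k).a (w.closure.crossing l).c :=
      ⟨fun h => h.trans hc, fun h => h.trans hc.symm⟩
    rw [hiff, hiff, lev_a hw, lev_c hw, pos_a hw, pos_c hw] at h1
    omega

end Moves

/-! ### Isolated strands -/

theorem pos_eq_iff_of_conn (hw : w.IsPositive) {ε : Fin w.closure.n → Bool} {m : ℕ}
    (hm : ∀ k, ε k = true → col w k ≠ m ∧ col w k + 1 ≠ m) {e f : w.closure.Edge}
    (h : w.closure.Conn ε e f) : pos e = m ↔ pos f = m := by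
  refine conn_induction hw (r := fun e f => pos e = m ↔ pos f = m)
    ⟨fun _ => Iff.rfl, fun h => h.symm, fun h h' => h.trans h'⟩ ?_ ?_ ?_ ?_ h
  · intro e f _ _ hp; rw [hp]
  · intro k e f _ _ hp _; rw [hp]
  · intro k e f hk _ _ h1 h2
    have := hm k hk
    omega
  · intro k e f hk _ _ h1 h2
    have := hm k hk
    omega

open Classical in
/-- The strands at the positions from `m` on, on the level `0`. -/
noncomputable def strandsFrom (w : BraidWord p) (m : ℕ) : Finset w.closure.Edge :=
  (Finset.univ.filter fun x : Fin p => m ≤ x).image (edge w 0)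

theorem mem_strandsFrom {m : ℕ} {e : w.closure.Edge} :
    e ∈ strandsFrom w m ↔ lev e = 0 ∧ m ≤ pos e := by
  simp only [strandsFrom, Finset.mem_image, Finset.mem_filter, Finset.mem_univ, true_and]
  constructor
  · rintro ⟨x, hx, rfl⟩; exact ⟨rfl, hx⟩
  · rintro ⟨h1, h2⟩
    exact ⟨⟨pos e, pos_lt e⟩, h2, edge_ext (by rw [h1]; rfl) rfl⟩

theorem card_strandsFrom (m : ℕ) : (strandsFrom w m).card = p - m := by
  classical
  rw [strandsFrom, Finset.card_image_of_injective]
  · have : (Finset.univ.filter fun x : Fin p => m ≤ x).card + m ⊓ p = p := by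
      have h1 := Finset.card_filter_add_card_filter_not (s := (Finset.univ : Finset (Fin p)))
        (fun x : Fin p => m ≤ x)
      have h2 : (Finset.univ.filter fun x : Fin p => ¬ m ≤ x).card = m ⊓ p := by
        have := Fin.card_filter_val_lt (n := p) (m := m)
        simp only [not_le]
        rw [this, inf_comm]
      rw [h2, Finset.card_univ, Fintype.card_fin] at h1
      exact h1
    omega
  · intro x y h
    exact Fin.ext (congrArg pos h)

theorem separated_strandsFrom (hw : w.IsPositive) {lo hi : Set (Fin w.closure.n)} {m : ℕ}
    (hhi : ∀ r ∈ hi, col w r + 1 < m) : Separated lo hi (strandsFrom w m) := by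
  refine ⟨fun x hx ε hε r hr _ ht => ?_, fun ε hε x hx y hy hxy hc => ?_⟩
  all_goals
    rw [mem_strandsFrom] at hx
    have h0 : ∀ k, ε k = true → col w k ≠ pos x ∧ col w k + 1 ≠ pos x := fun k hk => by
      have := hhi k (hε.2 k hk)
      omega
  · have := hhi r hr
    rcases ht with h | h <;> have := (pos_eq_iff_of_conn hw h0 h).1 rfl
    · rw [pos_a hw] at this; omega
    · rw [pos_c hw] at this; omega
  · rw [mem_strandsFrom] at hy
    exact hxy (edge_ext (by omega) ((pos_eq_iff_of_conn hw h0 hc).1 rfl).symm)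

end BraidWord

namespace LinkDiagram

variable {D : LinkDiagram}

/-! ### Extending a cycle over one more crossing -/

/-- The function `z` is supported on states that use only crossings of `S`, have the label `1` on
the edges in `F` and the quantum degree `j`, and it is a cycle of the complex of the diagram in
which all the other crossings are replaced by their `0`-resolutions. -/
structure IsPartialCycle (D : LinkDiagram) (S : Set (Fin D.n)) (F : Set D.Edge) (j : ℤ)
    (z : D.State → ℤ) : Prop where
  mem_box : ∀ s, z s ≠ 0 → s ∈ D.box ∅ S F j
  differential_eq_zero : ∀ t, D.InBox ∅ S t.res → D.differential z t = 0

variable {S : Set (Fin D.n)} {F : Set D.Edge} {j : ℤ} {z : D.State → ℤ} {k : Fin D.n}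

theorem exists_of_differential_ne_zero {t : D.State} (h : D.differential z t ≠ 0) :
    ∃ s, D.diffCoeff s t ≠ 0 ∧ z s ≠ 0 := by
  obtain ⟨s, -, hs⟩ := Finset.exists_ne_zero_of_sum_ne_zero h
  exact ⟨s, left_ne_zero_of_mul hs, right_ne_zero_of_mul hs⟩

theorem mem_box_of_differential_ne_zero (hD : D.IsPlanar) (hF : ∀ x ∈ F, D.Protected ∅ S x)
    (hz : ∀ s, z s ≠ 0 → s ∈ D.box ∅ S F j) {t : D.State} (ht : D.InBox ∅ S t.res)
    (h : D.differential z t ≠ 0) : t ∈ D.box ∅ S F j := by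
  obtain ⟨s, hst, hs⟩ := exists_of_differential_ne_zero h
  obtain ⟨l, hl, htl, hc⟩ := exists_of_diffCoeff_ne_zero hst
  exact (mem_box_iff_of_edgeCoeff hD hF hl htl (hz s hs).1 ht hc).1 (hz s hs)

theorem res_eq_false_of_diffCoeff_ne_zero {s t : D.State} (h : D.diffCoeff s t ≠ 0)
    (ht : t.res k = false) : s.res k = false := by
  obtain ⟨l, hl, htl, -⟩ := exists_of_diffCoeff_ne_zero h
  rw [htl, Function.update_apply] at ht
  split_ifs at ht with hkl
  exact ht

/-- If the states that use the new crossing `k` form an acyclic quotient complex, the obstruction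
against extending a cycle over `k` vanishes. -/
theorem IsPartialCycle.exists_insert (hD : D.IsPlanar) (hz : D.IsPartialCycle S F j z)
    (hF : ∀ x ∈ F, D.Protected ∅ (insert k S) x)
    (hac : IsAcyclic (D.box {k} (insert k S) F j)) :
    ∃ z', D.IsPartialCycle (insert k S) F j z' ∧ ∀ t : D.State, t.res k = false → z' t = z t := by
  have hbox : ∀ s, s ∈ D.box {k} (insert k S) F j ↔
      s ∈ D.box ∅ (insert k S) F j ∧ s.res k = true := fun s => by
    simp only [box, InBox, Set.mem_ofPred_eq, Set.mem_singleton_iff, forall_eq,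
      Set.mem_empty_iff_false, false_imp_iff, implies_true, true_and]
    tauto
  have hmono : ∀ s, s ∈ D.box ∅ S F j → s ∈ D.box ∅ (insert k S) F j := fun s hs =>
    ⟨hs.1.mono subset_rfl (Set.subset_insert _ _), hs.2⟩
  have hS : ∀ s : D.State, D.InBox ∅ (insert k S) s.res → s.res k = false → D.InBox ∅ S s.res :=
    fun s hs hsk => ⟨fun _ h => h.elim, fun r hr => (hs.2 r hr).resolve_left fun h => by
      rw [h, hsk] at hr; cases hr⟩
  set P := D.box {k} (insert k S) F j with hP
  have hP' : ∀ t, D.InBox ∅ (insert k S) t.res → t ∉ P → D.differential z t = 0 := by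
    intro t ht htP
    by_contra hne
    have h1 := mem_box_of_differential_ne_zero hD hF (fun s hs => hmono s (hz.mem_box s hs)) ht hne
    refine htP ((hbox t).2 ⟨h1, ?_⟩)
    by_contra htk
    exact hne (hz.differential_eq_zero t (hS t ht (Bool.eq_false_iff.2 htk)))
  obtain ⟨y, hy, hyd⟩ := hac (P.indicator (D.differential z))
    (fun s hs => Set.indicator_of_notMem hs _) (fun t ht => by
      have h : D.differential (D.differential z) t = 0 := by rw [differential_differential hD]; rfl
      rw [← h, differential_apply, differential_apply]
      refine Finset.sum_congr rfl fun s _ => ?_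
      by_cases hs : s ∈ P
      · rw [Set.indicator_of_mem hs]
      rw [Set.indicator_of_notMem hs, mul_zero, eq_comm]
      by_cases hc : D.diffCoeff s t = 0
      · rw [hc, zero_mul]
      obtain ⟨l, hl, htl, -⟩ := exists_of_diffCoeff_ne_zero hc
      rw [hP' s ⟨fun _ h => h.elim, fun r hr => ht.1.2 r ?_⟩ hs, mul_zero]
      rw [htl, Function.update_apply]
      split_ifs
      · rfl
      · exact hr)
  -- the part of `d z` at states that use `k` is a cycle of the quotient, hence a boundary `d y`
  refine ⟨z - y, ⟨fun s hs => ?_, fun t ht => ?_⟩, fun t ht => ?_⟩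
  · by_cases hzs : z s = 0
    · refine ((hbox s).1 (by_contra fun h => hs ?_)).1
      rw [Pi.sub_apply, hzs, hy s h, sub_zero]
    · exact hmono s (hz.mem_box s hzs)
  · rw [map_sub, Pi.sub_apply, sub_eq_zero]
    by_cases htP : t ∈ P
    · rw [hyd t htP, Set.indicator_of_mem htP]
    · rw [hP' t ht htP, eq_comm]
      by_contra hne
      have h1 := mem_box_of_differential_ne_zero hD hF
        (fun s hs => ((hbox s).1 (by_contra fun h => hs (hy s h))).1) ht hne
      obtain ⟨s, hst, hs⟩ := exists_of_differential_ne_zero hne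
      have htk : t.res k = false := Bool.eq_false_iff.2 fun h => htP ((hbox t).2 ⟨h1, h⟩)
      have hsP : s ∈ P := by_contra fun h => hs (hy s h)
      have := res_eq_false_of_diffCoeff_ne_zero hst htk
      rw [((hbox s).1 hsP).2] at this
      cases this
  · rw [Pi.sub_apply, hy t fun h => ?_, sub_zero]
    rw [((hbox t).1 h).2] at ht
    cases ht

end LinkDiagram

namespace BraidWord

open LinkDiagram

/-! ### The braid word of the torus link -/

theorem getElem?_flatten_replicate {α : Type*} (l : List α) (q k : ℕ) (hk : k < q * l.length) :
    (List.replicate q l).flatten[k]? = l[k % l.length]? := by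
  induction q generalizing k with
  | zero => simp at hk
  | succ q ih =>
    rw [List.replicate_succ, List.flatten_cons]
    rw [Nat.succ_mul] at hk
    by_cases h : k < l.length
    · rw [List.getElem?_append_left h, Nat.mod_eq_of_lt h]
    · rw [List.getElem?_append_right (by omega), ih _ (by omega),
        ← Nat.mod_eq_sub_mod (by omega)]

variable {p q : ℕ}

theorem length_torus (p q : ℕ) : (torus p q).length = q * (p - 1) := by
  simp [torus]

theorem torus_getElem {k : ℕ} (hk : k < (torus p q).length) :
    ∃ h : k % (p - 1) < p - 1, (torus p q)[k] = (⟨k % (p - 1), h⟩, true) := by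
  have hk' := hk
  rw [length_torus] at hk'
  have hp : 0 < p - 1 := Nat.pos_of_ne_zero fun h => by simp [h] at hk'
  refine ⟨Nat.mod_lt _ hp, ?_⟩
  have h1 : (torus p q)[k]? = _ := getElem?_flatten_replicate
    ((List.finRange (p - 1)).map fun i => (i, true)) q k (by simpa using hk')
  rw [List.getElem?_eq_getElem hk] at h1
  simp only [List.length_map, List.length_finRange, List.getElem?_map] at h1
  rw [List.getElem?_eq_getElem (by simpa using Nat.mod_lt _ hp)] at h1
  simpa using h1

theorem isPositive_torus (p q : ℕ) : (torus p q).IsPositive := fun k => by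
  obtain ⟨h, h'⟩ := torus_getElem k.2
  exact congrArg Prod.snd h'

/-- The number of the factor `σ₁ ⋯ σ_{p-1}` that contains the letter `k`. -/
def row (k : Fin (torus p q).closure.n) : ℕ := (k : ℕ) / (p - 1)

theorem col_torus (k : Fin (torus p q).closure.n) : col (torus p q) k = (k : ℕ) % (p - 1) := by
  obtain ⟨h, h'⟩ := torus_getElem k.2
  exact congrArg (fun x => (x.1 : ℕ)) h'

theorem val_eq_row_col (k : Fin (torus p q).closure.n) :
    (k : ℕ) = row k * (p - 1) + col (torus p q) k := by
  rw [col_torus, row, mul_comm, Nat.div_add_mod]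

theorem crossing_ext {k l : Fin (torus p q).closure.n} (h : row k = row l)
    (h' : col (torus p q) k = col (torus p q) l) : k = l :=
  Fin.ext (by rw [val_eq_row_col, val_eq_row_col, h, h'])

theorem crossing_lt_iff {k l : Fin (torus p q).closure.n} :
    k < l ↔ row k < row l ∨ row k = row l ∧ col (torus p q) k < col (torus p q) l := by
  have key : ∀ k l : Fin (torus p q).closure.n, row k < row l → k < l := fun k l h => by
    rw [Fin.lt_def, val_eq_row_col k, val_eq_row_col l]
    have h1 := col_lt k
    have h2 := Nat.mul_le_mul_right (p - 1) (Nat.succ_le_of_lt h)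
    rw [Nat.succ_mul] at h2
    omega
  rcases lt_trichotomy (row k) (row l) with h | h | h
  · exact iff_of_true (key k l h) (Or.inl h)
  · rw [Fin.lt_def, val_eq_row_col k, val_eq_row_col l, h]
    omega
  · refine iff_of_false (key l k h).asymm (by omega)

theorem exists_crossing {r c : ℕ} (hr : r < q) (hc : c + 1 < p) :
    ∃ k : Fin (torus p q).closure.n, row k = r ∧ col (torus p q) k = c := by
  have h : r * (p - 1) + c < (torus p q).length := by
    rw [length_torus]
    have := Nat.mul_le_mul_right (p - 1) (Nat.succ_le_of_lt hr)
    rw [Nat.succ_mul] at this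
    omega
  refine ⟨⟨_, h⟩, ?_, ?_⟩
  · show (r * (p - 1) + c) / (p - 1) = r
    rw [mul_comm, Nat.mul_add_div (by omega), Nat.div_eq_of_lt (by omega), add_zero]
  · rw [col_torus]
    show (r * (p - 1) + c) % (p - 1) = c
    rw [mul_comm, Nat.mul_add_mod, Nat.mod_eq_of_lt (by omega)]

theorem row_lt (k : Fin (torus p q).closure.n) : row k < q := by
  have h := lt_length k
  rw [length_torus, mul_comm] at h
  exact Nat.div_lt_of_lt_mul h

/-! ### Acyclic quotients -/

theorem crossing_ne {k l : Fin (torus p q).closure.n}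
    (h : ¬ (row k = row l ∧ col (torus p q) k = col (torus p q) l)) : k ≠ l :=
  fun h' => h (by rw [h']; exact ⟨rfl, rfl⟩)

theorem crossing_ne_iff {k l : Fin (torus p q).closure.n} :
    k ≠ l ↔ ¬ (row k = row l ∧ col (torus p q) k = col (torus p q) l) :=
  ⟨fun h h' => h (crossing_ext h'.1 h'.2), crossing_ne⟩

/-- Adding a crossing in the first two columns. Each of two slides followed by a curl turns three
crossings into one more free circle. -/
theorem isAcyclic_two_columns (hp : 3 ≤ p) {k₀ : Fin (torus p q).closure.n}
    (hk₀ : col (torus p q) k₀ ≤ 1) (h6 : 6 ≤ 2 * row k₀ + col (torus p q) k₀) :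
    IsAcyclic ((torus p q).closure.box {k₀}
      {r | col (torus p q) r ≤ 1 ∧
        2 * row r + col (torus p q) r ≤ 2 * row k₀ + col (torus p q) k₀}
      (strandsFrom (torus p q) 3) p) := by
  have hw := isPositive_torus p q
  have hq := row_lt k₀
  obtain ⟨M, hM⟩ : ∃ M, 2 * row k₀ + col (torus p q) k₀ = M := ⟨_, rfl⟩
  have hex : ∀ i, i ≤ M → ∃ k : Fin (torus p q).closure.n, col (torus p q) k ≤ 1 ∧
      2 * row k + col (torus p q) k = i := fun i hi => by
    obtain ⟨k, h1, h2⟩ := exists_crossing (p := p) (q := q) (r := i / 2) (c := i % 2) (by omega)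
      (by omega)
    exact ⟨k, by rw [h2]; omega, by rw [h1, h2]; omega⟩
  rw [hM] at h6 ⊢
  obtain ⟨k₁, c1, r1⟩ := hex (M - 1) (by omega)
  obtain ⟨k₂, c2, r2⟩ := hex (M - 2) (by omega)
  obtain ⟨k₃, c3, r3⟩ := hex (M - 3) (by omega)
  obtain ⟨k₄, c4, r4⟩ := hex (M - 4) (by omega)
  obtain ⟨k₅, c5, r5⟩ := hex (M - 5) (by omega)
  obtain ⟨k₆, c6, r6⟩ := hex (M - 6) (by omega)
  have hF : Separated {k₀} {r | col (torus p q) r ≤ 1 ∧ 2 * row r + col (torus p q) r ≤ M}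
      (strandsFrom (torus p q) 3) := separated_strandsFrom hw fun r hr => by
    have := hr.1; omega
  have hcard := card_strandsFrom (w := torus p q) 3
  refine isAcyclic_box_of_slide (k := k₂) (l := k₁) (k' := k₀) hw hF ?_ ?_ ?_ ?_ ?_ ?_ ?_ ?_ ?_ ?_
    fun hF => isAcyclic_box_of_curl (k := k₃) (k' := k₁) hw hF ?_ ?_ ?_ ?_ ?_ ?_ fun F hFc hF =>
    isAcyclic_box_of_slide (k := k₅) (l := k₄) (k' := k₃) hw hF ?_ ?_ ?_ ?_ ?_ ?_ ?_ ?_ ?_ ?_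
    fun hF => isAcyclic_box_of_curl (k := k₆) (k' := k₄) hw hF ?_ ?_ ?_ ?_ ?_ ?_ fun F' hFc' hF =>
    isAcyclic_box_of_lt hw hF (C := {0, 1}) ?_ ?_
  all_goals try simp only [Set.mem_insert_iff, Set.mem_singleton_iff, Set.mem_sdiff,
    Set.mem_ofPred_eq, ← ne_eq, crossing_lt_iff, crossing_ne_iff, Far, not_or]
  all_goals try omega
  · exact Or.inl trivial
  · exact Or.inl trivial
  · exact Or.inl trivial
  · intro c hc
    by_cases h : col (torus p q) k₀ = c
    · exact ⟨k₀, by simp, h⟩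
    · refine ⟨k₁, by simp, ?_⟩
      simp only [Finset.mem_insert, Finset.mem_singleton] at hc
      omega
  -- two columns, `p - 3` outer strands and two small circles: `2 * 2 + 2 * (p - 1) > 2 * p`
  · rw [Finset.card_pair zero_ne_one]
    omega

/-- Adding a crossing in a column `c ≥ 2` that is not the first one in its column. Slides move the
crossing to the left; in the leftmost column a curl is available. -/
theorem isAcyclic_next_column {k₀ : Fin (torus p q).closure.n}
    (hc : 2 ≤ col (torus p q) k₀) (hr : 0 < row k₀) :
    IsAcyclic ((torus p q).closure.box {k₀}
      {r | col (torus p q) r < col (torus p q) k₀ ∨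
        col (torus p q) r = col (torus p q) k₀ ∧ row r ≤ row k₀}
      (strandsFrom (torus p q) (col (torus p q) k₀ + 2))
      (p - 2 * col (torus p q) k₀ + 2)) := by
  have hw := isPositive_torus p q
  have hq := row_lt k₀
  have hcp := col_lt k₀
  obtain ⟨k₁, r1, c1⟩ := exists_crossing (p := p) (q := q) (r := row k₀ - 1)
    (c := col (torus p q) k₀) (by omega) (by omega)
  obtain ⟨k₂, r2, c2⟩ := exists_crossing (p := p) (q := q) (r := row k₀)
    (c := col (torus p q) k₀ - 1) (by omega) (by omega)
  obtain ⟨k₃, r3, c3⟩ := exists_crossing (p := p) (q := q) (r := row k₀ - 1)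
    (c := col (torus p q) k₀ - 1) (by omega) (by omega)
  obtain ⟨k₄, r4, c4⟩ := exists_crossing (p := p) (q := q) (r := row k₀)
    (c := col (torus p q) k₀ - 2) (by omega) (by omega)
  obtain ⟨k₅, r5, c5⟩ := exists_crossing (p := p) (q := q) (r := row k₀ - 1)
    (c := col (torus p q) k₀ - 2) (by omega) (by omega)
  have hF : Separated {k₀} {r | col (torus p q) r < col (torus p q) k₀ ∨
      col (torus p q) r = col (torus p q) k₀ ∧ row r ≤ row k₀}
      (strandsFrom (torus p q) (col (torus p q) k₀ + 2)) := separated_strandsFrom hw fun r hr => by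
    rcases hr with hr | hr <;> omega
  have hcard := card_strandsFrom (w := torus p q) (col (torus p q) k₀ + 2)
  refine isAcyclic_box_of_slide (k := k₁) (l := k₂) (k' := k₀) hw hF ?_ ?_ ?_ ?_ ?_ ?_ ?_ ?_ ?_ ?_
    fun hF => isAcyclic_box_of_slide (k := k₃) (l := k₄) (k' := k₂) hw hF ?_ ?_ ?_ ?_ ?_ ?_ ?_ ?_
      ?_ ?_ fun hF => ?_
  -- after two slides there is room for a third one, or the leftmost column is reached
  on_goal 21 => by_cases h3 : 3 ≤ col (torus p q) k₀
  on_goal 21 =>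
    obtain ⟨k₆, r6, c6⟩ := exists_crossing (p := p) (q := q) (r := row k₀)
      (c := col (torus p q) k₀ - 3) (by omega) (by omega)
    refine isAcyclic_box_of_slide (k := k₅) (l := k₆) (k' := k₄) hw hF ?_ ?_ ?_ ?_ ?_ ?_ ?_ ?_ ?_ ?_
      fun hF => isAcyclic_box_of_lt hw hF (C := {col (torus p q) k₀, col (torus p q) k₂,
        col (torus p q) k₄, col (torus p q) k₆}) ?_ ?_
  on_goal 33 =>
    refine isAcyclic_box_of_curl (k := k₅) (k' := k₄) hw hF ?_ ?_ ?_ ?_ ?_ ?_ fun F hFc hF =>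
      isAcyclic_box_of_lt hw hF (C := {col (torus p q) k₀, col (torus p q) k₂,
        col (torus p q) k₄}) ?_ ?_
  all_goals try simp only [Set.mem_insert_iff, Set.mem_singleton_iff, Set.mem_sdiff,
    Set.mem_ofPred_eq, ← ne_eq, crossing_lt_iff, crossing_ne_iff, Far, not_or, true_or]
  all_goals try omega
  · intro c hc
    simp only [Finset.mem_insert, Finset.mem_singleton] at hc
    rcases hc with rfl | rfl | rfl | rfl
    exacts [⟨k₀, by simp, rfl⟩, ⟨k₂, by simp, rfl⟩, ⟨k₄, by simp, rfl⟩, ⟨k₆, by simp, rfl⟩]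
  · rw [c2, c4, c6, Finset.card_insert_of_notMem, Finset.card_insert_of_notMem, Finset.card_pair]
    all_goals try simp only [Finset.mem_insert, Finset.mem_singleton, ne_eq]
    all_goals omega
  · intro c hc
    simp only [Finset.mem_insert, Finset.mem_singleton] at hc
    rcases hc with rfl | rfl | rfl
    exacts [⟨k₀, by simp, rfl⟩, ⟨k₂, by simp, rfl⟩, ⟨k₄, by simp, rfl⟩]
  · rw [c2, c4, Finset.card_insert_of_notMem, Finset.card_pair]
    all_goals try simp only [Finset.mem_insert, Finset.mem_singleton, ne_eq]
    all_goals omega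

end BraidWord

namespace LinkDiagram

variable {D : LinkDiagram}

/-! ### Multiplication by `X` and extensions over a merging crossing -/

theorem State.qdeg_set_one {s : D.State} {e : D.Edge} (h : s.labelAt e = .X) :
    (s.set e .one).qdeg = s.qdeg + 2 := by
  classical
  have hlab : (fun z : D.Circle s.res => ((s.set e .one).label z).deg) =
      Function.update (fun z => (s.label z).deg) (D.circ s.res e) 1 := by
    ext z
    rw [Function.update_apply]
    obtain ⟨x, rfl⟩ := exists_circ _ z
    refine (congrArg Label.deg (State.set_labelAt s e .one x)).trans ?_
    change Label.deg (if D.circ s.res x = D.circ s.res e then _ else _) = _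
    split_ifs <;> rfl
  have h1 : ∑ z, ((s.set e .one).label z).deg = ∑ z, (s.label z).deg + 2 := by
    have hX : (s.label (D.circ s.res e)).deg = -1 := congrArg Label.deg h
    change ∑ z, (fun z : D.Circle s.res => ((s.set e .one).label z).deg) z = _
    rw [hlab, Finset.sum_update_of_mem (Finset.mem_univ _),
      Finset.sum_eq_add_sum_sdiff_singleton_of_mem (Finset.mem_univ (D.circ s.res e))
        fun z => (s.label z).deg, hX]
    ring
  have h2 : (s.set e .one).height = s.height := rfl
  unfold State.qdeg
  rw [h1, h2]
  ring

theorem mulX_apply_congr {e f : D.Edge} {t : D.State} (h : D.Conn t.res e f) (z : D.State → ℤ) :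
    D.mulX e z t = D.mulX f z t := by
  have hl := State.labelAt_congr h
  rcases label_eq_one_or (t.labelAt f) with h1 | h1
  · rw [mulX_apply_one h1, mulX_apply_one (hl.trans h1)]
  · rw [mulX_apply_X h1, mulX_apply_X (hl.trans h1), State.set_congr h]

theorem mulX_apply_ne_zero {e : D.Edge} {t : D.State} {z : D.State → ℤ} (h : D.mulX e z t ≠ 0) :
    t.labelAt e = .X ∧ z (t.set e .one) ≠ 0 := by
  rcases label_eq_one_or (t.labelAt e) with h1 | h1
  · exact absurd (mulX_apply_one h1 z) h
  · exact ⟨h1, by rwa [mulX_apply_X h1] at h⟩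

variable {S : Set (Fin D.n)} {F F' : Set D.Edge} {j : ℤ} {z : D.State → ℤ} {k : Fin D.n}

theorem mem_box_of_mulX_ne_zero (hz : ∀ s, z s ≠ 0 → s ∈ D.box ∅ S F j) {e : D.Edge}
    (hF' : ∀ ε, D.InBox ∅ S ε → ∀ x ∈ F', x ∈ F ∧ ¬ D.Conn ε x e) {s : D.State}
    (h : D.mulX e z s ≠ 0) : s ∈ D.box ∅ S F' (j - 2) := by
  obtain ⟨hX, hs⟩ := mulX_apply_ne_zero h
  obtain ⟨h1, h2, h3⟩ := hz _ hs
  refine ⟨h1, fun x hx => ?_, ?_⟩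
  · obtain ⟨hxF, hxe⟩ := hF' _ h1 x hx
    exact (State.set_labelAt_of_not_conn (s := s) _ hxe).symm.trans (h2 x hxF)
  · rw [State.qdeg_set_one hX] at h3
    linarith

/-- If both ends of a crossing `k` carry the factor `X ⊗ 1 - 1 ⊗ X`, the `1`-resolution of `k`,
which connects them, contributes nothing to the differential. -/
theorem IsPartialCycle.insert_mulX_sub (hD : D.IsPlanar) (hz : D.IsPartialCycle S F j z)
    (hF' : ∀ ε, D.InBox ∅ S ε → ∀ x ∈ F', x ∈ F ∧ ¬ D.Conn ε x (D.crossing k).b ∧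
      ¬ D.Conn ε x (D.crossing k).c) :
    D.IsPartialCycle (insert k S) F' (j - 2)
      (D.mulX (D.crossing k).b z - D.mulX (D.crossing k).c z) := by
  constructor
  · intro s hs
    have h : s ∈ D.box ∅ S F' (j - 2) := by
      by_cases hb : D.mulX (D.crossing k).b z s = 0
      · refine mem_box_of_mulX_ne_zero hz.mem_box (e := (D.crossing k).c)
          (fun ε hε x hx => ⟨(hF' ε hε x hx).1, (hF' ε hε x hx).2.2⟩) fun hc => hs ?_
        rw [Pi.sub_apply, hb, hc, sub_zero]
      · exact mem_box_of_mulX_ne_zero hz.mem_box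
          (fun ε hε x hx => ⟨(hF' ε hε x hx).1, (hF' ε hε x hx).2.1⟩) hb
    exact ⟨h.1.mono subset_rfl (Set.subset_insert _ _), h.2⟩
  · intro t ht
    rw [map_sub, differential_mulX hD, differential_mulX hD, Pi.sub_apply, sub_eq_zero]
    cases hk : t.res k
    · have ht' : D.InBox ∅ S t.res := ⟨fun _ h => h.elim, fun r hr =>
        (ht.2 r hr).resolve_left fun h => by rw [h, hk] at hr; cases hr⟩
      have key : ∀ e, D.mulX e (D.differential z) t = 0 := fun e => by
        by_contra h
        exact (mulX_apply_ne_zero h).2 (hz.differential_eq_zero _ ht')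
      rw [key, key]
    · exact mulX_apply_congr (conn_bc hk) _

end LinkDiagram

namespace BraidWord

open LinkDiagram

variable {p q : ℕ}

/-! ### Extending a cycle over the columns -/

/-- The first six letters in the first two columns. -/
def firstSix (p q : ℕ) : Set (Fin (torus p q).closure.n) :=
  {r | col (torus p q) r ≤ 1 ∧ 2 * row r + col (torus p q) r < 6}

variable {z₀ : (torus p q).closure.State → ℤ}

/-- Extension of a cycle from the first six letters to the first two columns. The values on the old
states do not change. -/
theorem exists_two_columns (hp : 3 ≤ p)
    (hz₀ : (torus p q).closure.IsPartialCycle (firstSix p q) (strandsFrom (torus p q) 3) p z₀)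
    (M : ℕ) (hM : 6 ≤ M) :
    ∃ z, (torus p q).closure.IsPartialCycle
      {r | col (torus p q) r ≤ 1 ∧ 2 * row r + col (torus p q) r < M}
      (strandsFrom (torus p q) 3) p z ∧
      ∀ t : (torus p q).closure.State, (torus p q).closure.InBox ∅ (firstSix p q) t.res →
        z t = z₀ t := by
  have hw := isPositive_torus p q
  induction M, hM using Nat.le_induction with
  | base => exact ⟨z₀, hz₀, fun _ _ => rfl⟩
  | succ M hM ih =>
    obtain ⟨z, hz, hzt⟩ := ih
    by_cases hex : ∃ k₀ : Fin (torus p q).closure.n, col (torus p q) k₀ ≤ 1 ∧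
        2 * row k₀ + col (torus p q) k₀ = M
    · obtain ⟨k₀, h1, h2⟩ := hex
      have hS : insert k₀ {r | col (torus p q) r ≤ 1 ∧ 2 * row r + col (torus p q) r < M} =
          {r | col (torus p q) r ≤ 1 ∧
            2 * row r + col (torus p q) r ≤ 2 * row k₀ + col (torus p q) k₀} := by
        ext r
        simp only [Set.mem_insert_iff, Set.mem_ofPred_eq]
        constructor
        · rintro (rfl | h) <;> omega
        · intro h
          by_cases hr : r = k₀
          · exact Or.inl hr
          · have := crossing_ne_iff.1 hr
            omega
      obtain ⟨z', hz', hzz⟩ := hz.exists_insert (isPlanar_closure hw) (k := k₀)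
        (separated_strandsFrom hw fun r hr => by
          rw [hS] at hr
          have := hr.1
          omega).1
        (by rw [hS]; exact isAcyclic_two_columns hp h1 (by omega))
      rw [hS] at hz'
      refine ⟨z', ?_, fun t ht => ?_⟩
      · simpa only [Nat.lt_succ_iff, ← h2] using hz'
      · rw [hzz t ?_, hzt t ht]
        refine Bool.eq_false_iff.2 fun h => ?_
        have := (ht.2 k₀ h).2
        omega
    · have : {r : Fin (torus p q).closure.n | col (torus p q) r ≤ 1 ∧
          2 * row r + col (torus p q) r < M + 1} =
          {r | col (torus p q) r ≤ 1 ∧ 2 * row r + col (torus p q) r < M} := by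
        ext r
        have : ¬ (col (torus p q) r ≤ 1 ∧ 2 * row r + col (torus p q) r = M) :=
          fun h => hex ⟨r, h⟩
        simp only [Set.mem_ofPred_eq]
        omega
      rw [this]
      exact ⟨z, hz, hzt⟩

/-- Extension of a cycle from the first crossing of the column `c` to the whole column. -/
theorem exists_rest_of_column {c : ℕ} (hc : 2 ≤ c)
    {z₁ : (torus p q).closure.State → ℤ}
    (hz₁ : (torus p q).closure.IsPartialCycle
      {r | col (torus p q) r < c ∨ col (torus p q) r = c ∧ row r < 1}
      (strandsFrom (torus p q) (c + 2)) (p - 2 * c + 2) z₁)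
    (M : ℕ) (hM : 1 ≤ M) :
    ∃ z, (torus p q).closure.IsPartialCycle
      {r | col (torus p q) r < c ∨ col (torus p q) r = c ∧ row r < M}
      (strandsFrom (torus p q) (c + 2)) (p - 2 * c + 2) z ∧
      ∀ t : (torus p q).closure.State, (torus p q).closure.InBox ∅ (firstSix p q) t.res →
        z t = z₁ t := by
  have hw := isPositive_torus p q
  induction M, hM using Nat.le_induction with
  | base => exact ⟨z₁, hz₁, fun _ _ => rfl⟩
  | succ M hM ih =>
    obtain ⟨z, hz, hzt⟩ := ih
    by_cases hex : ∃ k₀ : Fin (torus p q).closure.n, col (torus p q) k₀ = c ∧ row k₀ = M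
    · obtain ⟨k₀, h1, h2⟩ := hex
      subst h1
      have hS : insert k₀ {r | col (torus p q) r < col (torus p q) k₀ ∨
          col (torus p q) r = col (torus p q) k₀ ∧ row r < M} =
          {r | col (torus p q) r < col (torus p q) k₀ ∨
            col (torus p q) r = col (torus p q) k₀ ∧ row r ≤ row k₀} := by
        ext r
        simp only [Set.mem_insert_iff, Set.mem_ofPred_eq]
        constructor
        · rintro (rfl | h) <;> omega
        · intro h
          by_cases hr : r = k₀
          · exact Or.inl hr
          · have := crossing_ne_iff.1 hr
            omega
      obtain ⟨z', hz', hzz⟩ := hz.exists_insert (isPlanar_closure hw) (k := k₀)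
        (separated_strandsFrom hw fun r hr => by
          rw [hS] at hr
          rcases hr with hr | hr <;> omega).1
        (by rw [hS]; exact isAcyclic_next_column hc (by omega))
      rw [hS] at hz'
      refine ⟨z', ?_, fun t ht => ?_⟩
      · simpa only [Nat.lt_succ_iff, ← h2] using hz'
      · rw [hzz t ?_, hzt t ht]
        refine Bool.eq_false_iff.2 fun h => ?_
        have := (ht.2 k₀ h).1
        omega
    · have : {r : Fin (torus p q).closure.n | col (torus p q) r < c ∨
          col (torus p q) r = c ∧ row r < M + 1} =
          {r | col (torus p q) r < c ∨ col (torus p q) r = c ∧ row r < M} := by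
        ext r
        have : ¬ (col (torus p q) r = c ∧ row r = M) := fun h => hex ⟨r, h⟩
        simp only [Set.mem_ofPred_eq]
        omega
      rw [this]
      exact ⟨z, hz, hzt⟩

/-- The state `t` agrees with `t'` on the first three strands. On the further strands `t` has the
label `X` up to the position `m`, and `t'` has the label `1`. -/
structure Raises (m : ℕ) (t t' : (torus p q).closure.State) : Prop where
  res_eq : t.res = t'.res
  labelAt_eq : ∀ x, pos x < 3 → t.labelAt x = t'.labelAt x
  labelAt_X : ∀ x, 3 ≤ pos x → pos x ≤ m → t.labelAt x = .X
  labelAt_one : ∀ x, 3 ≤ pos x → m < pos x → t.labelAt x = .one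
  labelAt_one' : ∀ x, 3 ≤ pos x → t'.labelAt x = .one

/-- Extension of a cycle from the first six letters to the first `c` columns. The first crossing of
each column `≥ 2` multiplies by `X ⊗ 1 - 1 ⊗ X`, which lowers the degree by `2` and moves the value
at a state with the label `1` on the new strand to the state with the label `X` there. -/
theorem exists_columns (hp : 3 ≤ p) (hq : 1 ≤ q)
    (hz₀ : (torus p q).closure.IsPartialCycle (firstSix p q) (strandsFrom (torus p q) 3) p z₀)
    (c : ℕ) (hc : 2 ≤ c) (hcp : c < p) :
    ∃ z, (torus p q).closure.IsPartialCycle {r | col (torus p q) r < c}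
      (strandsFrom (torus p q) (c + 1)) (p - 2 * c + 4) z ∧
      ∀ t t' : (torus p q).closure.State, (torus p q).closure.InBox ∅ (firstSix p q) t.res →
        Raises c t t' → z t = z₀ t' := by
  have hw := isPositive_torus p q
  induction c, hc using Nat.le_induction with
  | base =>
    obtain ⟨z, hz, hzt⟩ := exists_two_columns hp hz₀ (2 * q + 6) (by omega)
    have hS : {r : Fin (torus p q).closure.n | col (torus p q) r ≤ 1 ∧
        2 * row r + col (torus p q) r < 2 * q + 6} = {r | col (torus p q) r < 2} := by
      ext r
      have := row_lt r
      simp only [Set.mem_ofPred_eq]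
      omega
    rw [hS] at hz
    refine ⟨z, by convert hz using 1; push_cast; ring, fun t t' ht htt => ?_⟩
    rw [hzt t ht, State.ext_labelAt htt.res_eq fun x => ?_]
    by_cases hx : pos x < 3
    · exact htt.labelAt_eq x hx
    · rw [htt.labelAt_one x (by omega) (by omega), htt.labelAt_one' x (by omega)]
  | succ c hc ih =>
    obtain ⟨z, hz, hzt⟩ := ih (by omega)
    obtain ⟨k, hk, hk'⟩ := exists_crossing (p := p) (q := q) (r := 0) (c := c) (by omega)
      (by omega)
    have hS : insert k {r | col (torus p q) r < c} =
        {r | col (torus p q) r < c ∨ col (torus p q) r = c ∧ row r < 1} := by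
      ext r
      simp only [Set.mem_insert_iff, Set.mem_ofPred_eq]
      constructor
      · rintro (rfl | h) <;> omega
      · intro h
        by_cases hr : r = k
        · exact Or.inl hr
        · have := crossing_ne_iff.1 hr
          omega
    have hfar : ∀ ε, (torus p q).closure.InBox ∅ {r | col (torus p q) r < c} ε →
        ∀ x y : (torus p q).closure.Edge, c < pos x → pos x ≠ pos y →
        ¬ (torus p q).closure.Conn ε x y := fun ε hε x y hx hxy h => by
      refine hxy ((pos_eq_iff_of_conn hw (fun r hr => ?_) h).1 rfl).symm
      have : col (torus p q) r < c := hε.2 r hr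
      omega
    have hz₁ := hz.insert_mulX_sub (isPlanar_closure hw) (k := k)
      (F' := strandsFrom (torus p q) (c + 2)) fun ε hε x hx => by
        rw [Finset.mem_coe, mem_strandsFrom] at hx
        rw [Finset.mem_coe, mem_strandsFrom]
        refine ⟨by omega, hfar ε hε _ _ (by omega) ?_, hfar ε hε _ _ (by omega) ?_⟩
        · rw [pos_b hw]; omega
        · rw [pos_c hw]; omega
    rw [hS, show (p : ℤ) - 2 * c + 4 - 2 = p - 2 * c + 2 by ring] at hz₁
    obtain ⟨z', hz', hzz⟩ := exists_rest_of_column hc hz₁ (q + 1) (by omega)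
    have hS' : {r : Fin (torus p q).closure.n | col (torus p q) r < c ∨
        col (torus p q) r = c ∧ row r < q + 1} = {r | col (torus p q) r < c + 1} := by
      ext r
      have := row_lt r
      simp only [Set.mem_ofPred_eq]
      omega
    rw [hS'] at hz'
    refine ⟨z', by convert hz' using 1; push_cast; ring, fun t t' ht htt => ?_⟩
    have ht' : (torus p q).closure.InBox ∅ {r | col (torus p q) r < c} t.res :=
      ht.mono subset_rfl fun r hr => by
        have := hr.1
        show col (torus p q) r < c
        omega
    have hposb := pos_b hw k
    have hposc := pos_c hw k
    have hb : t.labelAt ((torus p q).closure.crossing k).b = .X :=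
      htt.labelAt_X _ (by omega) (by omega)
    obtain ⟨x, hx, hx'⟩ := exists_edge (w := torus p q) (i := 0) (x := c + 1) (by omega) hcp
    -- `t` has the label `X` on the strand `c + 1`, which has the label `1` in the support of `z`
    -- and is not affected by the factor `1 ⊗ X`
    have hzc : (torus p q).closure.mulX ((torus p q).closure.crossing k).c z t = 0 := by
      by_contra h
      have h1 := (hz.mem_box _ (mulX_apply_ne_zero h).2).2.1 x
        (Finset.mem_coe.2 (mem_strandsFrom.2 ⟨hx, by omega⟩))
      rw [State.set_labelAt_of_not_conn _ (hfar _ ht' _ _ (by omega) (by omega)),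
        htt.labelAt_X x (by omega) (by omega)] at h1
      cases h1
    rw [hzz t ht, Pi.sub_apply, hzc, sub_zero, mulX_apply_X hb]
    refine hzt _ t' ht ⟨htt.res_eq, fun y hy => ?_, fun y hy hy' => ?_, fun y hy hy' => ?_,
      htt.labelAt_one'⟩
    · rw [State.set_labelAt_of_not_conn _ fun h => hfar _ ht' _ _ (by omega) (by omega) h.symm,
        htt.labelAt_eq y hy]
    · rw [State.set_labelAt_of_not_conn _ fun h => hfar _ ht' _ _ (by omega) (by omega) h.symm,
        htt.labelAt_X y hy (by omega)]
    · by_cases hyb : (torus p q).closure.Conn t.res y ((torus p q).closure.crossing k).b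
      · exact State.set_labelAt_of_conn _ hyb
      · rw [State.set_labelAt_of_not_conn _ hyb]
        refine htt.labelAt_one y hy (lt_of_le_of_ne hy' fun h => hyb ?_)
        have hconn : ∀ e f : (torus p q).closure.Edge, pos e = c + 1 → pos f = c + 1 →
            lev e ≤ lev f → (torus p q).closure.Conn t.res e f := fun e f he hf hl => by
          refine conn_of_pos_eq hw (he.trans hf.symm) (fun r _ _ hr => ?_) hl
          have : col (torus p q) r < c := ht'.2 r hr
          omega
        rcases le_total (lev y) (lev ((torus p q).closure.crossing k).b) with hl | hl
        · exact hconn _ _ h.symm (by omega) hl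
        · exact (hconn _ _ (by omega) h.symm hl).symm

end BraidWord

namespace LinkDiagram

variable {D : LinkDiagram}

/-! ### Evaluating the edge maps at states with few labels `1` -/

/-- The state with resolution `ε` and all labels `X`. -/
def allX (D : LinkDiagram) (ε : Fin D.n → Bool) : D.State :=
  State.ofLabel ε (fun _ => .X) fun _ _ _ => rfl

open Classical in
theorem eq_allX_set_iff {s : D.State} {e : D.Edge} : s = (D.allX s.res).set e .one ↔
    ∀ x, s.labelAt x = if D.Conn s.res x e then .one else .X :=
  ⟨fun h x => (congrArg (fun t : D.State => t.labelAt x) h).trans rfl,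
    fun h => State.ext_labelAt rfl h⟩

theorem cubeCoeff_of_res_ne {k : Fin D.n} {ε : Fin D.n → Bool} {s t : D.State} (hk : ε k = false)
    (ht : t.res = Function.update ε k true) (h : s.res ≠ ε) : D.cubeCoeff k s t = 0 := by
  rw [cubeCoeff, if_neg]
  rintro ⟨h1, h2⟩
  exact h (update_injective_of_false h1 hk (h2.symm.trans ht))

open Classical in
/-- The transpose of `m` sends the dual of `X` to the sum of the duals of `1 ⊗ X` and `X ⊗ 1`. -/
theorem edgeMap_allX {k : Fin D.n} {ε : Fin D.n → Bool} (hk : ε k = false)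
    (hac : ¬ D.Conn ε (D.crossing k).a (D.crossing k).c) (z : D.State → ℤ) :
    D.edgeMap k z (D.allX (Function.update ε k true)) =
      z ((D.allX ε).set (D.crossing k).a .one) + z ((D.allX ε).set (D.crossing k).c .one) := by
  have key : ∀ s, D.cubeCoeff k s (D.allX (Function.update ε k true)) =
      (if s = (D.allX ε).set (D.crossing k).a .one then 1 else 0) +
        if s = (D.allX ε).set (D.crossing k).c .one then 1 else 0 := by
    intro s
    by_cases hs : s.res = ε
    swap
    · rw [cubeCoeff_of_res_ne hk rfl hs, if_neg fun h => hs (by rw [h]; rfl),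
        if_neg fun h => hs (by rw [h]; rfl)]
      rfl
    subst hs
    rw [cubeCoeff, if_pos ⟨hk, rfl⟩, edgeCoeff_merge hac]
    rw [eq_allX_set_iff, eq_allX_set_iff]
    change (if ∀ x, ¬ D.Touch s.res k x → Label.X = s.labelAt x then
      Label.mulCoeff (s.labelAt (D.crossing k).a) (s.labelAt (D.crossing k).c) .X else 0) = _
    set U := ∀ x, ¬ D.Touch s.res k x → Label.X = s.labelAt x with hU
    have h1 : (∀ x, s.labelAt x = if D.Conn s.res x (D.crossing k).a then .one else .X) ↔
        U ∧ s.labelAt (D.crossing k).a = .one ∧ s.labelAt (D.crossing k).c = .X := by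
      refine ⟨fun h => ⟨fun x hx => ?_, ?_, ?_⟩, fun ⟨h, ha, hc⟩ x => ?_⟩
      · rw [h, if_neg fun h' => hx (Or.inl h')]
      · rw [h, if_pos (Conn.refl _ _)]
      · rw [h, if_neg fun h' => hac h'.symm]
      · split_ifs with hx
        · rw [State.labelAt_congr hx, ha]
        · by_cases hx' : D.Conn s.res x (D.crossing k).c
          · rw [State.labelAt_congr hx', hc]
          · exact (h x (not_or.2 ⟨hx, hx'⟩)).symm
    have h2 : (∀ x, s.labelAt x = if D.Conn s.res x (D.crossing k).c then .one else .X) ↔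
        U ∧ s.labelAt (D.crossing k).a = .X ∧ s.labelAt (D.crossing k).c = .one := by
      refine ⟨fun h => ⟨fun x hx => ?_, ?_, ?_⟩, fun ⟨h, ha, hc⟩ x => ?_⟩
      · rw [h, if_neg fun h' => hx (Or.inr h')]
      · rw [h, if_neg hac]
      · rw [h, if_pos (Conn.refl _ _)]
      · split_ifs with hx
        · rw [State.labelAt_congr hx, hc]
        · by_cases hx' : D.Conn s.res x (D.crossing k).a
          · rw [State.labelAt_congr hx', ha]
          · exact (h x (not_or.2 ⟨hx', hx⟩)).symm
    rw [h1, h2]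
    by_cases hU' : U
    · rcases label_eq_one_or (s.labelAt (D.crossing k).a) with h | h <;>
        rcases label_eq_one_or (s.labelAt (D.crossing k).c) with h' | h' <;>
        simp [hU', h, h', Label.mulCoeff]
    · simp [hU']
  rw [edgeMap_apply]
  simp only [key, add_mul, ite_mul, one_mul, zero_mul, Finset.sum_add_distrib, Finset.sum_ite_eq',
    Finset.mem_univ, if_true]

open Classical in
/-- The transpose of `Δ` sends the duals of `1 ⊗ X` and of `X ⊗ 1` to the dual of `1`, and the dual
of `X ⊗ X` to the dual of `X`. -/
theorem edgeMap_allX_set (hD : D.IsPlanar) {k : Fin D.n} {ε : Fin D.n → Bool} (hk : ε k = false)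
    (hac : D.Conn ε (D.crossing k).a (D.crossing k).c) (x : D.Edge) (z : D.State → ℤ) :
    D.edgeMap k z ((D.allX (Function.update ε k true)).set x .one) =
      z ((D.allX ε).set x .one) := by
  have key : ∀ s, D.cubeCoeff k s ((D.allX (Function.update ε k true)).set x .one) =
      if s = (D.allX ε).set x .one then 1 else 0 := by
    intro s
    by_cases hs : s.res = ε
    swap
    · rw [cubeCoeff_of_res_ne hk rfl hs, if_neg fun h => hs (by rw [h]; rfl)]
    subst hs
    have hac' : ¬ D.Conn (Function.update s.res k true) (D.crossing k).a (D.crossing k).c := by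
      rw [hD _ _ hk]; exact not_not.2 hac
    have hoff : ∀ l, l ≠ k → s.res l = Function.update s.res k true l := fun l hl =>
      (Function.update_of_ne hl _ _).symm
    have hconn := fun y => conn_iff_of_conn (x := y) (y := x) hoff hac
    have htouch := fun y => touch_iff_of_conn (x := y) hoff hac
    have hsame : ∀ y, D.Touch s.res k y → D.Conn s.res y (D.crossing k).a := fun y hy =>
      hy.elim id fun h => h.trans hac.symm
    rw [cubeCoeff, if_pos ⟨hk, rfl⟩, edgeCoeff_split hac hac', eq_allX_set_iff]
    change (if ∀ y, ¬ D.Touch s.res k y →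
        (if D.Conn (Function.update s.res k true) y x then Label.one else .X) = s.labelAt y then
      Label.comulCoeff (s.labelAt (D.crossing k).a)
        (if D.Conn (Function.update s.res k true) (D.crossing k).a x then .one else .X)
        (if D.Conn (Function.update s.res k true) (D.crossing k).c x then .one else .X) else 0) = _
    have hU : (∀ y, ¬ D.Touch s.res k y →
        (if D.Conn (Function.update s.res k true) y x then Label.one else .X) = s.labelAt y) ↔
        ∀ y, ¬ D.Touch s.res k y → s.labelAt y = if D.Conn s.res y x then .one else .X := by
      refine forall_congr' fun y => imp_congr_right fun hy => ?_
      have : D.Conn (Function.update s.res k true) y x ↔ D.Conn s.res y x := by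
        rw [hconn, ← htouch, ← htouch]
        tauto
      simp only [this, eq_comm]
    have hall : (∀ y, s.labelAt y = if D.Conn s.res y x then .one else .X) ↔
        (∀ y, ¬ D.Touch s.res k y → s.labelAt y = if D.Conn s.res y x then .one else .X) ∧
        s.labelAt (D.crossing k).a = if D.Conn s.res (D.crossing k).a x then .one else .X := by
      refine ⟨fun h => ⟨fun y _ => h y, h _⟩, fun ⟨h, ha⟩ y => ?_⟩
      by_cases hy : D.Touch s.res k y
      · have h1 := hsame y hy
        have h2 : D.Conn s.res y x ↔ D.Conn s.res (D.crossing k).a x := ⟨h1.symm.trans, h1.trans⟩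
        simp only [State.labelAt_congr h1, ha, h2]
      · exact h y hy
    have hcoeff : Label.comulCoeff (s.labelAt (D.crossing k).a)
        (if D.Conn (Function.update s.res k true) (D.crossing k).a x then .one else .X)
        (if D.Conn (Function.update s.res k true) (D.crossing k).c x then .one else .X) =
        if s.labelAt (D.crossing k).a = if D.Conn s.res (D.crossing k).a x then .one else .X
        then 1 else 0 := by
      by_cases hx : D.Touch s.res k x
      · rw [if_pos (hsame x hx).symm]
        rcases (htouch x).1 hx with h | h
        · rw [if_pos h.symm, if_neg fun h' => hac' (h'.trans h).symm]
          rcases label_eq_one_or (s.labelAt (D.crossing k).a) with h | h <;>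
            simp [h, Label.comulCoeff]
        · rw [if_neg fun h' => hac' (h'.trans h), if_pos h.symm]
          rcases label_eq_one_or (s.labelAt (D.crossing k).a) with h | h <;>
            simp [h, Label.comulCoeff]
      · rw [if_neg (show ¬ D.Conn s.res (D.crossing k).a x from fun h => hx (Or.inl h.symm))]
        rw [htouch] at hx
        rw [if_neg fun h => hx (Or.inl h.symm), if_neg fun h => hx (Or.inr h.symm)]
        rcases label_eq_one_or (s.labelAt (D.crossing k).a) with h | h <;>
          simp [h, Label.comulCoeff]
    rw [hcoeff, hall, hU]
    split_ifs <;> first | rfl | (exfalso; tauto)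
  rw [edgeMap_apply]
  simp only [key, ite_mul, one_mul, zero_mul, Finset.sum_ite_eq', Finset.mem_univ, if_true]

end LinkDiagram

namespace BraidWord

open LinkDiagram

variable {p q : ℕ}

/-! ### The first six letters in the first two columns -/

/-- The number of the `g`-th letter that lies in the first two columns. -/
def letterIndex (p g : ℕ) : ℕ := g / 2 * (p - 1) + g % 2

theorem letterIndex_strictMono (hp : 3 ≤ p) : StrictMono (letterIndex p) := by
  refine strictMono_nat_of_lt_succ fun g => ?_
  unfold letterIndex
  rcases Nat.mod_two_eq_zero_or_one g with h | h
  · have h1 : (g + 1) / 2 = g / 2 := by omega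
    rw [h1]; omega
  · have h1 : (g + 1) / 2 = g / 2 + 1 := by omega
    rw [h1, Nat.succ_mul]; omega

theorem letterIndex_lt (hp : 3 ≤ p) (hq : 3 ≤ q) {g : ℕ} (hg : g < 6) :
    letterIndex p g < (torus p q).length := by
  refine ((letterIndex_strictMono hp).monotone (show g ≤ 5 by omega)).trans_lt ?_
  have h : letterIndex p 5 = 2 * (p - 1) + 1 := rfl
  rw [h, length_torus]
  have := Nat.mul_le_mul_right (p - 1) hq
  omega

/-- The `g`-th letter that lies in the first two columns, for `g < 6`. -/
def letter (hp : 3 ≤ p) (hq : 3 ≤ q) (g : Fin 6) : Fin (torus p q).closure.n :=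
  ⟨letterIndex p g, letterIndex_lt hp hq g.2⟩

section Letters

variable (hp : 3 ≤ p) (hq : 3 ≤ q)

theorem row_letter (g : Fin 6) : row (letter hp hq g) = g / 2 := by
  show ((g : ℕ) / 2 * (p - 1) + g % 2) / (p - 1) = g / 2
  rw [mul_comm, Nat.mul_add_div (by omega), Nat.div_eq_of_lt (show (g : ℕ) % 2 < p - 1 by omega),
    add_zero]

theorem col_letter (g : Fin 6) : col (torus p q) (letter hp hq g) = g % 2 := by
  rw [col_torus]
  show ((g : ℕ) / 2 * (p - 1) + g % 2) % (p - 1) = g % 2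
  rw [mul_comm, Nat.mul_add_mod, Nat.mod_eq_of_lt (by omega)]

theorem exists_letter {r : Fin (torus p q).closure.n} (hr : r ∈ firstSix p q) :
    ∃ g : Fin 6, r = letter hp hq g ∧ 2 * row r + col (torus p q) r = g := by
  obtain ⟨h1, h2⟩ := hr
  refine ⟨⟨_, h2⟩, crossing_ext ?_ ?_, rfl⟩
  · rw [row_letter]; show _ = (2 * row r + col (torus p q) r) / 2; omega
  · rw [col_letter]; show _ = (2 * row r + col (torus p q) r) % 2; omega

theorem position_letter (g : Fin 6) :
    2 * row (letter hp hq g) + col (torus p q) (letter hp hq g) = g := by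
  rw [row_letter, col_letter]; omega

theorem letter_mem (g : Fin 6) : letter hp hq g ∈ firstSix p q :=
  ⟨by rw [col_letter]; omega, by rw [position_letter]; exact g.2⟩

end Letters

/-- The resolution that has `1`-resolutions at those of the first six letters in the first two
columns that are given by the binary digits of `m`. -/
def sixRes (p q m : ℕ) : Fin (torus p q).closure.n → Bool := fun r =>
  decide (col (torus p q) r ≤ 1 ∧ 2 * row r + col (torus p q) r < 6) &&
    m.testBit (2 * row r + col (torus p q) r)

section Letters

variable (hp : 3 ≤ p) (hq : 3 ≤ q) {m : ℕ}

theorem mem_firstSix_of_sixRes {r : Fin (torus p q).closure.n} (hr : sixRes p q m r = true) :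
    r ∈ firstSix p q := by
  simp only [sixRes, Bool.and_eq_true, decide_eq_true_eq] at hr
  exact hr.1

theorem inBox_sixRes (p q m : ℕ) : (torus p q).closure.InBox ∅ (firstSix p q) (sixRes p q m) :=
  ⟨fun _ h => h.elim, fun _ hr => mem_firstSix_of_sixRes hr⟩

theorem sixRes_letter (g : Fin 6) : sixRes p q m (letter hp hq g) = m.testBit g := by
  have := letter_mem hp hq g
  unfold sixRes
  rw [position_letter, decide_eq_true ⟨this.1, g.2⟩, Bool.true_and]

theorem sixRes_flip {g : Fin 6} (hg : m.testBit g = true) :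
    Function.update (sixRes p q (m ^^^ 2 ^ (g : ℕ))) (letter hp hq g) true = sixRes p q m := by
  ext r
  by_cases hr : r = letter hp hq g
  · rw [hr, Function.update_self, sixRes_letter, hg]
  · rw [Function.update_of_ne hr]
    unfold sixRes
    by_cases hr' : col (torus p q) r ≤ 1 ∧ 2 * row r + col (torus p q) r < 6
    · obtain ⟨g', rfl, h⟩ := exists_letter hp hq hr'
      have hne : (g : ℕ) ≠ g' := fun h => hr (by rw [Fin.ext h])
      rw [h, Nat.testBit_xor, Nat.testBit_two_pow_of_ne hne, Bool.xor_false]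
    · rw [decide_eq_false hr']; rfl

theorem sixRes_flip_letter {g : Fin 6} (hg : m.testBit g = true) :
    sixRes p q (m ^^^ 2 ^ (g : ℕ)) (letter hp hq g) = false := by
  rw [sixRes_letter, Nat.testBit_xor, hg, Nat.testBit_two_pow_self]; rfl

/-- The sign of the edge of the cube in the direction of the `g`-th letter. -/
def sixSign (m : ℕ) : ℕ → ℤ
  | 0 => 1
  | g + 1 => if m.testBit g then -sixSign m g else sixSign m g

theorem cubeSign_sixRes (g : Fin 6) :
    cubeSign (D := (torus p q).closure) (sixRes p q m) (letter hp hq g) = sixSign m g := by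
  have hcard : (Finset.univ.filter fun l => l < letter hp hq g ∧ sixRes p q m l = true).card =
      ((Finset.range g).filter fun i => m.testBit i = true).card := by
    refine Finset.card_nbij' (fun l => 2 * row l + col (torus p q) l)
      (fun i => letter hp hq (Fin.ofNat 6 i)) ?_ ?_ ?_ ?_
    · intro l hl
      simp only [Finset.coe_filter, Finset.mem_univ, true_and, Set.mem_ofPred_eq] at hl
      obtain ⟨g', rfl, h⟩ := exists_letter hp hq (mem_firstSix_of_sixRes hl.2)
      have h2 := hl.2
      rw [sixRes_letter] at h2
      simp only [Finset.coe_filter, Finset.mem_range, Set.mem_ofPred_eq, h, h2, and_true]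
      exact (letterIndex_strictMono hp).lt_iff_lt.1 hl.1
    · intro i hi
      simp only [Finset.coe_filter, Finset.mem_range, Set.mem_ofPred_eq] at hi
      have h6 : i % 6 = i := Nat.mod_eq_of_lt (by omega)
      simp only [Finset.coe_filter, Finset.mem_univ, true_and, Set.mem_ofPred_eq, sixRes_letter,
        Fin.val_ofNat, h6, hi.2, and_true]
      refine (letterIndex_strictMono hp).lt_iff_lt.2 ?_
      rw [Fin.val_ofNat, h6]
      exact hi.1
    · intro l hl
      simp only [Finset.coe_filter, Finset.mem_univ, true_and, Set.mem_ofPred_eq] at hl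
      obtain ⟨g', rfl, h⟩ := exists_letter hp hq (mem_firstSix_of_sixRes hl.2)
      simp only [h, Fin.ofNat_val_eq_self]
    · intro i hi
      simp only [Finset.coe_filter, Finset.mem_range, Set.mem_ofPred_eq] at hi
      simp only [position_letter, Fin.val_ofNat]
      exact Nat.mod_eq_of_lt (by omega)
  unfold cubeSign
  rw [hcard]
  generalize (g : ℕ) = i
  induction i with
  | zero => rfl
  | succ i ih =>
    rw [Finset.range_add_one, Finset.filter_insert, sixSign]
    split_ifs with h
    · rw [Finset.card_insert_of_notMem (by simp), pow_succ, ih, mul_neg_one]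
    · exact ih

theorem edgeMap_apply_of_false {D : LinkDiagram} {k : Fin D.n} {t : D.State} (h : t.res k = false)
    (z : D.State → ℤ) : D.edgeMap k z t = 0 := by
  rw [edgeMap_apply]
  refine Finset.sum_eq_zero fun s _ => ?_
  rw [cubeCoeff, if_neg, zero_mul]
  rintro ⟨-, h2⟩
  rw [h2, Function.update_self] at h
  cases h

theorem letter_injective : Function.Injective (letter hp hq) := fun g g' h =>
  Fin.ext (by rw [← position_letter hp hq g, h, position_letter])

/-- On states that use the first six letters only, the other crossings do not contribute. -/
theorem differential_eq_sum_letter (z : (torus p q).closure.State → ℤ)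
    {t : (torus p q).closure.State} (ht : (torus p q).closure.InBox ∅ (firstSix p q) t.res) :
    (torus p q).closure.differential z t = ∑ g : Fin 6, cubeSign t.res (letter hp hq g) *
      (torus p q).closure.edgeMap (letter hp hq g) z t := by
  rw [differential_eq_sum_edgeMap, ← Finset.sum_image (s := Finset.univ) (g := letter hp hq)
    (f := fun k => cubeSign t.res k * (torus p q).closure.edgeMap k z t)
    fun _ _ _ _ h => letter_injective hp hq h]
  refine (Finset.sum_subset (Finset.subset_univ _) fun k _ hk => ?_).symm
  rw [edgeMap_apply_of_false, mul_zero]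
  refine Bool.eq_false_iff.2 fun h => hk ?_
  obtain ⟨g, rfl, -⟩ := exists_letter hp hq (ht.2 k h)
  exact Finset.mem_image_of_mem _ (Finset.mem_univ g)

end Letters

/-! ### Following the circles -/

/-- The first level after the `g - 1`-st letter in the first two columns. -/
def gapLevel (p g : ℕ) : ℕ := if g = 0 then 0 else letterIndex p (g - 1) + 1

section Points

variable (hp : 3 ≤ p) (hq : 3 ≤ q) {m : ℕ}

/-- The strand at the position `n % 3` between the letters `n / 3 - 1` and `n / 3` in the first two
columns. -/
def point (hp : 3 ≤ p) (q n : ℕ) : (torus p q).closure.Edge :=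
  edge (torus p q) (Fin.ofNat _ (gapLevel p (n / 3)))
    ⟨n % 3, (Nat.mod_lt _ (by norm_num)).trans_le hp⟩

theorem pos_point (n : ℕ) : pos (point hp q n) = n % 3 := rfl

include hq in
theorem lev_point {n : ℕ} (hn : n < 18) : lev (point hp q n) = gapLevel p (n / 3) := by
  refine Nat.mod_eq_of_lt ?_
  unfold gapLevel
  split_ifs
  · omega
  · have := letterIndex_lt hp hq (g := n / 3 - 1) (by omega)
    omega

include hp hq in
theorem conn_sixRes_of_pos_eq {e f : (torus p q).closure.Edge} (hpos : pos e = pos f)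
    (hl : lev e ≤ lev f)
    (h : ∀ g : ℕ, lev e ≤ letterIndex p g → letterIndex p g < lev f → 6 ≤ g) :
    (torus p q).closure.Conn (sixRes p q m) e f := by
  refine conn_of_pos_eq (isPositive_torus p q) hpos (fun k hk hk' hkε => ?_) hl
  obtain ⟨g, rfl, -⟩ := exists_letter hp hq (mem_firstSix_of_sixRes hkε)
  have := h g hk hk'
  omega

include hq in
theorem conn_before_letter {g : Fin 6} {e f : (torus p q).closure.Edge} (hpos : pos e = pos f)
    (he : gapLevel p g ≤ lev e) (hl : lev e ≤ lev f) (hf : lev f ≤ letter hp hq g) :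
    (torus p q).closure.Conn (sixRes p q m) e f := by
  refine conn_sixRes_of_pos_eq hp hq hpos hl fun g' h1 h2 => ?_
  have h3 : g' < g := (letterIndex_strictMono hp).lt_iff_lt.1 (h2.trans_le hf)
  unfold gapLevel at he
  split_ifs at he with h0
  · omega
  · have : (g : ℕ) - 1 < g' := (letterIndex_strictMono hp).lt_iff_lt.1 (by omega)
    omega

include hq in
theorem conn_after_letter {g : Fin 6} {e f : (torus p q).closure.Edge} (hpos : pos e = pos f)
    (he : lev e = letter hp hq g + 1) (hf : lev f = gapLevel p ((g + 1) % 6)) :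
    (torus p q).closure.Conn (sixRes p q m) e f := by
  by_cases hg : (g : ℕ) = 5
  · obtain ⟨e', h1, h2⟩ := exists_edge (w := torus p q) le_rfl (pos_lt e)
    have he5 : (letter hp hq g : ℕ) = letterIndex p 5 := by rw [← hg]; rfl
    refine (conn_sixRes_of_pos_eq hp hq h2.symm (by rw [h1]; exact lev_le e)
      fun g' h3 h4 => ?_).trans (conn_close h1 (by rw [hf, hg]; rfl) (by omega))
    exact (letterIndex_strictMono hp).lt_iff_lt.1 (by omega)
  · rw [Nat.mod_eq_of_lt (by omega)] at hf
    exact edge_ext (e := e) (f := f) (he.trans hf.symm) hpos ▸ Conn.refl _ _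

theorem conn_point_c (g : Fin 6) : (torus p q).closure.Conn (sixRes p q m)
    (point hp q (3 * g + g % 2)) ((torus p q).closure.crossing (letter hp hq g)).c := by
  have hw := isPositive_torus p q
  have h3 : (3 * (g : ℕ) + g % 2) / 3 = g := by omega
  have hl := lev_point hp hq (n := 3 * g + g % 2) (by omega)
  rw [h3] at hl
  have hc := lev_c hw (letter hp hq g)
  refine conn_before_letter hp hq (g := g) ?_ hl.ge ?_ hc.le
  · rw [pos_point, pos_c hw, col_letter]; omega
  · rw [hc, hl]
    unfold gapLevel
    split_ifs
    · omega
    · exact letterIndex_strictMono hp (by omega)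

theorem conn_point_b (g : Fin 6) : (torus p q).closure.Conn (sixRes p q m)
    (point hp q (3 * g + g % 2 + 1)) ((torus p q).closure.crossing (letter hp hq g)).b := by
  have hw := isPositive_torus p q
  have h3 : (3 * (g : ℕ) + g % 2 + 1) / 3 = g := by omega
  have hl := lev_point hp hq (n := 3 * g + g % 2 + 1) (by omega)
  rw [h3] at hl
  have hc := lev_b hw (letter hp hq g)
  refine conn_before_letter hp hq (g := g) ?_ hl.ge ?_ hc.le
  · rw [pos_point, pos_b hw, col_letter]; omega
  · rw [hc, hl]
    unfold gapLevel
    split_ifs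
    · omega
    · exact letterIndex_strictMono hp (by omega)

theorem conn_point_a (g : Fin 6) : (torus p q).closure.Conn (sixRes p q m)
    (point hp q (3 * ((g + 1) % 6) + g % 2 + 1))
    ((torus p q).closure.crossing (letter hp hq g)).a := by
  have hw := isPositive_torus p q
  refine (conn_after_letter hp hq (g := g) ?_ (lev_a hw _) ?_).symm
  · rw [pos_point, pos_a hw, col_letter]; omega
  · rw [lev_point hp hq (by omega)]; congr 1; omega

theorem conn_point_d (g : Fin 6) : (torus p q).closure.Conn (sixRes p q m)
    (point hp q (3 * ((g + 1) % 6) + g % 2))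
    ((torus p q).closure.crossing (letter hp hq g)).d := by
  have hw := isPositive_torus p q
  refine (conn_after_letter hp hq (g := g) ?_ (lev_d hw _) ?_).symm
  · rw [pos_point, pos_d hw, col_letter]; omega
  · rw [lev_point hp hq (by omega)]; congr 1; omega

include hq in
theorem exists_conn_point {e : (torus p q).closure.Edge} (he : pos e < 3) :
    ∃ n < 18, (torus p q).closure.Conn (sixRes p q m) (point hp q n) e := by
  have key : ∀ g : ℕ, g < 6 → lev e ≤ letterIndex p g →
      ∃ n < 18, (torus p q).closure.Conn (sixRes p q m) (point hp q n) e := by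
    intro g
    induction g with
    | zero =>
      intro _ h
      refine ⟨pos e, by omega, conn_before_letter hp hq (g := 0) ?_ ?_ ?_ h⟩
      · rw [pos_point]; omega
      · exact Nat.zero_le _
      · rw [lev_point hp hq (by omega), Nat.div_eq_of_lt he]; exact Nat.zero_le _
    | succ g ih =>
      intro hg h
      by_cases h' : lev e ≤ letterIndex p g
      · exact ih (by omega) h'
      · have hl := lev_point hp hq (n := 3 * (g + 1) + pos e) (by omega)
        rw [show (3 * (g + 1) + pos e) / 3 = g + 1 by omega] at hl
        refine ⟨3 * (g + 1) + pos e, by omega,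
          conn_before_letter hp hq (g := ⟨g + 1, hg⟩) ?_ hl.ge ?_ h⟩
        · rw [pos_point]; omega
        · rw [hl]; show letterIndex p g + 1 ≤ _; omega
  by_cases h : lev e ≤ letterIndex p 5
  · exact key 5 (by norm_num) h
  · obtain ⟨e', h1, h2⟩ := exists_edge (w := torus p q) le_rfl (pos_lt e)
    refine ⟨pos e, by omega, (Conn.trans (conn_sixRes_of_pos_eq hp hq h2.symm
      (by rw [h1]; exact lev_le e) fun g' h3 h4 => ?_) (conn_close h1 ?_ ?_)).symm⟩
    · exact (letterIndex_strictMono hp).lt_iff_lt.1 (by omega)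
    · rw [lev_point hp hq (by omega), Nat.div_eq_of_lt he]; rfl
    · rw [pos_point]; omega

end Points

/-- The point that follows the point `n` on its circle. Strands at even positions are followed
towards increasing levels, the other ones towards decreasing levels. -/
def next (m n : ℕ) : ℕ :=
  if n % 3 = 1 then
    if m.testBit ((n / 3 + 5) % 6) then 3 * (n / 3) + 2 * ((n / 3 + 5) % 2)
    else 3 * ((n / 3 + 5) % 6) + 1
  else if m.testBit (n / 3) ∧ (n % 3 = n / 3 % 2 ∨ n % 3 = n / 3 % 2 + 1) then 3 * (n / 3) + 1
  else 3 * ((n / 3 + 1) % 6) + n % 3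

theorem next_lt {m n : ℕ} (hn : n < 18) : next m n < 18 := by
  unfold next
  split_ifs <;> omega

section Points

variable (hp : 3 ≤ p) (hq : 3 ≤ q) {m : ℕ}

include hq in
theorem conn_point_vertical (g : Fin 6) {x : ℕ} (hx : x < 3)
    (h : m.testBit g = true → x ≠ g % 2 ∧ x ≠ g % 2 + 1) :
    (torus p q).closure.Conn (sixRes p q m) (point hp q (3 * g + x))
      (point hp q (3 * ((g + 1) % 6) + x)) := by
  have hw := isPositive_torus p q
  have hlt := letterIndex_lt hp hq g.2
  have hle : gapLevel p g ≤ letter hp hq g := by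
    unfold gapLevel
    split_ifs
    · omega
    · exact letterIndex_strictMono hp (by omega)
  have hl := lev_point hp hq (n := 3 * g + x) (by omega)
  rw [show (3 * (g : ℕ) + x) / 3 = g by omega] at hl
  have hl' := lev_point hp hq (n := 3 * ((g + 1) % 6) + x) (by omega)
  rw [show (3 * (((g : ℕ) + 1) % 6) + x) / 3 = (g + 1) % 6 by omega] at hl'
  obtain ⟨e, he, he'⟩ := exists_edge (w := torus p q) (i := letter hp hq g) (x := x) hlt.le
    (by omega)
  obtain ⟨f, hf, hf'⟩ := exists_edge (w := torus p q) (i := letter hp hq g + 1) (x := x) hlt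
    (by omega)
  refine (conn_before_letter hp hq (g := g) ?_ hl.ge (by omega) he.le).trans
    ((conn_vertical hw he hf (by omega) fun hk => ?_).trans
      (conn_after_letter hp hq (g := g) ?_ hf hl'))
  · rw [pos_point]; omega
  · rw [sixRes_letter] at hk
    rw [col_letter, he']
    exact h hk
  · rw [pos_point]; omega

include hq in
theorem conn_point_next {n : ℕ} (hn : n < 18) :
    (torus p q).closure.Conn (sixRes p q m) (point hp q n) (point hp q (next m n)) := by
  unfold next
  split_ifs with h1 h2 h2
  · obtain ⟨g, hg⟩ : ∃ g : Fin 6, (g : ℕ) = (n / 3 + 5) % 6 :=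
      ⟨⟨_, Nat.mod_lt _ (by norm_num)⟩, rfl⟩
    rw [← hg] at h2
    have h := conn_ad (D := (torus p q).closure) ((sixRes_letter hp hq g).trans h2)
    have key := ((conn_point_a hp hq g).trans h).trans (conn_point_d hp hq g).symm
    rcases Nat.mod_two_eq_zero_or_one g with h0 | h0
    · rw [show 3 * (((g : ℕ) + 1) % 6) + g % 2 + 1 = n by omega] at key
      rwa [show 3 * (((g : ℕ) + 1) % 6) + g % 2 = 3 * (n / 3) + 2 * ((n / 3 + 5) % 2) by omega]
        at key
    · rw [show 3 * (((g : ℕ) + 1) % 6) + g % 2 + 1 = 3 * (n / 3) + 2 * ((n / 3 + 5) % 2) by omega,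
        show 3 * (((g : ℕ) + 1) % 6) + g % 2 = n by omega] at key
      exact key.symm
  · obtain ⟨g, hg⟩ : ∃ g : Fin 6, (g : ℕ) = (n / 3 + 5) % 6 :=
      ⟨⟨_, Nat.mod_lt _ (by norm_num)⟩, rfl⟩
    rw [← hg] at h2 ⊢
    have := conn_point_vertical hp hq (m := m) g (x := 1) (by norm_num) fun h => absurd h h2
    rw [show 3 * (((g : ℕ) + 1) % 6) + 1 = n by omega] at this
    exact this.symm
  · obtain ⟨g, hg⟩ : ∃ g : Fin 6, (g : ℕ) = n / 3 := ⟨⟨_, by omega⟩, rfl⟩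
    rw [← hg] at h2 ⊢
    have h := conn_bc (D := (torus p q).closure) ((sixRes_letter hp hq g).trans h2.1)
    have key := ((conn_point_b hp hq g).trans h).trans (conn_point_c hp hq g).symm
    rcases h2.2 with h0 | h0
    · rw [show 3 * (g : ℕ) + g % 2 + 1 = 3 * g + 1 by omega,
        show 3 * (g : ℕ) + g % 2 = n by omega] at key
      exact key.symm
    · rwa [show 3 * (g : ℕ) + g % 2 + 1 = n by omega,
        show 3 * (g : ℕ) + g % 2 = 3 * g + 1 by omega] at key
  · obtain ⟨g, hg⟩ : ∃ g : Fin 6, (g : ℕ) = n / 3 := ⟨⟨_, by omega⟩, rfl⟩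
    rw [← hg] at h2 ⊢
    have := conn_point_vertical hp hq (m := m) g (x := n % 3) (by omega) fun h =>
      not_or.1 fun h' => h2 ⟨h, h'⟩
    rwa [show 3 * (g : ℕ) + n % 3 = n by omega] at this

/-- Whether the point `n'` is reached from `n` in at most the given number of steps. -/
def reaches (m : ℕ) : ℕ → ℕ → ℕ → Bool
  | 0, n, n' => n == n'
  | i + 1, n, n' => n == n' || reaches m i (next m n) n'

/-- The least among the given number of points following `n`. -/
def least (m : ℕ) : ℕ → ℕ → ℕ
  | 0, n => n
  | i + 1, n => min n (least m i (next m n))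

include hq in
theorem conn_of_reaches {i n n' : ℕ} (hn : n < 18) (h : reaches m i n n' = true) :
    (torus p q).closure.Conn (sixRes p q m) (point hp q n) (point hp q n') := by
  induction i generalizing n with
  | zero =>
    rw [beq_iff_eq.1 h]
  | succ i ih =>
    rcases (Bool.or_eq_true _ _).mp h with h | h
    · rw [beq_iff_eq.1 h]
    · exact (conn_point_next hp hq hn).trans (ih (next_lt hn) h)

include hq in
theorem conn_least (i : ℕ) {n : ℕ} (hn : n < 18) :
    (torus p q).closure.Conn (sixRes p q m) (point hp q n) (point hp q (least m i n)) := by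
  induction i generalizing n with
  | zero => exact Conn.refl _ _
  | succ i ih =>
    unfold least
    rcases min_choice n (least m i (next m n)) with h | h <;> rw [h]
    exact (conn_point_next hp hq hn).trans (ih (next_lt hn))

end Points

/-! ### A cocycle on the states of the first six letters -/

/-- The state with the label `X` everywhere, except for the label `1` on the circle of a given
point. -/
noncomputable def pointState (hp : 3 ≤ p) (q m : ℕ) : Option ℕ → (torus p q).closure.State
  | none => (torus p q).closure.allX (sixRes p q m)
  | some n => ((torus p q).closure.allX (sixRes p q m)).set (point hp q n) .one

/-- A list of coefficients, resolutions and points encodes a functional on chains. -/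
noncomputable def pairing (hp : 3 ≤ p) (q : ℕ) (l : List (ℤ × ℕ × Option ℕ))
    (z : (torus p q).closure.State → ℤ) : ℤ :=
  (l.map fun u => u.1 * z (pointState hp q u.2.1 u.2.2)).sum

/-- The part in the direction `g` of the transposed differential of an element of such a list. The
transpose of a merging map sends `X` to `X ⊗ 1 + 1 ⊗ X` in the dual basis, the transpose of a
splitting map sends `1 ⊗ X` to `1` and `X ⊗ X` to `X`. -/
def coface (u : ℤ × ℕ × Option ℕ) (g : ℕ) : List (ℤ × ℕ × Option ℕ) :=
  if u.2.1.testBit g then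
    match u.2.2 with
    | none => [(u.1 * sixSign u.2.1 g, u.2.1 ^^^ 2 ^ g,
          some (least (u.2.1 ^^^ 2 ^ g) 18 (3 * ((g + 1) % 6) + g % 2 + 1))),
        (u.1 * sixSign u.2.1 g, u.2.1 ^^^ 2 ^ g,
          some (least (u.2.1 ^^^ 2 ^ g) 18 (3 * g + g % 2)))]
    | some n => [(u.1 * sixSign u.2.1 g, u.2.1 ^^^ 2 ^ g, some (least (u.2.1 ^^^ 2 ^ g) 18 n))]
  else []

/-- The assumption under which `coface` is correct: with the label `X` everywhere the letter `g`
merges circles, and with one label `1` it splits a circle. -/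
def cofaceOK (u : ℤ × ℕ × Option ℕ) (g : ℕ) : Bool :=
  !u.2.1.testBit g ||
    match u.2.2 with
    | none => reaches u.2.1 18 (3 * ((g + 1) % 6) + g % 2 + 1) (3 * g + g % 2)
    | some n => decide (n < 18) &&
      reaches (u.2.1 ^^^ 2 ^ g) 18 (3 * ((g + 1) % 6) + g % 2 + 1) (3 * g + g % 2)

/-- The cocycle. Its summands with four cyclically consecutive `1`-resolutions have one circle, the
other ones have three circles, two of which are small, on the first three strands. -/
def cocycle : List (ℤ × ℕ × Option ℕ) :=
  [(1, 0b111100, none), (1, 0b110110, some 1), (1, 0b110110, some 9), (1, 0b011110, none),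
    (-1, 0b111001, none), (-1, 0b101101, some 3), (-1, 0b101101, some 13), (1, 0b110011, none),
    (1, 0b011011, some 0), (1, 0b011011, some 7), (-1, 0b100111, none), (1, 0b001111, none)]

theorem list_sum_eq_zero_of_cancel {β : Type*} [DecidableEq β] (l : List (ℤ × β)) (f : β → ℤ)
    (h : ∀ u ∈ l, ((l.filter fun v => v.2 = u.2).map fun v => v.1).sum = 0) :
    (l.map fun u => u.1 * f u.2).sum = 0 := by
  have key : ∀ (l : List (ℤ × β)) (K : Finset β), (∀ u ∈ l, u.2 ∈ K) →
      (l.map fun u => u.1 * f u.2).sum =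
        ∑ κ ∈ K, ((l.filter fun v => v.2 = κ).map fun v => v.1).sum * f κ := by
    intro l K
    induction l with
    | nil => simp
    | cons u l ih =>
      intro hK
      have hu := hK u (by simp)
      rw [List.map_cons, List.sum_cons, ih fun v hv => hK v (List.mem_cons_of_mem _ hv),
        ← Finset.sum_ite_eq K u.2 (fun κ => u.1 * f κ) |>.trans (if_pos hu),
        ← Finset.sum_add_distrib]
      refine Finset.sum_congr rfl fun κ _ => ?_
      by_cases hκ : u.2 = κ
      · rw [if_pos hκ, List.filter_cons_of_pos (by simpa using hκ), List.map_cons, List.sum_cons,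
          add_mul]
      · rw [if_neg hκ, List.filter_cons_of_neg (by simpa using hκ), zero_add]
  rw [key l (l.map Prod.snd).toFinset fun u hu => by
    rw [List.mem_toFinset]; exact List.mem_map_of_mem hu]
  refine Finset.sum_eq_zero fun κ hκ => ?_
  rw [List.mem_toFinset, List.mem_map] at hκ
  obtain ⟨u, hu, rfl⟩ := hκ
  rw [h u hu, zero_mul]

theorem cocycle_cofaceOK : ∀ u ∈ cocycle, ∀ g < 6, cofaceOK u g = true := by decide

/-- The coefficients of the transposed differential of `cocycle` cancel. Circles are compared by
their least points. -/
theorem cocycle_cancel :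
    ∀ u ∈ cocycle.flatMap fun u => (List.finRange 6).flatMap fun g => coface u g,
    (((cocycle.flatMap fun u => (List.finRange 6).flatMap fun g => coface u g).filter
      fun v => v.2 = u.2).map fun v => v.1).sum = 0 := by
  decide +kernel

section Pairing

variable (hp : 3 ≤ p) (hq : 3 ≤ q) {z : (torus p q).closure.State → ℤ}

theorem pairing_flatMap {α : Type*} (l : List α) (f : α → List (ℤ × ℕ × Option ℕ)) :
    pairing hp q (l.flatMap f) z = (l.map fun x => pairing hp q (f x) z).sum := by
  induction l with
  | nil => rfl
  | cons x l ih =>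
    rw [List.flatMap_cons, List.map_cons, List.sum_cons, ← ih]
    simp [pairing]

theorem set_point_least {m n : ℕ} (hn : n < 18) (hq : 3 ≤ q) :
    pointState hp q m (some (least m 18 n)) =
      ((torus p q).closure.allX (sixRes p q m)).set (point hp q n) .one :=
  (State.set_congr (conn_least hp hq 18 hn) _).symm

theorem not_conn_of_reaches {m : ℕ} {g : Fin 6} (hg : m.testBit g = true)
    (h : reaches m 18 (3 * ((g + 1) % 6) + g % 2 + 1) (3 * g + g % 2) = true) :
    ¬ (torus p q).closure.Conn (sixRes p q (m ^^^ 2 ^ (g : ℕ)))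
      ((torus p q).closure.crossing (letter hp hq g)).a
      ((torus p q).closure.crossing (letter hp hq g)).c := by
  rw [← isPlanar_closure (isPositive_torus p q) _ _ (sixRes_flip_letter hp hq hg),
    sixRes_flip hp hq hg]
  exact (conn_point_a hp hq g).symm.trans
    ((conn_of_reaches hp hq (by omega) h).trans (conn_point_c hp hq g))

theorem conn_crossing_of_reaches {m : ℕ} (g : Fin 6)
    (h : reaches m 18 (3 * ((g + 1) % 6) + g % 2 + 1) (3 * g + g % 2) = true) :
    (torus p q).closure.Conn (sixRes p q m) ((torus p q).closure.crossing (letter hp hq g)).a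
      ((torus p q).closure.crossing (letter hp hq g)).c :=
  (conn_point_a hp hq g).symm.trans
    ((conn_of_reaches hp hq (by omega) h).trans (conn_point_c hp hq g))

theorem edgeMap_pointState (u : ℤ × ℕ × Option ℕ) (g : Fin 6) (h : cofaceOK u g = true) :
    u.1 * (cubeSign (pointState hp q u.2.1 u.2.2).res (letter hp hq g) *
      (torus p q).closure.edgeMap (letter hp hq g) z (pointState hp q u.2.1 u.2.2)) =
    pairing hp q (coface u g) z := by
  have hD := isPlanar_closure (isPositive_torus p q)
  obtain ⟨c, m, o⟩ := u
  have hres : (pointState hp q m o).res = sixRes p q m := by cases o <;> rfl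
  unfold coface
  unfold cofaceOK at h
  dsimp only at h ⊢
  rw [hres, cubeSign_sixRes]
  by_cases hg : m.testBit g = true
  swap
  · rw [if_neg hg, edgeMap_apply_of_false, mul_zero, mul_zero]
    · rfl
    · rw [hres, sixRes_letter]
      exact Bool.eq_false_iff.2 hg
  rw [hg, Bool.not_true, Bool.false_or] at h
  have hk := sixRes_flip_letter hp hq hg
  rw [if_pos hg]
  cases o with
  | none =>
    have := edgeMap_allX hk (not_conn_of_reaches hp hq hg h) z
    rw [sixRes_flip hp hq hg] at this
    change c * (_ * (torus p q).closure.edgeMap _ z ((torus p q).closure.allX (sixRes p q m))) = _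
    rw [this]
    simp only [pairing, List.map_cons, List.map_nil, List.sum_cons, List.sum_nil]
    rw [set_point_least hp (by omega) hq, set_point_least hp (by omega) hq,
      State.set_congr (s := (torus p q).closure.allX (sixRes p q (m ^^^ 2 ^ (g : ℕ))))
        (conn_point_a hp hq g),
      State.set_congr (s := (torus p q).closure.allX (sixRes p q (m ^^^ 2 ^ (g : ℕ))))
        (conn_point_c hp hq g)]
    ring
  | some n =>
    rw [Bool.and_eq_true, decide_eq_true_eq] at h
    have := edgeMap_allX_set hD hk (conn_crossing_of_reaches hp hq g h.2) (point hp q n) z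
    rw [sixRes_flip hp hq hg] at this
    change c * (_ * (torus p q).closure.edgeMap _ z
      (((torus p q).closure.allX (sixRes p q m)).set (point hp q n) .one)) = _
    rw [this]
    simp only [pairing, List.map_cons, List.map_nil, List.sum_cons, List.sum_nil]
    rw [set_point_least hp h.1 hq]
    ring

include hq in
/-- The functional given by `cocycle` vanishes on boundaries. -/
theorem pairing_cocycle_differential :
    pairing hp q cocycle ((torus p q).closure.differential z) = 0 := by
  have h1 : pairing hp q cocycle ((torus p q).closure.differential z) =
      pairing hp q (cocycle.flatMap fun u => (List.finRange 6).flatMap fun g => coface u g) z := by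
    rw [pairing_flatMap, pairing]
    refine congrArg List.sum (List.map_congr_left fun u hu => ?_)
    have hbox : (torus p q).closure.InBox ∅ (firstSix p q) (pointState hp q u.2.1 u.2.2).res := by
      cases u.2.2 <;> exact inBox_sixRes p q _
    rw [differential_eq_sum_letter hp hq z hbox, Finset.mul_sum, pairing_flatMap, Fin.sum_univ_def]
    exact congrArg List.sum (List.map_congr_left fun g _ =>
      edgeMap_pointState hp hq u g (cocycle_cofaceOK u hu g g.2))
  rw [h1]
  exact list_sum_eq_zero_of_cancel _ (fun k => z (pointState hp q k.1 k.2)) cocycle_cancel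

end Pairing

end BraidWord

namespace LinkDiagram

variable {D : LinkDiagram}

theorem qdeg_vac (ε : Fin D.n → Bool) :
    (D.vac ε).qdeg = Fintype.card (D.Circle ε) + (D.vac ε).height := by
  have : ∀ z, ((D.vac ε).label z).deg = 1 := fun z => by
    obtain ⟨x, rfl⟩ := exists_circ _ z
    rfl
  unfold State.qdeg
  simp only [this, Finset.sum_const, Finset.card_univ, nsmul_eq_mul, mul_one]
  rfl

open Classical in
theorem qdeg_vac_update (hD : D.IsPlanar) {ε : Fin D.n → Bool} {k : Fin D.n} (hk : ε k = false) :
    (D.vac (Function.update ε k true)).qdeg = (D.vac ε).qdeg +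
      if D.Conn ε (D.crossing k).a (D.crossing k).c then 2 else 0 := by
  have h := height_update (s := D.vac ε) (t := D.vac (Function.update ε k true)) hk rfl
  rw [qdeg_vac, qdeg_vac, card_circle_update hD hk, h]
  push_cast
  split_ifs <;> ring

theorem eq_vac_of_vacuum_ne_zero {ε : Fin D.n → Bool} {t : D.State} (h : D.vacuum ε t ≠ 0) :
    t = D.vac ε := by
  rw [vacuum_apply] at h
  exact eq_vac_iff.2 (by_contra fun h' => h (if_neg h'))

theorem mulX_mulX_edgeMap_vacuum {k : Fin D.n} {ε : Fin D.n → Bool} {e f : D.Edge}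
    (h : D.Conn (Function.update ε k true) e f) :
    D.mulX e (D.mulX f (D.edgeMap k (D.vacuum ε))) = 0 := by
  ext t
  by_cases ht : t.res = Function.update ε k true
  · exact mulX_mulX_of_conn_apply (by rwa [ht]) _
  · by_contra hne
    have h1 := (mulX_apply_ne_zero (mulX_apply_ne_zero hne).2).2
    rw [edgeMap_vacuum_apply, cubeCoeff, if_neg fun h => ht h.2] at h1
    exact h1 rfl

theorem mulX_mulX_vacuum_apply_of_res_ne {ε : Fin D.n → Bool} {e f : D.Edge} {t : D.State}
    (h : t.res ≠ ε) : D.mulX e (D.mulX f (D.vacuum ε)) t = 0 := by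
  by_contra hne
  have h1 := (mulX_apply_ne_zero (mulX_apply_ne_zero hne).2).2
  exact h (congrArg State.res (eq_vac_of_vacuum_ne_zero h1))

end LinkDiagram

namespace BraidWord

open LinkDiagram

variable {p q : ℕ}

/-! ### The initial cycle -/

/-- A cycle on the states of the first six letters. On both resolutions the closing strands at the
positions `0` and `2` carry the factor `X`. -/
noncomputable def initialCycle (hp : 3 ≤ p) (q : ℕ) : (torus p q).closure.State → ℤ :=
  (torus p q).closure.mulX (point hp q 0) ((torus p q).closure.mulX (point hp q 2)
    ((torus p q).closure.vacuum (sixRes p q 0b011011) +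
      (torus p q).closure.vacuum (sixRes p q 0b011101)))

section Initial

variable (hp : 3 ≤ p) (hq : 3 ≤ q)

theorem qdeg_vac_zero (p q : ℕ) : ((torus p q).closure.vac (sixRes p q 0)).qdeg = p := by
  have h : sixRes p q 0 = fun _ => false := by
    ext r
    simp [sixRes]
  have h' : ((torus p q).closure.vac fun _ => false).height = 0 := by
    unfold State.height
    rw [Finset.card_eq_zero, Finset.filter_eq_empty_iff]
    exact fun k _ h => by cases h
  rw [h, qdeg_vac, card_circle_zero (isPositive_torus p q), h']
  simp

include hp hq in
theorem qdeg_vac_merge {m : ℕ} (g : Fin 6) (hg : m.testBit g = true)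
    (h : reaches m 18 (3 * ((g + 1) % 6) + g % 2 + 1) (3 * g + g % 2) = true) :
    ((torus p q).closure.vac (sixRes p q m)).qdeg =
      ((torus p q).closure.vac (sixRes p q (m ^^^ 2 ^ (g : ℕ)))).qdeg := by
  have := qdeg_vac_update (isPlanar_closure (isPositive_torus p q))
    (sixRes_flip_letter hp hq hg)
  rwa [sixRes_flip hp hq hg, if_neg (not_conn_of_reaches hp hq hg h), add_zero] at this

include hp hq in
theorem qdeg_vac_split {m : ℕ} (g : Fin 6) (hg : m.testBit g = true)
    (h : reaches (m ^^^ 2 ^ (g : ℕ)) 18 (3 * ((g + 1) % 6) + g % 2 + 1) (3 * g + g % 2) = true) :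
    ((torus p q).closure.vac (sixRes p q m)).qdeg =
      ((torus p q).closure.vac (sixRes p q (m ^^^ 2 ^ (g : ℕ)))).qdeg + 2 := by
  have := qdeg_vac_update (isPlanar_closure (isPositive_torus p q))
    (sixRes_flip_letter hp hq hg)
  rwa [sixRes_flip hp hq hg, if_pos (conn_crossing_of_reaches hp hq g h)] at this

include hp hq in
theorem qdeg_vac_left : ((torus p q).closure.vac (sixRes p q 0b011011)).qdeg = p + 2 + 2 := by
  rw [qdeg_vac_split hp hq (m := 0b011011) 4 (by decide) (by decide)]
  change ((torus p q).closure.vac (sixRes p q 0b001011)).qdeg + 2 = _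
  rw [qdeg_vac_split hp hq (m := 0b001011) 3 (by decide) (by decide)]
  change ((torus p q).closure.vac (sixRes p q 0b000011)).qdeg + 2 + 2 = _
  rw [qdeg_vac_merge hp hq (m := 0b000011) 1 (by decide) (by decide)]
  change ((torus p q).closure.vac (sixRes p q 0b000001)).qdeg + 2 + 2 = _
  rw [qdeg_vac_merge hp hq (m := 0b000001) 0 (by decide) (by decide)]
  change ((torus p q).closure.vac (sixRes p q 0)).qdeg + 2 + 2 = _
  rw [qdeg_vac_zero]

include hp hq in
theorem qdeg_vac_right : ((torus p q).closure.vac (sixRes p q 0b011101)).qdeg = p + 2 + 2 := by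
  rw [qdeg_vac_split hp hq (m := 0b011101) 4 (by decide) (by decide)]
  change ((torus p q).closure.vac (sixRes p q 0b001101)).qdeg + 2 = _
  rw [qdeg_vac_merge hp hq (m := 0b001101) 3 (by decide) (by decide)]
  change ((torus p q).closure.vac (sixRes p q 0b000101)).qdeg + 2 = _
  rw [qdeg_vac_split hp hq (m := 0b000101) 2 (by decide) (by decide)]
  change ((torus p q).closure.vac (sixRes p q 0b000001)).qdeg + 2 + 2 = _
  rw [qdeg_vac_merge hp hq (m := 0b000001) 0 (by decide) (by decide)]
  change ((torus p q).closure.vac (sixRes p q 0)).qdeg + 2 + 2 = _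
  rw [qdeg_vac_zero]

include hq in
/-- The letter `g` merges circles if the resolution `m` follows by using it. -/
theorem edgeMap_vacuum_sixRes {m : ℕ} (g : Fin 6) (hg : m.testBit g = true)
    (h : reaches m 18 (3 * ((g + 1) % 6) + g % 2 + 1) (3 * g + g % 2) = true) :
    (torus p q).closure.edgeMap (letter hp hq g)
      ((torus p q).closure.vacuum (sixRes p q (m ^^^ 2 ^ (g : ℕ)))) =
      (torus p q).closure.vacuum (sixRes p q m) := by
  rw [edgeMap_vacuum_merge (sixRes_flip_letter hp hq hg) (not_conn_of_reaches hp hq hg h)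
    (isPlanar_closure (isPositive_torus p q)), sixRes_flip hp hq hg]

theorem mulX_mulX_edgeMap_vacuum_sixRes {m : ℕ} (g : Fin 6) (hg : m.testBit g = true)
    (h : reaches m 18 0 2 = true) :
    (torus p q).closure.mulX (point hp q 0) ((torus p q).closure.mulX (point hp q 2)
      ((torus p q).closure.edgeMap (letter hp hq g)
        ((torus p q).closure.vacuum (sixRes p q (m ^^^ 2 ^ (g : ℕ)))))) = 0 := by
  refine mulX_mulX_edgeMap_vacuum ?_
  rw [sixRes_flip hp hq hg]
  exact conn_of_reaches hp hq (by norm_num) h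

theorem pos_lt_three_iff_of_conn {ε : Fin (torus p q).closure.n → Bool}
    (hε : (torus p q).closure.InBox ∅ (firstSix p q) ε) {x y : (torus p q).closure.Edge}
    (h : (torus p q).closure.Conn ε x y) : pos x < 3 ↔ pos y < 3 := by
  have h2 : 2 ∉ cols ε := fun h2 => by
    obtain ⟨k, hk, hk'⟩ := mem_cols.1 h2
    have := (hε.2 k hk).1
    omega
  have := pos_le_iff_of_conn (isPositive_torus p q) h2 h
  omega

theorem not_conn_point {ε : Fin (torus p q).closure.n → Bool}
    (hε : (torus p q).closure.InBox ∅ (firstSix p q) ε) {n : ℕ} {x : (torus p q).closure.Edge}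
    (hx : 3 ≤ pos x) : ¬ (torus p q).closure.Conn ε x (point hp q n) := fun h => by
  have := pos_lt_three_iff_of_conn hε h
  rw [pos_point] at this
  omega

include hq in
theorem isPartialCycle_initialCycle : (torus p q).closure.IsPartialCycle (firstSix p q)
    (strandsFrom (torus p q) 3) p (initialCycle hp q) := by
  have hw := isPositive_torus p q
  have hD := isPlanar_closure hw
  constructor
  · have hfar : ∀ n, ∀ ε, (torus p q).closure.InBox ∅ (firstSix p q) ε →
        ∀ x ∈ ((strandsFrom (torus p q) 3 : Finset _) : Set _),
        x ∈ ((strandsFrom (torus p q) 3 : Finset _) : Set _) ∧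
        ¬ (torus p q).closure.Conn ε x (point hp q n) := fun n ε hε x hx =>
      ⟨hx, not_conn_point hp hε (mem_strandsFrom.1 (Finset.mem_coe.1 hx)).2⟩
    have hvac : ∀ s, ((torus p q).closure.vacuum (sixRes p q 0b011011) +
        (torus p q).closure.vacuum (sixRes p q 0b011101)) s ≠ 0 → s ∈ (torus p q).closure.box ∅
          (firstSix p q) (strandsFrom (torus p q) 3) (p + 2 + 2) := by
      intro s hs
      rw [Pi.add_apply] at hs
      by_cases h1 : (torus p q).closure.vacuum (sixRes p q 0b011011) s = 0
      · rw [h1, zero_add] at hs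
        rw [eq_vac_of_vacuum_ne_zero hs]
        exact ⟨inBox_sixRes p q _, fun _ _ => rfl, qdeg_vac_right hp hq⟩
      · rw [eq_vac_of_vacuum_ne_zero h1]
        exact ⟨inBox_sixRes p q _, fun _ _ => rfl, qdeg_vac_left hp hq⟩
    intro s hs
    have := mem_box_of_mulX_ne_zero
      (fun s hs => mem_box_of_mulX_ne_zero hvac (hfar 2) hs) (hfar 0) hs
    rwa [show (p : ℤ) + 2 + 2 - 2 - 2 = p by ring] at this
  · intro t ht
    have hE : ∀ g : Fin 6, (torus p q).closure.edgeMap (letter hp hq g) (initialCycle hp q) =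
        (torus p q).closure.mulX (point hp q 0) ((torus p q).closure.mulX (point hp q 2)
          ((torus p q).closure.edgeMap (letter hp hq g)
            ((torus p q).closure.vacuum (sixRes p q 0b011011)))) +
        (torus p q).closure.mulX (point hp q 0) ((torus p q).closure.mulX (point hp q 2)
          ((torus p q).closure.edgeMap (letter hp hq g)
            ((torus p q).closure.vacuum (sixRes p q 0b011101)))) := fun g => by
      rw [initialCycle, edgeMap_mulX hD, edgeMap_mulX hD, map_add, map_add, map_add]
    have hT : ∀ (m : ℕ) (g : Fin 6), m.testBit g = true →
        (torus p q).closure.edgeMap (letter hp hq g)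
          ((torus p q).closure.vacuum (sixRes p q m)) = 0 := fun m g hg =>
      edgeMap_vacuum_of_true ((sixRes_letter hp hq g).trans hg)
    -- the letters `2` and `1` lead to the same resolution `011111`, with opposite signs; the letter
    -- `5` connects the two circles that carry the factor `X`
    have l2 := edgeMap_vacuum_sixRes hp hq (m := 0b011111) 2 (by decide) (by decide)
    have l5 := mulX_mulX_edgeMap_vacuum_sixRes hp hq (m := 0b111011) 5 (by decide) (by decide)
    have r1 := edgeMap_vacuum_sixRes hp hq (m := 0b011111) 1 (by decide) (by decide)
    have r5 := mulX_mulX_edgeMap_vacuum_sixRes hp hq (m := 0b111101) 5 (by decide) (by decide)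
    change (torus p q).closure.edgeMap _
      ((torus p q).closure.vacuum (sixRes p q 0b011011)) = _ at l2
    change (torus p q).closure.edgeMap _
      ((torus p q).closure.vacuum (sixRes p q 0b011101)) = _ at r1
    change _ = (0 : (torus p q).closure.State → ℤ) at l5 r5
    rw [show (0b111011 ^^^ 2 ^ ((5 : Fin 6) : ℕ) : ℕ) = 0b011011 from rfl] at l5
    rw [show (0b111101 ^^^ 2 ^ ((5 : Fin 6) : ℕ) : ℕ) = 0b011101 from rfl] at r5
    rw [differential_eq_sum_letter hp hq _ ht, Fin.sum_univ_six]
    simp only [hE]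
    rw [hT 0b011011 0 (by decide), hT 0b011011 1 (by decide), hT 0b011011 3 (by decide),
      hT 0b011011 4 (by decide), hT 0b011101 0 (by decide), hT 0b011101 2 (by decide),
      hT 0b011101 3 (by decide), hT 0b011101 4 (by decide), l2, l5, r1, r5]
    simp only [map_zero, add_zero, zero_add, Pi.zero_apply, mul_zero]
    by_cases hres : t.res = sixRes p q 0b011111
    · rw [hres, cubeSign_sixRes, cubeSign_sixRes, show sixSign 0b011111 (1 : Fin 6) = -1 by decide,
        show sixSign 0b011111 (2 : Fin 6) = 1 by decide]
      ring
    · rw [mulX_mulX_vacuum_apply_of_res_ne hres, mul_zero, mul_zero, add_zero]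

end Initial

end BraidWord

namespace LinkDiagram

variable {D : LinkDiagram}

/-! ### From functions on states to homology -/

/-- The state underlying a generator of a chain group. -/
def Gen.state {i j : ℤ} (s : D.Gen i j) : D.State := Subtype.val s

/-- A state as a generator of a chain group. -/
def Gen.of {i j : ℤ} (s : D.State) (h : (s.height : ℤ) = i ∧ s.qdeg = j) : D.Gen i j :=
  Subtype.mk s h

theorem Gen.property {i j : ℤ} (s : D.Gen i j) : (s.state.height : ℤ) = i ∧ s.state.qdeg = j :=
  Subtype.property s

theorem Gen.state_injective {i j : ℤ} :
    Function.Injective (Gen.state : D.Gen i j → D.State) := Subtype.val_injective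

open Classical in
/-- Extension by zero of a chain to a function on all states. -/
noncomputable def extend (D : LinkDiagram) (i j : ℤ) : D.Chain i j →ₗ[ℤ] (D.State → ℤ) where
  toFun c s := if h : (s.height : ℤ) = i ∧ s.qdeg = j then c (Gen.of s h) else 0
  map_add' c c' := by
    ext s
    by_cases h : (s.height : ℤ) = i ∧ s.qdeg = j
    · simp only [dif_pos h, Pi.add_apply]
    · simp only [dif_neg h, Pi.add_apply, add_zero]
  map_smul' a c := by
    ext s
    by_cases h : (s.height : ℤ) = i ∧ s.qdeg = j
    · simp only [dif_pos h, Pi.smul_apply, RingHom.id_apply]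
    · simp only [dif_neg h, Pi.smul_apply, smul_zero]

theorem extend_apply {i j : ℤ} (c : D.Chain i j) (s : D.Gen i j) : D.extend i j c s.state = c s :=
  dif_pos s.property

theorem extend_apply_of_not {i j : ℤ} (c : D.Chain i j) {s : D.State}
    (h : ¬ ((s.height : ℤ) = i ∧ s.qdeg = j)) : D.extend i j c s = 0 :=
  dif_neg h

theorem diff_apply (i i' j : ℤ) (c : D.Chain i j) (t : D.Gen i' j) :
    D.diff i i' j c t = D.differential (D.extend i j c) t.state := by
  classical
  have h : D.diff i i' j c t = ∑ s : D.Gen i j, D.diffCoeff s.state t.state * c s := rfl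
  rw [h, differential_apply]
  have hs : ∀ s : D.Gen i j, D.diffCoeff s.state t.state * c s =
      D.diffCoeff s.state t.state * D.extend i j c s.state := fun s => by rw [extend_apply]
  rw [Finset.sum_congr rfl fun s _ => hs s, ← Finset.sum_image (s := Finset.univ)
    (g := Gen.state) (f := fun s => D.diffCoeff s t.state * D.extend i j c s)
    fun _ _ _ _ h => Gen.state_injective h]
  refine Finset.sum_subset (Finset.subset_univ _) fun s _ hs => ?_
  rw [extend_apply_of_not, mul_zero]
  exact fun h => hs (Finset.mem_image.2 ⟨Gen.of s h, Finset.mem_univ _, rfl⟩)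

theorem extend_diff (hD : D.IsPlanar) (i j : ℤ) (c : D.Chain (i - 1) j) :
    D.extend i j (D.diff (i - 1) i j c) = D.differential (D.extend (i - 1) j c) := by
  ext t
  by_cases ht : (t.height : ℤ) = i ∧ t.qdeg = j
  · exact (extend_apply _ (Gen.of t ht)).trans (diff_apply _ _ _ _ _)
  · rw [extend_apply_of_not _ ht, eq_comm]
    by_contra h
    obtain ⟨s, hst, hs⟩ := exists_of_differential_ne_zero h
    have hs' := by_contra fun h => hs (extend_apply_of_not c h)
    refine ht ⟨?_, (qdeg_eq_of_diffCoeff_ne_zero hD hst).trans hs'.2⟩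
    rw [height_eq_of_diffCoeff_ne_zero hst]
    push_cast
    rw [hs'.1]
    ring

/-- A cycle of quantum degree `j` on which a cocycle supported in height `i` does not vanish gives a
class of infinite order. -/
theorem finrank_unnormalizedHomology_pos (hD : D.IsPlanar) {i j : ℤ} {z : D.State → ℤ}
    (hz : D.differential z = 0) (hzj : ∀ s, z s ≠ 0 → s.qdeg = j)
    (φ : (D.State → ℤ) →ₗ[ℤ] ℤ) (hφ : ∀ y, φ (D.differential y) = 0)
    (hφi : ∀ y : D.State → ℤ, (∀ s, (s.height : ℤ) = i → y s = 0) → φ y = 0) (hφz : φ z ≠ 0) :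
    0 < Module.finrank ℤ (D.UnnormalizedHomology i j) := by
  set c : D.Chain i j := fun s => z s.state with hc
  have hcz : ∀ s : D.State, (s.height : ℤ) = i → D.extend i j c s = z s := fun s hs => by
    by_cases hj : s.qdeg = j
    · exact extend_apply c (Gen.of s ⟨hs, hj⟩)
    · rw [extend_apply_of_not c fun h => hj h.2, by_contra fun h => hj (hzj s (Ne.symm h))]
  have hker : c ∈ LinearMap.ker (D.diff i (i + 1) j) := by
    rw [LinearMap.mem_ker]
    ext t
    rw [diff_apply]
    refine Eq.trans ?_ (congrFun hz t.state)
    rw [differential_apply, differential_apply]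
    refine Finset.sum_congr rfl fun s _ => ?_
    by_cases h : D.diffCoeff s t.state = 0
    · rw [h, zero_mul, zero_mul]
    · rw [hcz]
      have h1 := height_eq_of_diffCoeff_ne_zero h
      have h2 := t.property.1
      rw [h1] at h2
      push_cast at h2
      linarith
  set ψ : LinearMap.ker (D.diff i (i + 1) j) →ₗ[ℤ] ℤ :=
    φ ∘ₗ D.extend i j ∘ₗ (LinearMap.ker (D.diff i (i + 1) j)).subtype with hψ
  have hrange : (LinearMap.range (D.diff (i - 1) i j)).submoduleOf
      (LinearMap.ker (D.diff i (i + 1) j)) ≤ LinearMap.ker ψ := by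
    intro y hy
    obtain ⟨x, hx⟩ := hy
    rw [LinearMap.mem_ker]
    change φ (D.extend i j y.1) = 0
    change D.diff (i - 1) i j x = y.1 at hx
    rw [← hx, extend_diff hD, hφ]
  have hψc : ψ ⟨c, hker⟩ = φ z := by
    change φ (D.extend i j c) = φ z
    rw [← sub_eq_zero, ← map_sub]
    exact hφi _ fun s hs => by rw [Pi.sub_apply, hcz s hs, sub_self]
  rw [Nat.pos_iff_ne_zero]
  intro h0
  obtain ⟨a, ha, hac⟩ := Module.finrank_eq_zero_iff.1 h0 (Submodule.Quotient.mk ⟨c, hker⟩)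
  have := congrArg (Submodule.liftQ _ ψ hrange) hac
  rw [map_smul, map_zero, Submodule.liftQ_apply, hψc, smul_eq_mul] at this
  exact (mul_ne_zero ha hφz) this

end LinkDiagram

namespace BraidWord

open LinkDiagram

variable {p q : ℕ}

/-! ### The pairing of the cycle and the cocycle -/

section Pairing

variable (hp : 3 ≤ p) (hq : 3 ≤ q)

theorem pos_point_lt (n : ℕ) : pos (point hp q n) < 3 := Nat.mod_lt _ (by norm_num)

/-- The state that has the label `1` on all strands from the position `3` on, and agrees with
`pointState` on the other strands. -/
noncomputable def loweredState (hp : 3 ≤ p) (q m : ℕ) (o : Option ℕ) : (torus p q).closure.State :=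
  State.ofLabel (sixRes p q m)
    (fun x => if pos x < 3 then (pointState hp q m o).labelAt x else .one) fun x y h => by
      have h1 : (pointState hp q m o).labelAt x = (pointState hp q m o).labelAt y :=
        State.labelAt_congr (by cases o <;> exact h)
      simp only [pos_lt_three_iff_of_conn (inBox_sixRes p q m) h, h1]

theorem loweredState_labelAt (m : ℕ) (o : Option ℕ) {x : (torus p q).closure.Edge}
    (hx : pos x < 3) :
    (loweredState hp q m o).labelAt x = (pointState hp q m o).labelAt x := if_pos hx

/-- The value of the extended cycle at `pointState` is the value of `initialCycle` at
`loweredState`. -/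
theorem raises_pointState (m : ℕ) (o : Option ℕ) :
    Raises (p - 1) (pointState hp q m o) (loweredState hp q m o) where
  res_eq := by cases o <;> rfl
  labelAt_eq x hx := (loweredState_labelAt hp m o hx).symm
  labelAt_X x hx _ := by
    cases o with
    | none => rfl
    | some n =>
      exact State.set_labelAt_of_not_conn (s := (torus p q).closure.allX _) _
        (not_conn_point hp (inBox_sixRes p q m) hx)
  labelAt_one x _ hx := by
    have := pos_lt x
    omega
  labelAt_one' x hx := if_neg (by omega)

theorem initialCycle_apply (t : (torus p q).closure.State) : initialCycle hp q t =
    (torus p q).closure.mulX (point hp q 0) ((torus p q).closure.mulX (point hp q 2)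
      ((torus p q).closure.vacuum (sixRes p q 0b011011))) t +
    (torus p q).closure.mulX (point hp q 0) ((torus p q).closure.mulX (point hp q 2)
      ((torus p q).closure.vacuum (sixRes p q 0b011101))) t := by
  rw [initialCycle, map_add, map_add, Pi.add_apply]

include hp hq in
theorem sixRes_ne {m m' : ℕ} (h : ∃ g : Fin 6, m.testBit g ≠ m'.testBit g) :
    sixRes p q m ≠ sixRes p q m' := fun h' => by
  obtain ⟨g, hg⟩ := h
  rw [← sixRes_letter hp hq, ← sixRes_letter hp hq, h'] at hg
  exact hg rfl

include hq in
theorem initialCycle_loweredState_of_ne {m : ℕ} (o : Option ℕ)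
    (h : ∃ g : Fin 6, m.testBit g ≠ Nat.testBit 0b011011 g)
    (h' : ∃ g : Fin 6, m.testBit g ≠ Nat.testBit 0b011101 g) :
    initialCycle hp q (loweredState hp q m o) = 0 := by
  rw [initialCycle_apply, mulX_mulX_vacuum_apply_of_res_ne (sixRes_ne hp hq h),
    mulX_mulX_vacuum_apply_of_res_ne (sixRes_ne hp hq h'), add_zero]

theorem initialCycle_loweredState_zero :
    initialCycle hp q (loweredState hp q 0b011011 (some 0)) = 0 := by
  have h : (loweredState hp q 0b011011 (some 0)).labelAt (point hp q 0) = .one := by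
    rw [loweredState_labelAt hp _ _ (pos_point_lt hp 0)]
    exact State.set_labelAt_self _ _ _
  rw [initialCycle_apply, mulX_apply_one h, mulX_apply_one h, add_zero]

include hq in
/-- The three circles of the resolution `011011` of the first three strands. -/
theorem not_conn_points :
    ¬ (torus p q).closure.Conn (sixRes p q 0b011011) (point hp q 0) (point hp q 7) ∧
    ¬ (torus p q).closure.Conn (sixRes p q 0b011011) (point hp q 2) (point hp q 7) ∧
    ¬ (torus p q).closure.Conn (sixRes p q 0b011011) (point hp q 2) (point hp q 0) := by
  have hw := isPositive_torus p q
  have ha := conn_point_a hp hq (m := 0b011011) 1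
  have h7 : (torus p q).closure.Conn (sixRes p q 0b011011) (point hp q 7)
      ((torus p q).closure.crossing (letter hp hq 1)).a :=
    (conn_of_reaches hp hq (i := 18) (n := 7) (n' := 8) (by norm_num) (by decide)).trans ha
  have hiff := fun e => conn_a_iff hw (ε := sixRes p q 0b011011) (k := letter hp hq 1)
    (k' := letter hp hq 3) (letterIndex_strictMono hp (by decide))
    (by rw [col_letter, col_letter]; rfl) (by rw [sixRes_letter]; decide)
    (by rw [sixRes_letter]; decide) (fun r h1 h2 hr => by
      obtain ⟨g, rfl, -⟩ := exists_letter hp hq (mem_firstSix_of_sixRes hr)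
      have h1' : 1 < (g : ℕ) := (letterIndex_strictMono hp).lt_iff_lt.1 h1
      have h2' : (g : ℕ) < 3 := (letterIndex_strictMono hp).lt_iff_lt.1 h2
      rw [sixRes_letter, show (g : ℕ) = 2 by omega] at hr
      exact absurd hr (by decide)) (e := e)
  -- the circle of the point `7` lies between the letters `1` and `3`
  have hlow : ∀ n < 3, ¬ (torus p q).closure.Conn (sixRes p q 0b011011) (point hp q n)
      (point hp q 7) := fun n hn h => by
    have := (hiff _).1 (h.trans h7).symm
    rw [lev_point hp hq (by omega), Nat.div_eq_of_lt hn] at this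
    exact absurd this.1 (Nat.not_lt_zero _)
  refine ⟨hlow 0 (by norm_num), hlow 2 (by norm_num), fun h => ?_⟩
  -- the letter `4` splits off the circle of the point `0` from that of the point `2`
  have h4 : ¬ (torus p q).closure.Conn (sixRes p q 0b011011)
      ((torus p q).closure.crossing (letter hp hq 4)).a
      ((torus p q).closure.crossing (letter hp hq 4)).c := by
    rw [← sixRes_flip hp hq (m := 0b011011) (g := 4) (by decide), isPlanar_closure hw _ _
      (sixRes_flip_letter hp hq (by decide)), not_not]
    exact conn_crossing_of_reaches hp hq 4 (by decide)
  have h1 := conn_of_reaches hp hq (i := 18) (m := 0b011011) (n := 0) (n' := 16) (by norm_num)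
    (by decide)
  have h2 := conn_of_reaches hp hq (i := 18) (m := 0b011011) (n := 2) (n' := 12) (by norm_num)
    (by decide)
  exact h4 ((conn_point_a hp hq 4).symm.trans
    (h1.symm.trans (h.symm.trans (h2.trans (conn_point_c hp hq 4)))))

include hq in
theorem initialCycle_loweredState_seven :
    initialCycle hp q (loweredState hp q 0b011011 (some 7)) = 1 := by
  obtain ⟨h07, h27, h20⟩ := not_conn_points hp hq
  have hlab : ∀ n < 3, ¬ (torus p q).closure.Conn (sixRes p q 0b011011) (point hp q n)
      (point hp q 7) → (loweredState hp q 0b011011 (some 7)).labelAt (point hp q n) = .X :=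
    fun n _ h => (loweredState_labelAt hp _ _ (pos_point_lt hp n)).trans
      (State.set_labelAt_of_not_conn (s := (torus p q).closure.allX _) _ h)
  have hX := hlab 0 (by norm_num) h07
  have hX' : ((loweredState hp q 0b011011 (some 7)).set (point hp q 0) .one).labelAt
      (point hp q 2) = .X :=
    (State.set_labelAt_of_not_conn _ h20).trans (hlab 2 (by norm_num) h27)
  rw [initialCycle_apply, mulX_mulX_vacuum_apply_of_res_ne (ε := sixRes p q 0b011101)
      (sixRes_ne (m := 0b011011) hp hq ⟨1, by decide⟩),
    add_zero, mulX_apply_X hX, mulX_apply_X hX', vacuum_apply]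
  classical
  refine (if_congr Iff.rfl rfl rfl).trans (if_pos ⟨rfl, fun x => ?_⟩)
  rw [State.set_labelAt, State.set_labelAt]
  split_ifs with h2 h0
  · rfl
  · rfl
  · by_cases hx : pos x < 3
    · obtain ⟨n, hn, hnx⟩ := exists_conn_point hp hq (m := 0b011011) hx
      have key : ∀ n < 18, reaches 0b011011 18 n 0 = true ∨ reaches 0b011011 18 n 2 = true ∨
          reaches 0b011011 18 n 7 = true := by decide
      rcases key n hn with h | h | h
      · exact absurd (hnx.symm.trans (conn_of_reaches hp hq hn h)) h0
      · exact absurd (hnx.symm.trans (conn_of_reaches hp hq hn h)) h2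
      · exact (loweredState_labelAt hp _ _ hx).trans
          (State.set_labelAt_of_conn (s := (torus p q).closure.allX _) _
            (hnx.symm.trans (conn_of_reaches hp hq hn h)))
    · exact if_neg hx

include hq in
theorem height_pointState (m : ℕ) (o : Option ℕ) : (pointState hp q m o).height =
    (Finset.univ.filter fun g : Fin 6 => m.testBit g = true).card := by
  classical
  have hres : (pointState hp q m o).res = sixRes p q m := by cases o <;> rfl
  unfold State.height
  rw [hres, ← Finset.card_image_of_injective _ (letter_injective hp hq)]
  congr 1
  ext r
  simp only [Finset.mem_filter, Finset.mem_univ, true_and, Finset.mem_image]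
  constructor
  · intro hr
    obtain ⟨g, rfl, -⟩ := exists_letter hp hq (mem_firstSix_of_sixRes hr)
    exact ⟨g, by rwa [sixRes_letter] at hr, rfl⟩
  · rintro ⟨g, hg, rfl⟩
    rwa [sixRes_letter]

/-- The pairing with a list of coefficients, resolutions and points, as a linear map. -/
noncomputable def pairingMap (hp : 3 ≤ p) (q : ℕ) (l : List (ℤ × ℕ × Option ℕ)) :
    ((torus p q).closure.State → ℤ) →ₗ[ℤ] ℤ where
  toFun := pairing hp q l
  map_add' y z := by
    unfold pairing
    induction l with
    | nil => simp
    | cons u l ih =>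
      simp only [List.map_cons, List.sum_cons]
      rw [ih, Pi.add_apply]
      ring
  map_smul' a z := by
    unfold pairing
    induction l with
    | nil => simp
    | cons u l ih =>
      simp only [List.map_cons, List.sum_cons]
      rw [ih]
      simp only [Pi.smul_apply, smul_eq_mul, RingHom.id_apply]
      ring

end Pairing

end BraidWord

open LinkDiagram BraidWord in
/-- The homology group of the unnormalized complex has positive rank. -/
theorem finrank_unnormalizedHomology_torus_pos (p q : ℕ) (hp : 3 ≤ p) (hq : 3 ≤ q) :
    0 < Module.finrank ℤ ((torus p q).closure.UnnormalizedHomology 4 (6 - p)) := by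
  have hD := isPlanar_closure (isPositive_torus p q)
  obtain ⟨z, hz, hzt⟩ := exists_columns hp (by omega) (isPartialCycle_initialCycle hp hq) (p - 1)
    (by omega) (by omega)
  refine finrank_unnormalizedHomology_pos hD (z := z) (funext fun t => ?_) (fun s hs => ?_)
    (pairingMap hp q cocycle) (fun y => pairing_cocycle_differential hp hq) (fun y hy => ?_) ?_
  · exact hz.differential_eq_zero t ⟨fun _ h => h.elim, fun r _ => by
      have := col_lt r
      show col (torus p q) r < p - 1
      omega⟩
  · rw [(hz.mem_box s hs).2.2, Nat.cast_sub (by omega)]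
    push_cast
    ring
  · have h4 : ∀ u ∈ cocycle,
        (Finset.univ.filter fun g : Fin 6 => u.2.1.testBit g = true).card = 4 := by decide
    have h0 : ∀ u ∈ cocycle, u.1 * y (pointState hp q u.2.1 u.2.2) = 0 := fun u hu => by
      rw [hy, mul_zero]
      rw [height_pointState hp hq, h4 u hu]
      rfl
    change (cocycle.map fun u => u.1 * y (pointState hp q u.2.1 u.2.2)).sum = 0
    rw [List.map_congr_left h0]
    simp
  · have hv : ∀ m o, z (pointState hp q m o) = initialCycle hp q (loweredState hp q m o) :=
      fun m o => hzt _ _ (by cases o <;> exact inBox_sixRes p q m) (raises_pointState hp m o)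
    change (cocycle.map fun u => u.1 * z (pointState hp q u.2.1 u.2.2)).sum ≠ 0
    -- only the resolution `011011` is common to the cycle and the cocycle
    simp only [cocycle, List.map_cons, List.map_nil, List.sum_cons, List.sum_nil, hv]
    rw [initialCycle_loweredState_zero hp, initialCycle_loweredState_seven hp hq]
    repeat rw [initialCycle_loweredState_of_ne hp hq _ (by decide) (by decide)]
    norm_num

open LinkDiagram BraidWord in
theorem theorem20 (p q : ℕ) (hp : 3 ≤ p) (hpq : p ≤ q) :
    0 < Module.finrank ℤ
      ((torusLink p q).KhovanovHomology 4 (((p : ℤ) - 1) * ((q : ℤ) - 1) + 5)) := by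
  have hw := isPositive_torus p q
  have hpos : ∀ k, ((torusLink p q).crossing k).positive = true := fun k =>
    congrArg Crossing.positive (crossing_eq hw k)
  have hneg : (torusLink p q).nNeg = 0 := by
    unfold nNeg
    rw [Finset.card_eq_zero, Finset.filter_eq_empty_iff]
    intro k _ h
    rw [hpos] at h
    cases h
  have hn : (torusLink p q).nPos = q * (p - 1) := by
    unfold nPos
    rw [Finset.filter_true_of_mem fun k _ => hpos k, Finset.card_univ, Fintype.card_fin]
    exact length_torus p q
  have h := finrank_unnormalizedHomology_torus_pos p q hp (hp.trans hpq)
  unfold KhovanovHomology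
  rw [hneg, hn]
  have h1 : (4 : ℤ) + ((0 : ℕ) : ℤ) = 4 := by norm_num
  have h2 : ((p : ℤ) - 1) * ((q : ℤ) - 1) + 5 - ((q * (p - 1) : ℕ) : ℤ) + 2 * ((0 : ℕ) : ℤ) =
      6 - p := by
    rw [Nat.cast_mul, Nat.cast_sub (by omega)]
    push_cast
    ring
  rw [h1, h2]
  exact h
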